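/- Let $R$ be a commutative artinian ring and let $\Lambda$ be an Artin $R$-algebra, i.e. an $R$-algebra that is finitely generated as an $R$-module. Let $\mathrm{mod}(\Lambda)$ and $\mathrm{proj}(\Lambda)$ be the categories of finitely generated, respectively finitely generated projective, left $\Lambda$-modules. For $M\in\mathrm{mod}(\Lambda)$ let $$\cdots\to P^{-2}(M)\to P^{-1}(M)\xrightarrow{\pi_M^{-1}}P^0(M)\to M\to 0$$ be a minimal projective resolution, let $P^\bullet(M)$ be the complex $\cdots\to P^{-1}(M)\to P^0(M)\to 0\to\cdots$, let $P^\bullet_{\geq -n}(M)$ be its truncation, which agrees with $P^\bullet(M)$ in degrees $\geq -n$ and is zero in degrees $<-n$, and let $\Omega^i(M)$ be the $i$-th syzygy of $M$ in this resolution ($\Omega^0(M)=M$). Let $D=\mathrm{Hom}_R(-,J)$, where $J$ is the injective envelope of $R/\mathrm{rad}(R)$, let $\nu=D\,\mathrm{Hom}_\Lambda(-,\Lambda)$ on $\mathrm{proj}(\Lambda)$, and put $\tau(M)=\mathrm{Ker}(\nu(\pi_M^{-1}))$ and $\tau_n(M)=\tau(\Omega^{n-1}(M))$ for $n\geq 1$.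 A complex $P^\bullet\in\mathsf{K}^b(\mathrm{proj}(\Lambda))$ is silting if $\mathrm{Hom}(P^\bullet,P^\bullet[i])=0$ for all $i>0$ and the smallest triangulated subcategory (closed under isomorphisms) of $\mathsf{K}^b(\mathrm{proj}(\Lambda))$ containing all direct summands of finite direct sums of copies of $P^\bullet$ is $\mathsf{K}^b(\mathrm{proj}(\Lambda))$ itself. For $n\geq 1$, a module $M\in\mathrm{mod}(\Lambda)$ is $\tau_n$-tilting if $P^\bullet_{\geq -n}(M)$ is silting in $\mathsf{K}^b(\mathrm{proj}(\Lambda))$, and $\tau_n$-rigid if $\mathrm{Hom}_\Lambda(M,\tau_n(M))=0$ and $\mathrm{Ext}^i_\Lambda(M,M)=0$ for all $1\leq i\leq n-1$. It is sincere if every simple $\Lambda$-module is a composition factor of $M$. Finally, $rk(M)$ is the number of pairwise non-isomorphic indecomposable direct summands of $M$, and $rk(\Lambda)=rk({}_\Lambda\Lambda)$. Theorem. Let $n\geq 1$ and let $M\in\mathrm{mod}(\Lambda)$ be $\tau_n$-tilting. Then: (a) $M$ is sincere and $rk(M)=rk(\Lambda)$; (b) $M$ is not $\tau_{n+1}$-rigid,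 or $\mathrm{pd}(M)\leq n$. -/

import Mathlib

universe u v

open CategoryTheory Limits Pretriangulated ZeroObject

noncomputable section

namespace TauTilting

/-! ### Silting objects in triangulated categories -/

section Silting

variable {C : Type*} [Category C] [HasZeroObject C] [HasShift C ℤ] [Preadditive C]
  [∀ n : ℤ, (shiftFunctor C n).Additive] [Pretriangulated C]

/-- `add(X)`: the direct summands of finite direct sums of copies of `X`. -/
def addClosure (X : C) : ObjectProperty C := fun Y =>
  ∃ (m : ℕ) (Z : C), Nonempty (Y ⊞ Z ≅ ⨁ fun _ : Fin m => X)

/-- `X` is presilting: `Hom(X, X[i]) = 0` for all `i > 0`. -/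
def IsPresilting (X : C) : Prop :=
  ∀ i : ℤ, 0 < i → ∀ f : X ⟶ X⟦i⟧, f = 0

/-- `X` is silting: it is presilting and the smallest (strictly full) triangulated subcategory
containing `add(X)` is the whole category. -/
structure IsSilting (X : C) : Prop where
  presilting : IsPresilting X
  generates : ∀ S : ObjectProperty C, S.IsTriangulated → S.IsClosedUnderIsomorphisms →
    addClosure X ≤ S → S = ⊤

end Silting

/-! ### The triangulated category `K^b(proj Λ)` -/

section Kb

variable (Λ : Type u) [Ring Λ]

/-- Bounded cochain complexes of finitely generated projective (left) `Λ`-modules. -/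
structure IsBoundedProj (K : CochainComplex (ModuleCat.{u} Λ) ℤ) : Prop where
  bddBelow : ∃ a : ℤ, K.IsStrictlyGE a
  bddAbove : ∃ b : ℤ, K.IsStrictlyLE b
  projective : ∀ i : ℤ, Module.Projective Λ (K.X i)
  finite : ∀ i : ℤ, Module.Finite Λ (K.X i)

/-- The objects of the homotopy category of `Λ`-modules given by bounded complexes of
finitely generated projective modules. -/
def kbProj : ObjectProperty (HomotopyCategory (ModuleCat.{u} Λ) (.up ℤ)) :=
  ObjectProperty.strictMap (IsBoundedProj Λ) (HomotopyCategory.quotient _ _)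

variable {Λ}

lemma kbProj_quotient_obj_iff (K : CochainComplex (ModuleCat.{u} Λ) ℤ) :
    kbProj Λ ((HomotopyCategory.quotient _ _).obj K) ↔ IsBoundedProj Λ K := by
  refine ⟨?_, fun h => ⟨_, h⟩⟩
  simp only [kbProj, ObjectProperty.strictMap_iff]
  rintro ⟨L, h, hL⟩
  obtain rfl : L = K := congr_arg Quotient.as hL
  exact h

lemma IsBoundedProj.zero : IsBoundedProj Λ (0 : CochainComplex (ModuleCat.{u} Λ) ℤ) := by
  have h : ∀ i : ℤ, IsZero ((0 : CochainComplex (ModuleCat.{u} Λ) ℤ).X i) := fun i =>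
    (HomologicalComplex.eval _ _ i).map_isZero (isZero_zero _)
  have h' : ∀ i : ℤ, Subsingleton ((0 : CochainComplex (ModuleCat.{u} Λ) ℤ).X i) := fun i =>
    ModuleCat.isZero_iff_subsingleton.1 (h i)
  refine ⟨⟨0, inferInstance⟩, ⟨0, inferInstance⟩, fun i => ?_, fun i => ?_⟩
  · have := h' i
    infer_instance
  · have := h' i
    infer_instance

lemma IsBoundedProj.shift {K : CochainComplex (ModuleCat.{u} Λ) ℤ} (hK : IsBoundedProj Λ K)
    (n : ℤ) : IsBoundedProj Λ (K⟦n⟧) := by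
  obtain ⟨⟨a, _⟩, ⟨b, _⟩, hp, hf⟩ := hK
  exact ⟨⟨a - n, K.isStrictlyGE_shift a n _ (by lia)⟩,
    ⟨b - n, K.isStrictlyLE_shift b n _ (by lia)⟩, fun i => hp (i + n), fun i => hf (i + n)⟩

lemma IsBoundedProj.mappingCone {K L : CochainComplex (ModuleCat.{u} Λ) ℤ} (f : K ⟶ L)
    (hK : IsBoundedProj Λ K) (hL : IsBoundedProj Λ L) :
    IsBoundedProj Λ (CochainComplex.mappingCone f) := by
  obtain ⟨⟨a, _⟩, ⟨b, _⟩, hp, hf⟩ := hK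
  obtain ⟨⟨a', _⟩, ⟨b', _⟩, hp', hf'⟩ := hL
  have e : ∀ i : ℤ, Nonempty
      ((CochainComplex.mappingCone f).X i ≃ₗ[Λ] (K.X (i + 1) × L.X i)) := fun i =>
    ⟨(HomologicalComplex.homotopyCofiber.XIsoBiprod f i (i + 1) rfl ≪≫
      ModuleCat.biprodIsoProd _ _).toLinearEquiv⟩
  refine ⟨⟨min (a - 1) a', ?_⟩, ⟨max (b - 1) b', ?_⟩, fun i => ?_, fun i => ?_⟩
  · rw [CochainComplex.isStrictlyGE_iff]
    intro i hi
    rw [lt_min_iff] at hi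
    rw [CochainComplex.mappingCone.isZero_X_iff]
    exact ⟨K.isZero_of_isStrictlyGE a _ (by lia), L.isZero_of_isStrictlyGE a' _ (by lia)⟩
  · rw [CochainComplex.isStrictlyLE_iff]
    intro i hi
    rw [max_lt_iff] at hi
    rw [CochainComplex.mappingCone.isZero_X_iff]
    exact ⟨K.isZero_of_isStrictlyLE b _ (by lia), L.isZero_of_isStrictlyLE b' _ (by lia)⟩
  · have := hp (i + 1)
    have := hp' i
    exact Module.Projective.of_equiv (e i).some.symm
  · have := hf (i + 1)
    have := hf' i
    exact Module.Finite.equiv (e i).some.symm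

instance : (kbProj Λ).ContainsZero where
  exists_zero := ⟨(HomotopyCategory.quotient _ _).obj 0,
    Functor.map_isZero _ (isZero_zero _), (kbProj_quotient_obj_iff _).2 .zero⟩

instance : (kbProj Λ).IsStableUnderShift ℤ where
  isStableUnderShiftBy n :=
    { le_shift := by
        rintro _ ⟨K, hK⟩
        rw [ObjectProperty.prop_shift_iff, HomotopyCategory.shift_quotient_obj]
        exact (kbProj_quotient_obj_iff _).2 (hK.shift n) }

instance : (kbProj Λ).IsTriangulatedClosed₃ where
  ext₃' T hT h₁ h₂ := by
    have h₁' : IsBoundedProj Λ T.obj₁.as := (kbProj_quotient_obj_iff _).1 h₁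
    have h₂' : IsBoundedProj Λ T.obj₂.as := (kbProj_quotient_obj_iff _).1 h₂
    obtain ⟨f, hf⟩ : ∃ f : T.obj₁.as ⟶ T.obj₂.as, (HomotopyCategory.quotient _ _).map f = T.mor₁ :=
      (HomotopyCategory.quotient _ _).map_surjective T.mor₁
    refine ⟨_, (kbProj_quotient_obj_iff _).2 (h₁'.mappingCone f h₂'),
      ⟨Triangle.π₃.mapIso (isoTriangleOfIso₁₂ T _ hT
        (HomotopyCategory.mappingCone_triangleh_distinguished f) (Iso.refl _) (Iso.refl _) ?_)⟩⟩
    exact (Category.comp_id _).trans (hf.symm.trans (Category.id_comp _).symm)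

instance : (kbProj Λ).IsTriangulated where
  toIsTriangulatedClosed₂ := .of_isTriangulatedClosed₃

variable (Λ)

/-- `K^b(proj Λ)`, with the triangulated structure inherited from the homotopy category. -/
abbrev KbProj := (kbProj Λ).FullSubcategory

variable {Λ}

/-- A bounded complex of finitely generated projective modules, as an object of `K^b(proj Λ)`. -/
def KbProj.mk (K : CochainComplex (ModuleCat.{u} Λ) ℤ) (hK : IsBoundedProj Λ K) : KbProj Λ :=
  ⟨(HomotopyCategory.quotient _ _).obj K, (kbProj_quotient_obj_iff K).2 hK⟩

end Kb

/-! ### Minimal projective resolutions -/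

section Resolution

variable {Λ : Type u} [Ring Λ]

/-- A superfluous (small) submodule. -/
def IsSuperfluous {P : Type*} [AddCommGroup P] [Module Λ P] (K : Submodule Λ P) : Prop :=
  ∀ N : Submodule Λ P, N ⊔ K = ⊤ → N = ⊤

/-- A minimal projective resolution `⋯ ⟶ P₁ ⟶ P₀ ⟶ M ⟶ 0` by finitely generated modules:
`P₀ ⟶ M` and all the corestrictions `P_{i+1} ⟶ Im(P_{i+1} ⟶ P_i)` are projective covers. -/
structure MinProjRes (M : ModuleCat.{u} Λ) extends ProjectiveResolution M where
  finite : ∀ i : ℕ, Module.Finite Λ (complex.X i)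
  superfluous_zero : IsSuperfluous (LinearMap.ker (π.f 0).hom)
  superfluous_succ : ∀ i : ℕ, IsSuperfluous (LinearMap.ker (complex.d (i + 1) i).hom)

namespace MinProjRes

variable {M : ModuleCat.{u} Λ} (P : MinProjRes M)

/-- The syzygy `Ω^i(M)`: `Ω^0(M) = M`, `Ω^1(M) = Ker(P₀ ⟶ M)`,
`Ω^{i+2}(M) = Ker(P_{i+1} ⟶ P_i)`. -/
def syzygy : ℕ → ModuleCat.{u} Λ
  | 0 => M
  | 1 => ModuleCat.of Λ (LinearMap.ker (P.π.f 0).hom)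
  | i + 2 => ModuleCat.of Λ (LinearMap.ker (P.complex.d (i + 1) i).hom)

/-- The truncated complex `P_{≥ -n}(M)`: the module `P_i` sits in cohomological degree `-i` for
`0 ≤ i ≤ n`, and all the other terms are zero. -/
def trunc (n : ℕ) : CochainComplex (ModuleCat.{u} Λ) ℤ :=
  P.toProjectiveResolution.cochainComplex.stupidTrunc
    (ComplexShape.embeddingUpIntGE (-(n : ℤ)))

lemma isBoundedProj_trunc (n : ℕ) : IsBoundedProj Λ (P.trunc n) := by
  have hX : ∀ i : ℤ, IsZero ((P.trunc n).X i) ∨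
      ∃ k : ℕ, Nonempty ((P.trunc n).X i ≅ P.complex.X k) := by
    intro i
    by_cases hi : -(n : ℤ) ≤ i
    · obtain ⟨j, hj⟩ := Int.eq_ofNat_of_zero_le (sub_nonneg.2 hi)
      have e := P.toProjectiveResolution.cochainComplex.stupidTruncXIso
        (ComplexShape.embeddingUpIntGE (-(n : ℤ))) (i := j) (i' := i)
        (show -(n : ℤ) + j = i by lia)
      by_cases hi' : i ≤ 0
      · obtain ⟨k, hk⟩ := Int.exists_eq_neg_ofNat hi'
        exact .inr ⟨k, ⟨e ≪≫ P.toProjectiveResolution.cochainComplexXIso i k (by lia)⟩⟩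
      · exact .inl (IsZero.of_iso
          (P.toProjectiveResolution.cochainComplex.isZero_of_isStrictlyLE 0 i (by lia)) e)
    · refine .inl (HomologicalComplex.isZero_stupidTrunc_X _ _ _ ?_)
      exact (ComplexShape.notMem_range_embeddingUpIntGE_iff _ _).2 (by lia)
  refine ⟨⟨-n, ?_⟩, ⟨0, ?_⟩, fun i => ?_, fun i => ?_⟩
  · rw [CochainComplex.isStrictlyGE_iff]
    intro i hi
    exact HomologicalComplex.isZero_stupidTrunc_X _ _ _
      ((ComplexShape.notMem_range_embeddingUpIntGE_iff _ _).2 hi)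
  · rw [CochainComplex.isStrictlyLE_iff]
    intro i hi
    by_cases hi' : -(n : ℤ) ≤ i
    · obtain ⟨j, hj⟩ := Int.eq_ofNat_of_zero_le (sub_nonneg.2 hi')
      exact IsZero.of_iso (P.toProjectiveResolution.cochainComplex.isZero_of_isStrictlyLE 0 i hi)
        (P.toProjectiveResolution.cochainComplex.stupidTruncXIso
          (ComplexShape.embeddingUpIntGE (-(n : ℤ))) (i := j) (show -(n : ℤ) + j = i by lia))
    · lia
  · obtain h | ⟨k, ⟨e⟩⟩ := hX i
    · have := ModuleCat.isZero_iff_subsingleton.1 h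
      infer_instance
    · have : Module.Projective Λ (P.complex.X k) :=
        (IsProjective.iff_projective _).2 (P.projective k)
      exact Module.Projective.of_equiv e.symm.toLinearEquiv
  · obtain h | ⟨k, ⟨e⟩⟩ := hX i
    · have := ModuleCat.isZero_iff_subsingleton.1 h
      infer_instance
    · have := P.finite k
      exact Module.Finite.equiv e.symm.toLinearEquiv

end MinProjRes

/-- `M` is `τ_n`-tilting: `P_{≥ -n}(M)` is silting in `K^b(proj Λ)`, where `P(M)` is a minimal
projective resolution of `M` (which is unique up to isomorphism). -/
def IsTauTilting (n : ℕ) (M : ModuleCat.{u} Λ) : Prop :=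
  ∃ P : MinProjRes M, IsSilting (KbProj.mk (P.trunc n) (P.isBoundedProj_trunc n))

end Resolution

/-! ### Dualities, the Nakayama functor, and the Auslander-Reiten translation -/

section AR

variable (R : Type v) [CommRing R] {Λ : Type u} [Ring Λ] [Algebra R Λ]
  (J : Type v) [AddCommGroup J] [Module R J]

/-- `(J, ι)` is an injective envelope of the `R`-module `A`. -/
structure IsInjectiveEnvelope {A : Type*} [AddCommGroup A] [Module R A] {J : Type v}
    [AddCommGroup J] [Module R J] (ι : A →ₗ[R] J) : Prop where
  injective : Module.Injective R J
  mono : Function.Injective ι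
  essential : ∀ N : Submodule R J, N ⊓ LinearMap.range ι = ⊥ → N = ⊥

/-- `Hom_R(X, J)` for a right `Λ`-module `X`. -/
def Dual (X : Type*) [AddCommGroup X] [Module R X] : Type _ := X →ₗ[R] J

instance (X : Type*) [AddCommGroup X] [Module R X] : AddCommGroup (Dual R J X) :=
  inferInstanceAs (AddCommGroup (X →ₗ[R] J))

instance (X : Type*) [AddCommGroup X] [Module R X] : FunLike (Dual R J X) X J :=
  inferInstanceAs (FunLike (X →ₗ[R] J) X J)

instance (X : Type*) [AddCommGroup X] [Module R X] : LinearMapClass (Dual R J X) R X J :=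
  inferInstanceAs (LinearMapClass (X →ₗ[R] J) R X J)

/-- The left `Λ`-module structure `(a • φ)(x) = φ(x a)` on `Hom_R(X, J)`. -/
instance (X : Type*) [AddCommGroup X] [Module R X] [Module Λᵐᵒᵖ X] [SMulCommClass Λᵐᵒᵖ R X] :
    Module Λ (Dual R J X) where
  smul a φ := LinearMap.comp (φ : X →ₗ[R] J) (DistribSMul.toLinearMap R X (MulOpposite.op a))
  one_smul φ := DFunLike.ext _ _ fun x => congrArg φ (one_smul Λᵐᵒᵖ x)
  mul_smul a b φ := DFunLike.ext _ _ fun x =>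
    congrArg φ (mul_smul (MulOpposite.op b) (MulOpposite.op a) x)
  smul_zero _ := rfl
  smul_add _ _ _ := rfl
  add_smul a b φ := DFunLike.ext _ _ fun x =>
    (congrArg φ (add_smul (MulOpposite.op a) (MulOpposite.op b) x)).trans (map_add φ _ _)
  zero_smul φ := DFunLike.ext _ _ fun x => (congrArg φ (zero_smul Λᵐᵒᵖ x)).trans (map_zero φ)

/-- The Nakayama functor on objects: `ν(P) = Hom_R(Hom_Λ(P, Λ), J)`, where `Hom_Λ(P, Λ)` is a right
`Λ`-module through the right multiplication of `Λ`. -/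
abbrev Nakayama (P : Type*) [AddCommGroup P] [Module Λ P] : Type _ := Dual R J (P →ₗ[Λ] Λ)

variable {P Q : Type*} [AddCommGroup P] [Module Λ P] [AddCommGroup Q] [Module Λ Q]

/-- The Nakayama functor on morphisms: `ν(f)(φ)(h) = φ(h ∘ f)`. -/
def nakayamaMap (f : P →ₗ[Λ] Q) : Nakayama R (Λ := Λ) J P →ₗ[Λ] Nakayama R (Λ := Λ) J Q where
  toFun φ :=
    { toFun := fun h => φ (h ∘ₗ f)
      map_add' := fun h h' => map_add φ (h ∘ₗ f) (h' ∘ₗ f)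
      map_smul' := fun r h => map_smul φ r (h ∘ₗ f) }
  map_add' _ _ := rfl
  map_smul' _ _ := rfl

/-- The Auslander-Reiten translation `τ(N) = Ker(ν(P₁ ⟶ P₀))`, computed from a minimal projective
resolution `⋯ ⟶ P₁ ⟶ P₀ ⟶ N ⟶ 0`. -/
def MinProjRes.tau {N : ModuleCat.{u} Λ} (P : MinProjRes N) :
    Submodule Λ (Nakayama R (Λ := Λ) J (P.complex.X 1)) :=
  LinearMap.ker (nakayamaMap R J (P.complex.d 1 0).hom)

/-- `M` is `τ_n`-rigid (`n ≥ 1`): `Hom_Λ(M, τ_n(M)) = 0` and `Ext^i_Λ(M, M) = 0` for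
`1 ≤ i ≤ n - 1`, where `τ_n(M) = τ(Ω^{n-1}(M))`. The minimal projective resolutions and the
injective envelope `J` of `R / rad R` which enter `τ_n(M)` are unique up to isomorphism. -/
def IsTauRigid (n : ℕ) (M : ModuleCat.{u} Λ) : Prop :=
  (∃ (P : MinProjRes M) (Q : MinProjRes (P.syzygy (n - 1)))
    (J : Type v) (_ : AddCommGroup J) (_ : Module R J) (ι : (R ⧸ Ring.jacobson R) →ₗ[R] J),
      IsInjectiveEnvelope R ι ∧ ∀ f : M →ₗ[Λ] Q.tau R J, f = 0) ∧
  ∀ i : ℕ, 1 ≤ i → i < n → Subsingleton (Abelian.Ext M M i)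

end AR

/-! ### Sincere modules and the rank -/

section Sincere

variable {Λ : Type u} [Ring Λ]

/-- `S` is a composition factor of `M`: it is isomorphic to a factor of a composition series
`0 = M₀ < M₁ < ⋯ < M_l = M`. -/
def IsCompositionFactor (S M : ModuleCat.{u} Λ) : Prop :=
  ∃ s : CompositionSeries (Submodule Λ M), s.head = ⊥ ∧ s.last = ⊤ ∧
    ∃ i : Fin s.length,
      Nonempty (S ≃ₗ[Λ] (s i.succ ⧸ (s i.castSucc).comap (s i.succ).subtype))

/-- `M` is sincere: every simple module is a composition factor of `M`. -/
def IsSincere (M : ModuleCat.{u} Λ) : Prop :=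
  ∀ S : ModuleCat.{u} Λ, IsSimpleModule Λ S → IsCompositionFactor S M

/-- `rk(M)`: the number of isomorphism classes of indecomposable direct summands of `M`. -/
def rk (M : ModuleCat.{u} Λ) : ℕ∞ :=
  Set.encard {c : Quotient (isIsomorphicSetoid (ModuleCat.{u} Λ)) |
    ∃ N N' : ModuleCat.{u} Λ, c = Quotient.mk _ N ∧ Indecomposable N ∧ Nonempty (N ⊞ N' ≅ M)}

end Sincere

end TauTilting

end

noncomputable section

set_option linter.unusedSectionVars false

namespace TauTilting

/-! ### Vanishing of morphisms and shifts -/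

section Vanishing

variable {C : Type*} [Category C] [HasShift C ℤ] [Preadditive C]
  [∀ n : ℤ, (shiftFunctor C n).Additive]

/-! Write T for the truncation P_{≥ -n}(M). Since n ≥ 1, its degree zero homology is M.

Rank. The functor H⁰ identifies add T with add M up to a nilpotent ideal. It is full by the
comparison theorem. If a chain endomorphism of T is zero on H⁰, it is homotopically trivial enough
that minimality puts its image in rad(Λ)·T (`IsTruncatedResolution.map_mem`), so it is nilpotent.
Hence H⁰ reflects isomorphisms and retracts of M lift to retracts of T
(`MinProjRes.exists_retract_of_retract`), so counting indecomposable summands of M amounts to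
counting summands of T with local endomorphism ring. Two silting objects have equally many of these,
because both families play the role of a basis of the Grothendieck group. Instead of K₀, the proof
uses a pairing by alternating sums of lengths of Hom groups. For each indecomposable summand X of T,
`exists_detecting` builds objects Y k that see X and no other indecomposable summand, with no
shifted morphisms from T in a long range of degrees. The Euler sums of the summands of T against
these objects form a diagonal matrix with nonzero diagonal, which factors through any finite
generating family; comparing ranks gives `IsSilting.card_le`. Since Λ is itself τ_n-tilting
(`isTauTilting_self`), the inequality used in both directions gives rk(M) = rk(Λ).

Sincerity. If a simple S is not a composition factor of M, its projective cover Q satisfies Hom(Q,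
M) = 0. Then Q placed in degree -n has no positive extensions to or from T, and a silting object is
maximal with this property (`IsSilting.isSplitOff`), so Q[n] lies in add T. But H⁰(Q[n]) = 0, which
forces Q = 0.

Projective dimension. Let Q₁ ⟶ Q₀ ⟶ Ωⁿ(M) be a minimal presentation. If Hom(M, τ(Ωⁿ M)) = 0, duality
makes every map Q₁ ⟶ M factor through Q₀ (`exists_comp_eq_of_forall_eq_zero`). On the other hand
Hom(T, T[n]) = 0 says that every map Q₀ ⟶ M kills the image of Q₁
(`MinProjRes.eq_zero_of_isPresilting`). So Hom(Q₁, M) = 0, and sincerity gives Q₁ = 0: the syzygy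
Ωⁿ(M) is projective. -/

lemma hom_shift_eq_zero {X Y : C} {i j k : ℤ} (hk : i + k = j) (h : ∀ f : X ⟶ Y⟦k⟧, f = 0)
    (f : X⟦i⟧ ⟶ Y⟦j⟧) : f = 0 := by
  obtain ⟨g, hg⟩ := (shiftFunctor C i).map_surjective
    (f ≫ ((shiftFunctorAdd' C k i j (by lia)).app Y).hom)
  rw [h g, Functor.map_zero] at hg
  rw [← cancel_mono ((shiftFunctorAdd' C k i j (by lia)).app Y).hom, ← hg, zero_comp]

lemma hom_eq_zero_of_iso {X X' Y Y' : C} (e : X ≅ X') (e' : Y ≅ Y') (h : ∀ f : X ⟶ Y, f = 0)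
    (f : X' ⟶ Y') : f = 0 := by
  have := h (e.hom ≫ f ≫ e'.inv)
  rw [← cancel_epi e.hom, ← cancel_mono e'.inv]
  simpa using this

lemma eq_zero_of_eq_comp {X Y Z : C} {f : X ⟶ Z} {g : X ⟶ Y} {u : Y ⟶ Z} (h : f = g ≫ u)
    (hg : g = 0) : f = 0 := by
  rw [h, hg, zero_comp]

lemma eq_zero_of_eq_comp' {X Y Z : C} {f : X ⟶ Z} {g : X ⟶ Y} {u : Y ⟶ Z} (h : f = g ≫ u)
    (hu : u = 0) : f = 0 := by
  rw [h, hu, comp_zero]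

lemma hom_shift_shift_eq_zero {X Y : C} {i j k : ℤ} (hk : i + j = k)
    (h : ∀ f : X⟦k⟧ ⟶ Y, f = 0) (f : X⟦i⟧⟦j⟧ ⟶ Y) : f = 0 :=
  hom_eq_zero_of_iso ((shiftFunctorAdd' C i j k hk).app X) (Iso.refl _) h f

end Vanishing

/-! ### Objects split off by finite sums of copies of an object -/

section SplitOff

variable {C : Type*} [Category C] [Preadditive C]

/-- `X` is a retract of a finite sum of copies of `T`. -/
def IsSplitOff (T X : C) : Prop :=
  ∃ (a : ℕ) (i : Fin a → (X ⟶ T)) (r : Fin a → (T ⟶ X)), ∑ s, i s ≫ r s = 𝟙 X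

lemma IsSplitOff.of_retract {T X Y : C} (hX : IsSplitOff T X) (i : Y ⟶ X) (r : X ⟶ Y)
    (h : i ≫ r = 𝟙 Y) : IsSplitOff T Y := by
  obtain ⟨a, j, p, hjp⟩ := hX
  refine ⟨a, fun s => i ≫ j s, fun s => p s ≫ r, ?_⟩
  have : ∑ s, (i ≫ j s) ≫ p s ≫ r = i ≫ (∑ s, j s ≫ p s) ≫ r := by
    simp [Preadditive.sum_comp, Preadditive.comp_sum]
  rw [this, hjp, Category.id_comp, h]

lemma IsSplitOff.self (T : C) : IsSplitOff T T :=
  ⟨1, fun _ => 𝟙 T, fun _ => 𝟙 T, by simp⟩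

lemma IsSplitOff.biproduct [HasFiniteBiproducts C] {T : C} {ι : Type} [Finite ι] (X : ι → C)
    (h : ∀ s, IsSplitOff T (X s)) : IsSplitOff T (⨁ X) := by
  have := Fintype.ofFinite ι
  choose a i r h using h
  let e := Fintype.equivFin ((s : ι) × Fin (a s))
  refine ⟨_, fun k => biproduct.π X (e.symm k).1 ≫ i _ (e.symm k).2,
    fun k => r _ (e.symm k).2 ≫ biproduct.ι X (e.symm k).1, ?_⟩
  rw [e.symm.sum_comp (fun k : (s : ι) × Fin (a s) =>
    (biproduct.π X k.1 ≫ i _ k.2) ≫ r _ k.2 ≫ biproduct.ι X k.1), Fintype.sum_sigma,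
    ← biproduct.total]
  refine Finset.sum_congr rfl fun s _ => ?_
  have : ∑ t, (biproduct.π X s ≫ i s t) ≫ r s t ≫ biproduct.ι X s =
      biproduct.π X s ≫ (∑ t, i s t ≫ r s t) ≫ biproduct.ι X s := by
    simp [Preadditive.sum_comp, Preadditive.comp_sum]
  rw [this, h, Category.id_comp]

lemma IsSplitOff.map {D : Type*} [Category D] [Preadditive D] {T X : C} (h : IsSplitOff T X)
    (F : C ⥤ D) [F.Additive] : IsSplitOff (F.obj T) (F.obj X) := by
  obtain ⟨a, i, r, hir⟩ := h
  exact ⟨a, fun s => F.map (i s), fun s => F.map (r s), by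
    simp_rw [← F.map_comp]; rw [← F.map_sum, hir, F.map_id]⟩

end SplitOff

section AddClosure

variable {C : Type*} [Category C] [HasZeroObject C] [HasShift C ℤ] [Preadditive C]
  [∀ n : ℤ, (shiftFunctor C n).Additive] [Pretriangulated C]

lemma addClosure.isSplitOff {T X : C} (h : addClosure T X) : IsSplitOff T X := by
  obtain ⟨a, Z, ⟨e⟩⟩ := h
  exact (IsSplitOff.biproduct (fun _ : Fin a => T) fun _ => .self T).of_retract
    (biprod.inl ≫ e.hom) (e.inv ≫ biprod.fst) (by simp)

lemma hom_eq_zero_of_isSplitOff {T X Y : C} (hX : IsSplitOff T X) (h : ∀ f : T ⟶ Y, f = 0)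
    (f : X ⟶ Y) : f = 0 := by
  obtain ⟨a, i, r, hir⟩ := hX
  rw [← Category.id_comp f, ← hir, Preadditive.sum_comp]
  exact Finset.sum_eq_zero fun s _ => by rw [Category.assoc, h (r s ≫ f), comp_zero]

lemma hom_eq_zero_of_isSplitOff' {T X Y : C} (hX : IsSplitOff T X) (h : ∀ f : Y ⟶ T, f = 0)
    (f : Y ⟶ X) : f = 0 := by
  obtain ⟨a, i, r, hir⟩ := hX
  rw [← Category.comp_id f, ← hir, Preadditive.comp_sum]
  exact Finset.sum_eq_zero fun s _ => by rw [← Category.assoc, h (f ≫ i s), zero_comp]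

lemma IsPresilting.hom_eq_zero {T : C} (hT : IsPresilting T) {i j : ℤ} (hij : i < j)
    (f : T⟦i⟧ ⟶ T⟦j⟧) : f = 0 :=
  hom_shift_eq_zero (k := j - i) (by lia) (hT _ (by lia)) f

/-- Closure properties that make an object property a triangulated subcategory. -/
lemma isTriangulated_of_closed (S : ObjectProperty C) [S.IsClosedUnderIsomorphisms] (h0 : S 0)
    (hs : ∀ X (n : ℤ), S X → S (X⟦n⟧))
    (h2 : ∀ T ∈ distTriang C, S T.obj₁ → S T.obj₃ → S T.obj₂) : S.IsTriangulated :=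
  letI : S.ContainsZero := ⟨⟨0, isZero_zero C, h0⟩⟩
  letI : S.IsStableUnderShift ℤ := ⟨fun n => ⟨fun X hX => hs X n hX⟩⟩
  letI : S.IsTriangulatedClosed₂ := .mk' h2
  { }

lemma of_forall_shift (S : ObjectProperty C) [S.IsClosedUnderIsomorphisms]
    (h1 : ∀ X, S X → S (X⟦(1 : ℤ)⟧)) (h1' : ∀ X, S X → S (X⟦(-1 : ℤ)⟧)) (X : C) (n : ℤ)
    (hX : S X) : S (X⟦n⟧) := by
  induction n using Int.induction_on with
  | zero => exact S.prop_of_iso ((shiftFunctorZero C ℤ).app X).symm hX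
  | succ n ih => exact S.prop_of_iso ((shiftFunctorAdd' C (n : ℤ) 1 _ rfl).app X).symm (h1 _ ih)
  | pred n ih =>
    exact S.prop_of_iso ((shiftFunctorAdd' C (-n : ℤ) (-1) _ rfl).app X).symm (h1' _ ih)

end AddClosure

/-! ### Approximations -/

section Approximation

variable {R : Type*} [CommRing R] {C : Type*} [Category C] [HasZeroObject C] [HasShift C ℤ]
  [Preadditive C] [∀ n : ℤ, (shiftFunctor C n).Additive] [Pretriangulated C] [Linear R C]

/-- Take one copy of U for each of finitely many R-generators of W; an R-linear combination of them
is a matrix of scalars followed by b. -/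
lemma exists_approximation {U Y : C} (W : Submodule R (U ⟶ Y)) (hW : W.FG) :
    ∃ (a : ℕ) (b : (⨁ fun _ : Fin a => U) ⟶ Y),
      (∀ s, biproduct.ι (fun _ : Fin a => U) s ≫ b ∈ W) ∧ ∀ f ∈ W, ∃ g, g ≫ b = f := by
  obtain ⟨a, w, rfl⟩ := Submodule.fg_iff_exists_fin_generating_family.1 hW
  refine ⟨a, biproduct.desc w, fun s => ?_, fun f hf => ?_⟩
  · rw [biproduct.ι_desc]
    exact Submodule.subset_span ⟨s, rfl⟩
  · obtain ⟨c, rfl⟩ := (Submodule.mem_span_range_iff_exists_fun R).1 hf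
    exact ⟨biproduct.lift fun s => c s • 𝟙 U, by simp [biproduct.lift_desc]⟩

variable (R) in
/-- The cone of a right approximation of `Y` by sums of copies of `T⟦q⟧`. -/
structure ApproxCone (T Y : C) (q : ℤ) where
  a : ℕ
  b : (⨁ fun _ : Fin a => T⟦q⟧) ⟶ Y
  obj : C
  u : Y ⟶ obj
  w : obj ⟶ (⨁ fun _ : Fin a => T⟦q⟧)⟦(1 : ℤ)⟧
  distinguished : Triangle.mk b u w ∈ distTriang C
  approx : ∀ f : T⟦q⟧ ⟶ Y, ∃ g, g ≫ b = f

namespace ApproxCone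

variable (R) in
lemma exists_of_finite (T Y : C) (q : ℤ) [Module.Finite R (T⟦q⟧ ⟶ Y)] :
    Nonempty (ApproxCone T Y q) := by
  obtain ⟨a, b, -, hb⟩ := exists_approximation (⊤ : Submodule R (T⟦q⟧ ⟶ Y)) Module.Finite.fg_top
  obtain ⟨Z, u, w, h⟩ := distinguished_cocone_triangle b
  exact ⟨⟨a, b, Z, u, w, h, fun f => hb f trivial⟩⟩

variable {T Y : C} {q : ℤ} (A : ApproxCone T Y q)

lemma comp_u (f : T⟦q⟧ ⟶ Y) : f ≫ A.u = 0 := by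
  obtain ⟨g, rfl⟩ := A.approx f
  rw [Category.assoc, show A.b ≫ A.u = 0 from comp_distTriang_mor_zero₁₂ _ A.distinguished,
    comp_zero]

lemma exists_comp_b {V : C} (f : V ⟶ Y) (hf : f ≫ A.u = 0) : ∃ g, f = g ≫ A.b :=
  Triangle.coyoneda_exact₂ _ A.distinguished f hf

lemma exists_comp_u {V : C} (hV : ∀ g : V ⟶ T⟦q + 1⟧, g = 0) (f : V ⟶ A.obj) :
    ∃ g : V ⟶ Y, f = g ≫ A.u := by
  refine Triangle.coyoneda_exact₃ _ A.distinguished f ?_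
  have := (IsSplitOff.biproduct (fun _ : Fin A.a => T⟦q⟧) fun _ => .self _).map
    (shiftFunctor C (1 : ℤ))
  exact hom_eq_zero_of_isSplitOff' this
    (hom_eq_zero_of_iso (Iso.refl V) ((shiftFunctorAdd' C q 1 _ rfl).app T) hV) _

lemma eq_zero_of_comp_u {V : C} (hV : ∀ g : V ⟶ T⟦q⟧, g = 0) (f : V ⟶ Y) (hf : f ≫ A.u = 0) :
    f = 0 := by
  obtain ⟨g, rfl⟩ := A.exists_comp_b f hf
  rw [hom_eq_zero_of_isSplitOff' (IsSplitOff.biproduct _ fun _ => .self _) hV g, zero_comp]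

end ApproxCone

variable (R) (hfin : ∀ X Y : C, Module.Finite R (X ⟶ Y)) (T Z : C) (q : ℤ)

/-- Iterated cones of approximations by `T⟦q⟧`, `T⟦q + 1⟧`, … -/
def tower : ℕ → C
  | 0 => Z
  | k + 1 =>
    haveI := hfin (T⟦q + k⟧) (tower k)
    (ApproxCone.exists_of_finite R T (tower k) (q + k)).some.obj

/-- The approximation which defines the next object of the tower. -/
def towerCone (k : ℕ) : ApproxCone T (tower R hfin T Z q k) (q + k) :=
  haveI := hfin (T⟦q + k⟧) (tower R hfin T Z q k)
  (ApproxCone.exists_of_finite R T (tower R hfin T Z q k) (q + k)).some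

/-- The transition maps of the tower. -/
def towerMap (k : ℕ) : tower R hfin T Z q k ⟶ tower R hfin T Z q (k + 1) :=
  (towerCone R hfin T Z q k).u

/-- The maps from the first object of the tower. -/
def towerTo : ∀ k : ℕ, Z ⟶ tower R hfin T Z q k
  | 0 => 𝟙 Z
  | k + 1 => towerTo k ≫ towerMap R hfin T Z q k

variable {T} {q}

/-- The cones only attach copies of T⟦j⟧ with j > q, into which T⟦i⟧ has no morphisms, so no new
morphisms appear below degree q. -/
lemma hom_tower_eq_zero_of_lt (hT : IsPresilting T) {i : ℤ} (hi : i < q)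
    (h : ∀ f : T⟦i⟧ ⟶ Z, f = 0) (k : ℕ) (f : T⟦i⟧ ⟶ tower R hfin T Z q k) : f = 0 := by
  induction k with
  | zero => exact h f
  | succ k ih =>
    obtain ⟨g, hg⟩ := (towerCone R hfin T Z q k).exists_comp_u (hT.hom_eq_zero (by lia)) f
    exact eq_zero_of_eq_comp hg (ih g)

/-- Stage k + 1 kills the morphisms from T⟦q + k⟧, because they factor through the approximation;
the degrees killed earlier stay killed, because T is presilting. -/
lemma hom_tower_eq_zero (hT : IsPresilting T) {i : ℤ} (hi : q ≤ i) (k : ℕ) (hk : i < q + k)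
    (f : T⟦i⟧ ⟶ tower R hfin T Z q k) : f = 0 := by
  induction k with
  | zero => simp at hk; lia
  | succ k ih =>
    obtain ⟨g, hg⟩ := (towerCone R hfin T Z q k).exists_comp_u
      (hT.hom_eq_zero (by push_cast at hk; lia)) f
    obtain h | h := lt_or_eq_of_le (show i ≤ q + k by push_cast at hk; lia)
    · exact eq_zero_of_eq_comp hg (ih h g)
    · subst h
      exact hg.trans ((towerCone R hfin T Z q k).comp_u g)

/-- A morphism killed by a transition map factors through a sum of copies of some T⟦j⟧ with j ≥ q.
-/
lemma comp_towerTo_eq_zero {V : C} (hV : ∀ j : ℤ, q ≤ j → ∀ f : V ⟶ T⟦j⟧, f = 0) (f : V ⟶ Z)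
    (k : ℕ) (hf : f ≫ towerTo R hfin T Z q k = 0) : f = 0 := by
  induction k with
  | zero => exact (Category.comp_id f).symm.trans hf
  | succ k ih =>
    refine ih ?_
    rw [towerTo, ← Category.assoc] at hf
    exact (towerCone R hfin T Z q k).eq_zero_of_comp_u (hV _ (by lia)) _ hf

/-- Vanishing of the morphisms to a sequence of objects in a range of degrees propagates from a
silting object to all objects, up to a shift of the range. -/
lemma IsSilting.vanishing {C : Type*} [Category C] [HasZeroObject C] [HasShift C ℤ]
    [Preadditive C] [∀ n : ℤ, (shiftFunctor C n).Additive] [Pretriangulated C] {T : C}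
    (hT : IsSilting T) (Y : ℕ → C) (Φ : ℕ → ℕ → ℤ → Prop)
    (hΦ : ∀ N (n : ℤ) (m : ℕ) k i, n.natAbs ≤ m → Φ (N + m) k i → Φ N k (n + i))
    (h : ∀ k i, Φ 0 k i → ∀ f : T⟦i⟧ ⟶ Y k, f = 0) (V : C) :
    ∃ N : ℕ, ∀ k i, Φ N k i → ∀ f : V⟦i⟧ ⟶ Y k, f = 0 := by
  -- The bound N may depend on V: shifts and extensions only shrink the range by a finite amount, so
  -- these objects form a triangulated subcategory containing add(T).
  let S : ObjectProperty C := fun V => ∃ N : ℕ, ∀ k i, Φ N k i → ∀ f : V⟦i⟧ ⟶ Y k, f = 0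
  have hS : S.IsClosedUnderIsomorphisms := ⟨fun e ⟨N, hN⟩ => ⟨N, fun k i hi =>
    hom_eq_zero_of_iso ((shiftFunctor C i).mapIso e) (Iso.refl _) (hN k i hi)⟩⟩
  have hS' : S.IsTriangulated := by
    refine isTriangulated_of_closed S ⟨0, fun k i _ f => ?_⟩ ?_ ?_
    · exact ((shiftFunctor C i).map_isZero (isZero_zero C)).eq_of_src f 0
    · rintro V n ⟨N, hN⟩
      exact ⟨N + n.natAbs, fun k i hi =>
        hom_shift_shift_eq_zero (k := n + i) rfl (hN k _ (hΦ _ _ _ _ _ le_rfl hi))⟩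
    · rintro D hD ⟨N₁, h₁⟩ ⟨N₃, h₃⟩
      refine ⟨N₁ + N₃, fun k i hi f => ?_⟩
      have hi₁ := hΦ N₁ 0 N₃ k i (by simp) hi
      have hi₃ := hΦ N₃ 0 N₁ k i (by simp) (by rwa [add_comm])
      rw [zero_add] at hi₁ hi₃
      obtain ⟨g, hg⟩ := Triangle.yoneda_exact₂ _ (Triangle.shift_distinguished D hD i) f
        (h₁ k i hi₁ _)
      exact eq_zero_of_eq_comp' hg (h₃ k i hi₃ g)
  have key : S = ⊤ := hT.generates S hS' hS fun X hX => ⟨0, fun k i hi =>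
    hom_eq_zero_of_isSplitOff (hX.isSplitOff.map (shiftFunctor C i)) (h k i hi)⟩
  exact (congrFun key V).mpr trivial

include R hfin in
/-- A silting object is maximal: an object without positive extensions from and to a silting
object `T` is a summand of a finite sum of copies of `T`. -/
theorem IsSilting.isSplitOff (hT : IsSilting T) {X : C} (h₁ : ∀ i < (0 : ℤ), ∀ f : T⟦i⟧ ⟶ X, f = 0)
    (h₂ : ∀ i > (0 : ℤ), ∀ f : X ⟶ T⟦i⟧, f = 0) : IsSplitOff T X := by
  -- Stage k of the tower receives nothing from T⟦i⟧ for all i < k. Propagating this to X shows that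
  -- X has no nonzero morphism to a sufficiently late stage.
  obtain ⟨N, hN⟩ := hT.vanishing (tower R hfin T X 0) (fun N k i => i + N + 1 ≤ k)
    (fun N n m k i hn h => by push_cast at h; omega) (fun k i hi f => by
      by_cases h : i < 0
      · exact hom_tower_eq_zero_of_lt R hfin X hT.presilting h (h₁ i h) k f
      · exact hom_tower_eq_zero R hfin X hT.presilting (by lia) k (by push_cast at hi; lia) f) X
  let A := towerCone R hfin T X 0 0
  -- Going down the tower, each cone after the first is taken along copies of T⟦j⟧ with j > 0, to
  -- which X has no morphisms; so already the first map X ⟶ cone is zero.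
  have key : ∀ k : ℕ, towerTo R hfin T X 0 (k + 1) = 0 → A.u = 0 := by
    intro k
    induction k with
    | zero => exact fun h => (Category.id_comp _).symm.trans h
    | succ k ih =>
      intro h
      refine ih ((towerCone R hfin T X 0 (k + 1)).eq_zero_of_comp_u (h₂ _ (by push_cast; lia)) _ h)
  have h0 : A.u = 0 := key N (hom_eq_zero_of_iso ((shiftFunctorZero C ℤ).app X) (Iso.refl _)
    (hN (N + 1) 0 (by push_cast; lia)) _)
  -- The identity of X thus factors through the approximation by a sum of copies of T⟦0⟧.
  obtain ⟨g, hg⟩ := A.exists_comp_b (𝟙 X) ((Category.id_comp _).trans h0)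
  refine (IsSplitOff.biproduct (T := T) (fun _ : Fin A.a => T⟦(0 : ℤ) + (0 : ℕ)⟧) fun _ =>
    (IsSplitOff.self T).of_retract ?_ ?_ ?_).of_retract g A.b hg.symm
  · exact ((shiftFunctorZero' C _ (by simp)).app T).hom
  · exact ((shiftFunctorZero' C _ (by simp)).app T).inv
  · simp

end Approximation

/-! ### Lengths of morphism groups -/

section Length

variable (R : Type*) [CommRing R] {C : Type*} [Category C] [Preadditive C] [Linear R C]

/-- The length of the `R`-module `Hom(X, Y)`, as a natural number. -/
def homLength (X Y : C) : ℕ := (Module.length R (X ⟶ Y)).toNat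

variable {R}

lemma homLength_eq_zero {X Y : C} (h : ∀ f : X ⟶ Y, f = 0) : homLength R X Y = 0 := by
  have : Subsingleton (X ⟶ Y) := ⟨fun f g => (h f).trans (h g).symm⟩
  simp [homLength]

lemma homLength_ne_zero [IsArtinianRing R] {X Y : C} [Module.Finite R (X ⟶ Y)] {f : X ⟶ Y}
    (hf : f ≠ 0) : homLength R X Y ≠ 0 := by
  intro h
  obtain h | h := ENat.toNat_eq_zero.1 h
  · have := Module.length_eq_zero_iff.1 h
    exact hf (Subsingleton.elim _ _)
  · exact (Module.length_ne_top) h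

lemma homLength_congr {X X' Y Y' : C} (e : X ≅ X') (e' : Y ≅ Y') :
    homLength R X Y = homLength R X' Y' := by
  rw [homLength, homLength, (Linear.homCongr R e e').length_eq]

lemma length_eq_length_ker_add_length_ker {A B D : Type*} [AddCommGroup A] [Module R A]
    [AddCommGroup B] [Module R B] [AddCommGroup D] [Module R D] (f : A →ₗ[R] B) (g : B →ₗ[R] D)
    (h : Function.Exact f g) :
    Module.length R A = Module.length R (LinearMap.ker f) + Module.length R (LinearMap.ker g) := by
  rw [h.linearMap_ker_eq]
  exact Module.length_eq_add_of_exact (LinearMap.ker f).subtype f.rangeRestrict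
    (Submodule.subtype_injective _) f.surjective_rangeRestrict
    (LinearMap.exact_iff.2 (by simp))

end Length

/-! ### Sums of non-isomorphisms over local endomorphism rings -/

section LocalEnd

variable {C : Type*} [Category C] [Preadditive C]

lemma not_isIso_add {X : C} [IsLocalRing (End X)] {f g : X ⟶ X} (hf : ¬ IsIso f)
    (hg : ¬ IsIso g) : ¬ IsIso (f + g) := by
  intro h
  let F : End X := f
  let G : End X := g
  obtain ⟨u, hu⟩ : IsUnit (F + G) := (isUnit_iff_isIso (f + g)).2 h
  have hu : (↑u⁻¹ : End X) * F + (↑u⁻¹ : End X) * G = 1 := by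
    rw [← mul_add, ← hu]
    exact u.inv_mul
  obtain h | h := IsLocalRing.isUnit_or_isUnit_of_add_one hu
  · exact hf ((isUnit_iff_isIso f).1 ((Units.isUnit_units_mul u⁻¹ F).1 h))
  · exact hg ((isUnit_iff_isIso g).1 ((Units.isUnit_units_mul u⁻¹ G).1 h))

lemma not_isIso_zero {X : C} [IsLocalRing (End X)] : ¬ IsIso (0 : X ⟶ X) := fun h =>
  not_isUnit_zero ((isUnit_iff_isIso (0 : X ⟶ X)).2 h : IsUnit (0 : End X))

lemma not_isIso_sum {X : C} [IsLocalRing (End X)] {σ : Type*} (s : Finset σ) (f : σ → (X ⟶ X))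
    (hf : ∀ i ∈ s, ¬ IsIso (f i)) : ¬ IsIso (∑ i ∈ s, f i) := by
  classical
  induction s using Finset.induction_on with
  | empty => simpa using not_isIso_zero
  | insert a s ha ih =>
    rw [Finset.sum_insert ha]
    exact not_isIso_add (hf a (Finset.mem_insert_self a s))
      (ih fun i hi => hf i (Finset.mem_insert_of_mem hi))

end LocalEnd

/-! ### Truncated Euler sums and the number of summands of a silting object -/

section Euler

variable {R : Type*} [CommRing R] [IsArtinianRing R] {C : Type*} [Category C] [HasZeroObject C]
  [HasShift C ℤ] [Preadditive C] [∀ n : ℤ, (shiftFunctor C n).Additive] [Pretriangulated C]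
  [Linear R C] (hfin : ∀ X Y : C, Module.Finite R (X ⟶ Y))

/-- The shifted triangle carries the sign (-1)^i on its maps; rescaling the middle object by this
sign removes it from the first two. -/
lemma exists_distinguished_shift (D : Triangle C) (hD : D ∈ distTriang C)
    (i : ℤ) : ∃ δ : D.obj₃⟦i⟧ ⟶ D.obj₁⟦i⟧⟦(1 : ℤ)⟧,
      Triangle.mk (D.mor₁⟦i⟧') (D.mor₂⟦i⟧') δ ∈ distTriang C := by
  let D' : Triangle C := (shiftFunctor (Triangle C) i).obj D
  let δ : D.obj₃⟦i⟧ ⟶ D.obj₁⟦i⟧⟦(1 : ℤ)⟧ := D'.mor₃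
  let s : ℤˣ := i.negOnePow
  let e : D.obj₂⟦i⟧ ≅ D.obj₂⟦i⟧ := ⟨s • 𝟙 _, s • 𝟙 _,
    by simp [Linear.comp_units_smul, smul_smul],
    by simp [Linear.comp_units_smul, smul_smul]⟩
  refine ⟨δ, isomorphic_distinguished D' (Triangle.shift_distinguished D hD i) _
    (Triangle.isoMk _ D' (Iso.refl (D.obj₁⟦i⟧)) e (Iso.refl (D.obj₃⟦i⟧)) ?_ ?_ ?_)⟩
  · change D.mor₁⟦i⟧' ≫ (s • 𝟙 (D.obj₂⟦i⟧)) = 𝟙 (D.obj₁⟦i⟧) ≫ (s • D.mor₁⟦i⟧')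
    rw [Linear.comp_units_smul, Category.comp_id, Category.id_comp]
  · change D.mor₂⟦i⟧' ≫ 𝟙 (D.obj₃⟦i⟧) = (s • 𝟙 (D.obj₂⟦i⟧)) ≫ (s • D.mor₂⟦i⟧')
    rw [Linear.units_smul_comp, Linear.comp_units_smul, Category.comp_id, Category.id_comp,
      smul_smul]
    simp [s]
  · change δ ≫ (shiftFunctor C (1 : ℤ)).map (𝟙 (D.obj₁⟦i⟧)) = 𝟙 (D.obj₃⟦i⟧) ≫ δ
    rw [CategoryTheory.Functor.map_id, Category.comp_id, Category.id_comp]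

include hfin in
/-- The numerical content of the long exact sequence of a distinguished triangle. -/
lemma exists_homLength_add (D : Triangle C) (hD : D ∈ distTriang C) (Y : C) :
    ∃ ρ : ℤ → ℕ, (∀ i : ℤ, ρ i ≤ homLength R (D.obj₃⟦i⟧) Y) ∧
      ∀ i : ℤ, homLength R (D.obj₂⟦i⟧) Y + ρ i + ρ (i - 1) =
        homLength R (D.obj₁⟦i⟧) Y + homLength R (D.obj₃⟦i⟧) Y := by
  choose δ hδ using exists_distinguished_shift D hD
  let α : ∀ i : ℤ, (D.obj₃⟦i⟧ ⟶ Y) →ₗ[R] (D.obj₂⟦i⟧ ⟶ Y) := fun i =>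
    Linear.leftComp R Y (D.mor₂⟦i⟧')
  let β : ∀ i : ℤ, (D.obj₂⟦i⟧ ⟶ Y) →ₗ[R] (D.obj₁⟦i⟧ ⟶ Y) := fun i =>
    Linear.leftComp R Y (D.mor₁⟦i⟧')
  let θ : ∀ (i : ℤ) (X : C), X⟦(i - 1 : ℤ)⟧⟦(1 : ℤ)⟧ ≅ X⟦i⟧ := fun i X =>
    ((shiftFunctorAdd' C (i - 1) 1 i (by lia)).app X).symm
  have hθ : ∀ (i : ℤ) {X X' : C} (f : X ⟶ X'), f⟦(i - 1 : ℤ)⟧'⟦(1 : ℤ)⟧' ≫ (θ i X').hom =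
      (θ i X).hom ≫ f⟦i⟧' := fun i X X' f =>
    ((shiftFunctorAdd' C (i - 1) 1 i (by lia)).inv.naturality f)
  let ε : ∀ i : ℤ, (D.obj₁⟦i⟧ ⟶ Y) →ₗ[R] (D.obj₃⟦(i - 1 : ℤ)⟧ ⟶ Y) := fun i =>
    Linear.leftComp R Y (δ (i - 1) ≫ (θ i D.obj₁).hom)
  have hαβ : ∀ i, Function.Exact (α i) (β i) := by
    intro i f
    constructor
    · intro hf
      obtain ⟨g, hg⟩ := Triangle.yoneda_exact₂ _ (hδ i) f hf
      exact ⟨g, hg.symm⟩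
    · rintro ⟨g, rfl⟩
      change D.mor₁⟦i⟧' ≫ D.mor₂⟦i⟧' ≫ g = 0
      rw [← Category.assoc, ← Functor.map_comp, comp_distTriang_mor_zero₁₂ _ hD, Functor.map_zero,
        zero_comp]
  have hεα : ∀ i, Function.Exact (ε i) (α (i - 1)) := by
    intro i f
    constructor
    · intro hf
      obtain ⟨g, hg⟩ := Triangle.yoneda_exact₃ _ (hδ (i - 1)) f hf
      change (D.obj₁⟦(i - 1 : ℤ)⟧⟦(1 : ℤ)⟧) ⟶ Y at g
      change f = δ (i - 1) ≫ g at hg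
      refine ⟨(θ i _).inv ≫ g, ?_⟩
      change (δ (i - 1) ≫ (θ i D.obj₁).hom) ≫ (θ i _).inv ≫ g = f
      rw [Category.assoc, Iso.hom_inv_id_assoc, hg]
    · rintro ⟨g, rfl⟩
      have h : D.mor₂⟦(i - 1 : ℤ)⟧' ≫ δ (i - 1) = 0 := comp_distTriang_mor_zero₂₃ _ (hδ (i - 1))
      change D.mor₂⟦(i - 1 : ℤ)⟧' ≫ (δ (i - 1) ≫ (θ i D.obj₁).hom) ≫ g = 0
      rw [Category.assoc, reassoc_of% h, zero_comp]
  have hβε : ∀ i, Function.Exact (β i) (ε i) := by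
    intro i f
    constructor
    · intro hf
      obtain ⟨g, hg⟩ := Triangle.yoneda_exact₃ _ (rot_of_distTriang _ (hδ (i - 1)))
        ((θ i _).hom ≫ f) ((Category.assoc _ _ _).symm.trans hf)
      change (D.obj₂⟦(i - 1 : ℤ)⟧⟦(1 : ℤ)⟧) ⟶ Y at g
      change (θ i D.obj₁).hom ≫ f = (-D.mor₁⟦(i - 1 : ℤ)⟧'⟦(1 : ℤ)⟧') ≫ g at hg
      refine ⟨-((θ i _).inv ≫ g), ?_⟩
      change D.mor₁⟦i⟧' ≫ (-((θ i _).inv ≫ g)) = f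
      rw [← cancel_epi (θ i _).hom, ← Category.assoc, ← hθ, hg, Category.assoc,
        Preadditive.comp_neg, Iso.hom_inv_id_assoc, Preadditive.comp_neg, Preadditive.neg_comp]
    · rintro ⟨g, rfl⟩
      have h : δ (i - 1) ≫ (-D.mor₁⟦(i - 1 : ℤ)⟧'⟦(1 : ℤ)⟧') = 0 :=
        comp_distTriang_mor_zero₂₃ _ (rot_of_distTriang _ (hδ (i - 1)))
      rw [Preadditive.comp_neg, neg_eq_zero] at h
      change (δ (i - 1) ≫ (θ i D.obj₁).hom) ≫ D.mor₁⟦i⟧' ≫ g = 0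
      rw [Category.assoc, ← Category.assoc (θ i D.obj₁).hom, ← hθ, Category.assoc,
        reassoc_of% h, zero_comp]
  have hlen : ∀ {A : C} (S : Submodule R (A ⟶ Y)), Module.length R S ≠ ⊤ := fun S =>
    have := hfin
    Module.length_ne_top
  -- The error term ρ i is the length of the image of the connecting map into Hom(D.obj₃⟦i⟧, Y). It
  -- enters the count in the two neighbouring degrees i and i + 1.
  refine ⟨fun i => (Module.length R (LinearMap.ker (α i))).toNat, fun i => ?_, fun i => ?_⟩
  · have := hfin
    exact ENat.toNat_le_toNat (Module.length_le_of_injective (LinearMap.ker (α i)).subtype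
      (Submodule.subtype_injective _))
      Module.length_ne_top
  · simp only [homLength]
    rw [length_eq_length_ker_add_length_ker _ _ (hαβ i),
      length_eq_length_ker_add_length_ker _ _ (hβε i),
      length_eq_length_ker_add_length_ker _ _ (hεα i)]
    rw [ENat.toNat_add (hlen _) (hlen _), ENat.toNat_add (hlen _) (hlen _),
      ENat.toNat_add (hlen _) (hlen _)]
    lia

variable (R) in
/-- Truncated alternating sum of the lengths of `Hom(X⟦i⟧, Y)` for `-p ≤ i ≤ p`. -/
def eulerSum (p : ℕ) (X Y : C) : ℤ :=
  ∑ j ∈ Finset.range (2 * p + 1), (-1) ^ j * (homLength R (X⟦(j - p : ℤ)⟧) Y : ℤ)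

lemma sum_alternating_telescope (ρ : ℤ → ℤ) (c : ℤ) (m : ℕ) :
    ∑ j ∈ Finset.range m, (-1) ^ j * (ρ (j - c) + ρ (j - c - 1)) =
      ρ (-c - 1) - (-1) ^ m * ρ (m - c - 1) := by
  induction m with
  | zero => simp
  | succ m ih =>
    rw [Finset.sum_range_succ, ih]
    have : ((m + 1 : ℕ) : ℤ) - c - 1 = m - c := by push_cast; ring
    rw [this, pow_succ]
    ring

-- The error terms of the long exact sequence telescope in the alternating sum, leaving those at i =
-- p and i = -p - 1; the two vanishing hypotheses remove exactly these.
include hfin in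
lemma eulerSum_add (D : Triangle C) (hD : D ∈ distTriang C) (Y : C) (p : ℕ)
    (h₁ : ∀ f : D.obj₃⟦(p : ℤ)⟧ ⟶ Y, f = 0) (h₂ : ∀ f : D.obj₃⟦(-p - 1 : ℤ)⟧ ⟶ Y, f = 0) :
    eulerSum R p D.obj₂ Y = eulerSum R p D.obj₁ Y + eulerSum R p D.obj₃ Y := by
  obtain ⟨ρ, hρ, h⟩ := exists_homLength_add hfin D hD Y
  have hp : ρ p = 0 := Nat.le_zero.1 ((hρ p).trans (homLength_eq_zero h₁).le)
  have hp' : ρ (-p - 1) = 0 := Nat.le_zero.1 ((hρ _).trans (homLength_eq_zero h₂).le)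
  have key := sum_alternating_telescope (fun i => (ρ i : ℤ)) p (2 * p + 1)
  have e : ((2 * p + 1 : ℕ) : ℤ) - p - 1 = p := by push_cast; ring
  rw [e, hp, hp'] at key
  simp only [eulerSum]
  rw [← Finset.sum_add_distrib, ← sub_eq_zero, ← Finset.sum_sub_distrib, ← neg_eq_zero,
    ← Finset.sum_neg_distrib]
  refine Eq.trans (Finset.sum_congr rfl fun j _ => ?_) (key.trans (by simp))
  have := congrArg (Nat.cast : ℕ → ℤ) (h (j - p))
  simp only [Nat.cast_add] at this
  linear_combination (-(-1) ^ j) * this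

include hfin in
/-- The classes of the objects of a triangulated category are integral combinations of the classes
of a family of generators: numerical version for truncated Euler sums. -/
lemma exists_eulerSum_eq {ι ι' : Type*} [Fintype ι'] (X' : ι' → C)
    (hX' : ∀ S : ObjectProperty C, S.IsTriangulated → S.IsClosedUnderIsomorphisms →
      (∀ l, S (X' l)) → S = ⊤) [Finite ι] (Y : ι → ℕ → C)
    (hY : ∀ j V, ∃ N : ℕ, ∀ (k : ℕ) (i : ℤ), (i + N < 0 ∨ (N < i ∧ i + N ≤ k)) →
      ∀ f : V⟦i⟧ ⟶ Y j k, f = 0) (X : C) :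
    ∃ v : ι' → ℤ, ∃ N : ℕ, ∀ p, N ≤ p → ∀ j,
      eulerSum R p X (Y j (2 * p)) = ∑ l, v l * eulerSum R p (X' l) (Y j (2 * p)) := by
  classical
  have hY' : ∀ V, ∃ N : ℕ, ∀ p, N ≤ p → ∀ j, (∀ f : V⟦(p : ℤ)⟧ ⟶ Y j (2 * p), f = 0) ∧
      (∀ f : V⟦(-p - 1 : ℤ)⟧ ⟶ Y j (2 * p), f = 0) := by
    intro V
    choose N hN using fun j => hY j V
    obtain ⟨M, hM⟩ := (Set.finite_range N).bddAbove
    refine ⟨M + 1, fun p hp j => ?_⟩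
    have := hM ⟨j, rfl⟩
    -- At stage 2 * p the vanishing range is N < i ≤ 2 * p - N, so it contains i = p as soon as p >
    -- N; this is why the stage is twice the cutoff.
    exact ⟨hN j _ _ (.inr ⟨by lia, by push_cast; lia⟩), hN j _ _ (.inl (by lia))⟩
  let S : ObjectProperty C := fun X => ∃ v : ι' → ℤ, ∃ N : ℕ, ∀ p, N ≤ p → ∀ j,
      eulerSum R p X (Y j (2 * p)) = ∑ l, v l * eulerSum R p (X' l) (Y j (2 * p))
  have hS : S.IsClosedUnderIsomorphisms := ⟨fun e ⟨v, N, h⟩ => ⟨v, N, fun p hp j => by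
    rw [← h p hp j]
    exact Finset.sum_congr rfl fun i _ => by
      rw [homLength_congr ((shiftFunctor C _).mapIso e) (Iso.refl _)]⟩⟩
  have h2 : ∀ D ∈ distTriang C, S D.obj₁ → S D.obj₃ → S D.obj₂ := by
    rintro D hD ⟨v, N, h⟩ ⟨v', N', h'⟩
    obtain ⟨M, hM⟩ := hY' D.obj₃
    refine ⟨v + v', max M (max N N'), fun p hp j => ?_⟩
    simp only [max_le_iff] at hp
    rw [eulerSum_add hfin D hD _ _ (hM p hp.1 j).1 (hM p hp.1 j).2, h p hp.2.1, h' p hp.2.2,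
      ← Finset.sum_add_distrib]
    exact Finset.sum_congr rfl fun l _ => (add_mul _ _ _).symm
  have h0 : ∀ (p : ℕ) (Z : C), eulerSum R p (0 : C) Z = 0 := fun p Z =>
    Finset.sum_eq_zero fun i _ => by
      rw [homLength_eq_zero fun f => ((shiftFunctor C _).map_isZero (isZero_zero C)).eq_of_src f 0]
      simp
  -- Applied to X ⟶ 0 ⟶ X⟦1⟧: shifting by one changes the sign of the Euler sums, whence stability
  -- under all shifts.
  have hneg : ∀ D ∈ distTriang C, IsZero D.obj₂ → (S D.obj₁ ↔ S D.obj₃) := by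
    intro D hD hz
    obtain ⟨M, hM⟩ := hY' D.obj₃
    have key : ∀ p, M ≤ p → ∀ j, eulerSum R p D.obj₃ (Y j (2 * p)) =
        - eulerSum R p D.obj₁ (Y j (2 * p)) := by
      intro p hp j
      have := eulerSum_add hfin D hD _ _ (hM p hp j).1 (hM p hp j).2
      have h0' : eulerSum R p D.obj₂ (Y j (2 * p)) = 0 :=
        Finset.sum_eq_zero fun i _ => by
          rw [homLength_eq_zero fun f => ((shiftFunctor C _).map_isZero hz).eq_of_src f 0]
          simp
      linarith
    constructor
    · rintro ⟨v, N, h⟩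
      refine ⟨-v, max M N, fun p hp j => ?_⟩
      rw [key p (le_of_max_le_left hp), h p (le_of_max_le_right hp), ← Finset.sum_neg_distrib]
      exact Finset.sum_congr rfl fun l _ => (neg_mul _ _).symm
    · rintro ⟨v, N, h⟩
      refine ⟨-v, max M N, fun p hp j => ?_⟩
      rw [← neg_eq_iff_eq_neg.2 (key p (le_of_max_le_left hp) j), h p (le_of_max_le_right hp),
        ← Finset.sum_neg_distrib]
      exact Finset.sum_congr rfl fun l _ => (neg_mul _ _).symm
  have hS' : S.IsTriangulated := by
    refine isTriangulated_of_closed S ⟨0, 0, fun p _ j => by simp [h0]⟩ (fun X n hX => ?_) h2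
    refine of_forall_shift S (fun X hX => (hneg _ (rot_of_distTriang _ (contractible_distinguished X)) (isZero_zero C)).1 hX)
      (fun X hX => (hneg _ (rot_of_distTriang _ (contractible_distinguished _)) (isZero_zero C)).2 ?_) X n hX
    exact S.prop_of_iso ((shiftFunctorCompIsoId C (-1 : ℤ) 1 (by simp)).app X).symm hX
  have key : S = ⊤ := hX' S hS' hS fun l => ⟨Pi.single l 1, 0, fun p _ j => by
    rw [Finset.sum_eq_single l] <;> simp +contextual⟩
  exact (congrFun key X).mpr trivial

/-- Over ℚ the product of the two matrices is an invertible diagonal matrix, and its rank is at most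
the inner size. -/
lemma card_le_of_diagonal {ι ι' : Type*} [Fintype ι] [Fintype ι'] (v : ι → ι' → ℤ)
    (e : ι' → ι → ℤ) (h : ∀ i j, i ≠ j → ∑ l, v i l * e l j = 0)
    (h' : ∀ i, ∑ l, v i l * e l i ≠ 0) : Fintype.card ι ≤ Fintype.card ι' := by
  classical
  let V : Matrix ι ι' ℚ := Matrix.of fun i l => (v i l : ℚ)
  let E : Matrix ι' ι ℚ := Matrix.of fun l j => (e l j : ℚ)
  have hVE : V * E = Matrix.diagonal fun i => ((∑ l, v i l * e l i : ℤ) : ℚ) := by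
    ext i j
    rw [Matrix.mul_apply, Matrix.diagonal_apply]
    split_ifs with hij
    · subst hij
      simp [V, E]
    · have := congrArg (Int.cast : ℤ → ℚ) (h i j hij)
      simpa [V, E] using this
  have hr : (V * E).rank = Fintype.card ι := by
    refine Matrix.rank_of_isUnit _ ?_
    rw [hVE, Matrix.isUnit_iff_isUnit_det, Matrix.det_diagonal, isUnit_iff_ne_zero]
    exact Finset.prod_ne_zero_iff.2 fun i _ => Int.cast_ne_zero.2 (h' i)
  rw [← hr]
  exact (Matrix.rank_mul_le_left V E).trans (Matrix.rank_le_card_width V)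

variable (R) in
/-- The morphisms `T ⟶ X` which are not split epimorphisms, for `X` with local endomorphism
ring. -/
def nonSplit (T X : C) [IsLocalRing (End X)] : Submodule R (T ⟶ X) where
  carrier := {f | ∀ g : X ⟶ T, ¬ IsIso (g ≫ f)}
  zero_mem' g := by simpa using not_isIso_zero
  add_mem' {f f'} hf hf' g := by
    rw [Preadditive.comp_add]
    exact not_isIso_add (hf g) (hf' g)
  smul_mem' r f hf g := by
    have := hf (r • g)
    rwa [Linear.smul_comp, ← Linear.comp_smul] at this

include hfin in
/-- The objects `Y` which detect, among the summands of the silting object `T`, the copies of a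
summand `X` with local endomorphism ring. -/
lemma exists_detecting {T X : C} (hT : IsSilting T) [IsLocalRing (End X)] (i : X ⟶ T) (r : T ⟶ X)
    (hir : i ≫ r = 𝟙 X) : ∃ Y : ℕ → C,
      (∀ V, ∃ N : ℕ, ∀ (k : ℕ) (i : ℤ), (i + N < 0 ∨ (N < i ∧ i + N ≤ k)) →
        ∀ f : V⟦i⟧ ⟶ Y k, f = 0) ∧
      (∀ (k : ℕ) (i : ℤ), i < 0 ∨ (0 < i ∧ i ≤ k) → ∀ f : T⟦i⟧ ⟶ Y k, f = 0) ∧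
      (∀ k, ∃ f : X ⟶ Y k, f ≠ 0) ∧
      ∀ k, ∀ X' : C, IsSplitOff T X' → (∀ (f : X' ⟶ X) (g : X ⟶ X'), ¬ IsIso (g ≫ f)) →
        ∀ f : X' ⟶ Y k, f = 0 := by
  have hX : IsSplitOff T X := (IsSplitOff.self T).of_retract i r hir
  -- The cone Z of the approximation by the radical morphisms T ⟶ X leaves only the top of Hom(T,
  -- X). The tower starting at q = 1 then removes the morphisms from positive shifts of T without
  -- touching degree 0.
  obtain ⟨a, b, hb, hb'⟩ := exists_approximation (nonSplit R T X)
    (haveI := hfin; IsNoetherian.noetherian _)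
  obtain ⟨Z, u, w, hZ⟩ := distinguished_cocone_triangle b
  let B : C := ⨁ fun _ : Fin a => T
  have hB : IsSplitOff T B := .biproduct _ fun _ => .self T
  have hTT : ∀ i : ℤ, i ≤ 0 → ∀ f : T⟦i⟧ ⟶ T⟦(1 : ℤ)⟧, f = 0 := fun i hi f =>
    hT.presilting.hom_eq_zero (by lia) f
  have lift : ∀ V : C, (∀ f : V ⟶ T⟦(1 : ℤ)⟧, f = 0) → ∀ f : V ⟶ Z, ∃ g : V ⟶ X, f = g ≫ u :=
    fun V hV f => Triangle.coyoneda_exact₃ _ hZ f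
      (hom_eq_zero_of_isSplitOff' (hB.map (shiftFunctor C (1 : ℤ))) hV _)
  have hZneg : ∀ i < (0 : ℤ), ∀ f : T⟦i⟧ ⟶ Z, f = 0 := by
    intro i hi f
    obtain ⟨g, rfl⟩ := lift _ (hTT i hi.le) f
    have hg : g = 0 := hom_eq_zero_of_isSplitOff' hX (hom_eq_zero_of_iso (Iso.refl _)
      ((shiftFunctorZero C ℤ).app T) (hT.presilting.hom_eq_zero hi)) g
    rw [hg, zero_comp]
  have hbase : ∀ (k : ℕ) (i : ℤ), i < 0 ∨ (0 < i ∧ i ≤ k) →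
      ∀ f : T⟦i⟧ ⟶ tower R hfin T Z 1 k, f = 0 := by
    rintro k i (hi | ⟨hi, hi'⟩) f
    · exact hom_tower_eq_zero_of_lt R hfin Z hT.presilting (by lia) (hZneg i hi) k f
    · exact hom_tower_eq_zero R hfin Z hT.presilting (by lia) k (by lia) f
  have hpos : ∀ V : C, IsSplitOff T V → ∀ j : ℤ, 1 ≤ j → ∀ f : V ⟶ T⟦j⟧, f = 0 :=
    fun V hV j hj => hom_eq_zero_of_isSplitOff hV (hT.presilting j (by lia))
  refine ⟨tower R hfin T Z 1, ?_, hbase, fun k => ⟨u ≫ towerTo R hfin T Z 1 k, fun h => ?_⟩,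
    fun k X' hX' hne f => ?_⟩
  · exact hT.vanishing _ (fun N k i => i + N < 0 ∨ (N < i ∧ i + N ≤ k))
      (fun N n m k i hn h => by push_cast at h; omega) fun k i hi => hbase k i (by simpa using hi)
  -- If X ⟶ Y k were zero, then u = 0 and the identity of X would be a sum of endomorphisms
  -- factoring through radical maps, impossible over a local endomorphism ring.
  · have hu : u = 0 := comp_towerTo_eq_zero R hfin Z (hpos X hX) u k h
    obtain ⟨g, hg⟩ := Triangle.coyoneda_exact₂ _ hZ (𝟙 X) (by
      change 𝟙 X ≫ u = 0
      rw [hu, comp_zero])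
    change X ⟶ B at g
    change 𝟙 X = g ≫ b at hg
    have hsum : g ≫ b = ∑ s, (g ≫ biproduct.π _ s) ≫ biproduct.ι (fun _ : Fin a => T) s ≫ b := by
      calc g ≫ b = g ≫ (∑ s, biproduct.π (fun _ : Fin a => T) s ≫
            biproduct.ι (fun _ : Fin a => T) s) ≫ b := by
            rw [biproduct.total, Category.id_comp]
        _ = _ := by simp only [Preadditive.sum_comp, Preadditive.comp_sum, Category.assoc]
    refine not_isIso_sum Finset.univ
      (fun s => (g ≫ biproduct.π _ s) ≫ biproduct.ι (fun _ : Fin a => T) s ≫ b)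
      (fun s _ => hb s _) ?_
    rw [← hsum, ← hg]
    infer_instance
  -- A summand X' of copies of T has no positive extensions by T, so f lifts back along the tower to
  -- Z and then to X. The lift, preceded by any T ⟶ X', is radical, hence factors through b and dies
  -- in Z.
  · have hlift : ∃ g : X' ⟶ Z, f = g ≫ towerTo R hfin T Z 1 k := by
      induction k with
      | zero => exact ⟨f, (Category.comp_id f).symm⟩
      | succ k ih =>
        obtain ⟨g, hg⟩ := (towerCone R hfin T Z 1 k).exists_comp_u (hpos X' hX' _ (by lia)) f
        obtain ⟨g', hg'⟩ := ih g
        refine ⟨g', hg.trans ?_⟩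
        rw [hg', towerTo, Category.assoc]
        rfl
    obtain ⟨g, rfl⟩ := hlift
    obtain ⟨f₀, rfl⟩ := lift X' (hpos X' hX' 1 le_rfl) g
    obtain ⟨c, i', r', hir'⟩ := hX'
    have key : ∀ s, r' s ≫ f₀ ≫ u = 0 := by
      intro s
      obtain ⟨h, hh⟩ := hb' (r' s ≫ f₀) fun g => by
        rw [← Category.assoc]
        exact hne f₀ (g ≫ r' s)
      rw [← Category.assoc, ← hh, Category.assoc,
        show b ≫ u = 0 from comp_distTriang_mor_zero₁₂ _ hZ, comp_zero]
    have : f₀ ≫ u = 0 := by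
      rw [← Category.id_comp (f₀ ≫ u), ← hir', Preadditive.sum_comp]
      exact Finset.sum_eq_zero fun s _ => by rw [Category.assoc, key, comp_zero]
    rw [this, zero_comp]

include hfin in
/-- Let `T` be silting. If the category is generated by a finite family of objects, then `T` has
at most as many pairwise non-isomorphic summands with local endomorphism rings. -/
theorem IsSilting.card_le {T : C} (hT : IsSilting T) {ι ι' : Type*} [Fintype ι] [Fintype ι']
    (X : ι → C) (i : ∀ s, X s ⟶ T) (r : ∀ s, T ⟶ X s) (hir : ∀ s, i s ≫ r s = 𝟙 (X s))
    [∀ s, IsLocalRing (End (X s))]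
    (hne : ∀ s t, s ≠ t → ∀ (f : X s ⟶ X t) (g : X t ⟶ X s), ¬ IsIso (g ≫ f))
    (X' : ι' → C) (hX' : ∀ S : ObjectProperty C, S.IsTriangulated → S.IsClosedUnderIsomorphisms →
      (∀ l, S (X' l)) → S = ⊤) : Fintype.card ι ≤ Fintype.card ι' := by
  have hX : ∀ s, IsSplitOff T (X s) := fun s => (IsSplitOff.self T).of_retract _ _ (hir s)
  choose Y hY hYT hY₁ hY₂ using fun s => exists_detecting hfin hT (i s) (r s) (hir s)
  choose v N hv using fun s => exists_eulerSum_eq hfin X' hX' Y hY (X s)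
  let p := ∑ s, N s
  have hp : ∀ s, N s ≤ p := fun s => Finset.single_le_sum (fun _ _ => Nat.zero_le _)
    (Finset.mem_univ s)
  -- Only the term i = 0, that is j = p, survives: Y t (2 * p) receives nothing from the other
  -- shifts in the range -p ≤ i ≤ p.
  have hsum : ∀ s t, eulerSum R p (X s) (Y t (2 * p)) =
      (-1) ^ p * (homLength R (X s) (Y t (2 * p)) : ℤ) := by
    intro s t
    rw [eulerSum, Finset.sum_eq_single p]
    · rw [sub_self, homLength_congr ((shiftFunctorZero C ℤ).app (X s)) (Iso.refl _)]
      rfl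
    · intro j hj hjp
      rw [Finset.mem_range] at hj
      rw [homLength_eq_zero, Nat.cast_zero, mul_zero]
      exact hom_eq_zero_of_isSplitOff ((hX s).map (shiftFunctor C _)) (hYT t _ _ (by push_cast; lia))
    · intro h
      exact absurd (Finset.mem_range.2 (by lia)) h
  refine card_le_of_diagonal v (fun l t => eulerSum R p (X' l) (Y t (2 * p)))
    (fun s t hst => ?_) fun s => ?_
  · rw [← hv s p (hp s), hsum, homLength_eq_zero (hY₂ t _ (X s) (hX s) (hne s t hst))]
    simp
  · rw [← hv s p (hp s), hsum]
    obtain ⟨f, hf⟩ := hY₁ s (2 * p)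
    have := hfin (X s) (Y s (2 * p))
    exact mul_ne_zero (pow_ne_zero _ (by norm_num))
      (Int.natCast_ne_zero.2 (homLength_ne_zero (R := R) hf))

end Euler

/-! ### Indecomposable modules of finite length -/

section KrullSchmidt

variable {Λ : Type u} [Ring Λ]

/-- A decomposition into complementary submodules, as a biproduct. -/
def isoBiprodOfIsCompl {M : ModuleCat.{u} Λ} {p q : Submodule Λ M} (h : IsCompl p q) :
    M ≅ ModuleCat.of Λ p ⊞ ModuleCat.of Λ q :=
  (Submodule.prodEquivOfIsCompl p q h).symm.toModuleIso ≪≫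
    (ModuleCat.biprodIsoProd (ModuleCat.of Λ p) (ModuleCat.of Λ q)).symm

lemma Indecomposable.eq_bot_or_eq_bot {M : ModuleCat.{u} Λ} (hM : Indecomposable M)
    {p q : Submodule Λ M} (h : IsCompl p q) : p = ⊥ ∨ q = ⊥ := by
  refine (hM.2 _ _ (isoBiprodOfIsCompl h)).imp ?_ ?_ <;> intro h <;>
  · rw [ModuleCat.isZero_iff_subsingleton] at h
    exact (Submodule.subsingleton_iff_eq_bot).1 h

/-- Fitting's lemma: the kernel and the range of a large power of an endomorphism are complementary,
so the endomorphism is either invertible or nilpotent. -/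
lemma Indecomposable.isLocalRing_end {M : ModuleCat.{u} Λ} (hM : Indecomposable M)
    [IsArtinian Λ M] [IsNoetherian Λ M] : IsLocalRing (End M) := by
  have : Nontrivial (End M) := by
    refine ⟨𝟙 M, 0, fun h => hM.1 ((IsZero.iff_id_eq_zero M).2 h)⟩
  refine { isUnit_or_isUnit_of_add_one := fun {a b} hab => ?_ }
  let e := ModuleCat.endRingEquiv M
  obtain ⟨n, hn, h⟩ := (Filter.eventually_atTop.1
    (LinearMap.eventually_isCompl_ker_pow_range_pow (e a))).imp fun n h => (⟨h (n + 1) (by lia), h n le_rfl⟩ : _ ∧ _)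
  obtain h' | h' := Indecomposable.eq_bot_or_eq_bot hM hn
  · left
    have htop : LinearMap.range (e a ^ (n + 1)) = ⊤ := by
      simpa [h'] using hn.sup_eq_top
    have hu : IsUnit (e a ^ (n + 1)) :=
      (Module.End.isUnit_iff _).2 ⟨LinearMap.ker_eq_bot.1 h', LinearMap.range_eq_top.1 htop⟩
    have := (isUnit_pow_iff (Nat.succ_ne_zero n)).1 hu
    exact (MulEquiv.isUnit_map e).1 this
  · right
    have h0 : e a ^ (n + 1) = 0 := LinearMap.range_eq_bot.1 h'
    have hn' : IsNilpotent a := ⟨n + 1, e.injective (by rw [map_pow, h0, map_zero])⟩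
    rw [eq_sub_of_add_eq' hab]
    exact hn'.isUnit_one_sub

/-- The complement of a retract. -/
lemma exists_biprod_iso_of_retract {M N : ModuleCat.{u} Λ} (i : N ⟶ M) (r : M ⟶ N)
    (h : i ≫ r = 𝟙 N) : ∃ N', Nonempty (N ⊞ N' ≅ M) := by
  have h' : r.hom ∘ₗ i.hom = LinearMap.id := by
    rw [← ModuleCat.hom_comp, h, ModuleCat.hom_id]
  have hc : IsCompl (LinearMap.range i.hom) (LinearMap.ker r.hom) := by
    refine IsCompl.of_eq (eq_bot_iff.2 ?_) (eq_top_iff.2 fun x _ => ?_)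
    · rintro _ ⟨⟨y, rfl⟩, hy⟩
      have := LinearMap.congr_fun h' y
      simp only [SetLike.mem_coe, LinearMap.mem_ker] at hy
      simp only [LinearMap.comp_apply, hy, LinearMap.id_apply] at this
      simp [← this]
    · refine Submodule.mem_sup.2 ⟨i.hom (r.hom x), ⟨_, rfl⟩, x - i.hom (r.hom x), ?_, by abel⟩
      have := LinearMap.congr_fun h' (r.hom x)
      simp only [LinearMap.comp_apply, LinearMap.id_apply] at this
      rw [LinearMap.mem_ker, map_sub, this, sub_self]
  have hi : Function.Injective i.hom := Function.LeftInverse.injective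
    (g := r.hom) fun x => LinearMap.congr_fun h' x
  exact ⟨_, ⟨biprod.mapIso (LinearEquiv.ofInjective i.hom hi).toModuleIso (Iso.refl _) ≪≫
    (isoBiprodOfIsCompl hc).symm⟩⟩

/-- A retract of an indecomposable module of finite length is either zero or everything. -/
lemma Indecomposable.isIso_of_retract {M N : ModuleCat.{u} Λ} (hM : Indecomposable M)
    [IsArtinian Λ M] [IsNoetherian Λ M] (hN : ¬ IsZero N) (i : N ⟶ M) (r : M ⟶ N)
    (h : i ≫ r = 𝟙 N) : IsIso i := by
  have := Indecomposable.isLocalRing_end hM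
  -- The composite is an idempotent of a local ring, and it is not 0 because N is not zero.
  have key : IsIso (r ≫ i) := by
    by_contra hri
    have h1 : IsIso (𝟙 M - r ≫ i) := by
      by_contra h2
      refine not_isIso_add hri h2 ?_
      rw [add_sub_cancel]
      infer_instance
    have h3 : (r ≫ i) ≫ (𝟙 M - r ≫ i) = 0 := by
      rw [Preadditive.comp_sub, Category.comp_id, Category.assoc, reassoc_of% h, sub_self]
    have h4 : r ≫ i = 0 := by
      rw [← cancel_mono (𝟙 M - r ≫ i), h3, zero_comp]
    refine hN ((IsZero.iff_id_eq_zero N).2 ?_)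
    calc 𝟙 N = i ≫ (r ≫ i) ≫ r := by rw [Category.assoc, h, Category.comp_id, h]
      _ = 0 := by rw [h4, zero_comp, comp_zero]
  have : Epi i := epi_of_epi r i
  have : IsSplitMono i := ⟨⟨⟨r, h⟩⟩⟩
  exact isIso_of_epi_of_isSplitMono i

/-- An indecomposable module of finite length that splits off a finite sum of copies of `M` splits
off `M`. -/
lemma Indecomposable.exists_retract {M N : ModuleCat.{u} Λ} (hN : Indecomposable N)
    [IsArtinian Λ N] [IsNoetherian Λ N] (h : IsSplitOff M N) :
    ∃ (i : N ⟶ M) (r : M ⟶ N), i ≫ r = 𝟙 N := by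
  have := Indecomposable.isLocalRing_end hN
  obtain ⟨a, i, r, hir⟩ := h
  by_contra! hne
  refine not_isIso_sum Finset.univ (fun s => i s ≫ r s) (fun s _ hs => ?_)
    (hir ▸ (inferInstance : IsIso (𝟙 N)))
  exact hne (i s) (r s ≫ inv (i s ≫ r s)) (by rw [← Category.assoc, IsIso.hom_inv_id])

/-- Induction over modules of finite length, starting from indecomposable modules. -/
lemma induction_indecomposable {p : ModuleCat.{u} Λ → Prop}
    (hzero : ∀ M, IsZero M → p M)
    (hind : ∀ M : ModuleCat.{u} Λ, IsArtinian Λ M → IsNoetherian Λ M → Indecomposable M → p M)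
    (hsum : ∀ M N K, (M ≅ N ⊞ K) → p N → p K → p M)
    (M : ModuleCat.{u} Λ) [IsArtinian Λ M] [IsNoetherian Λ M] : p M := by
  suffices key : ∀ (n : ℕ) (M : ModuleCat.{u} Λ), IsArtinian Λ M → IsNoetherian Λ M →
      Module.length Λ M = n → p M by
    obtain ⟨n, hn⟩ := ENat.ne_top_iff_exists.1 (Module.length_ne_top (R := Λ) (M := M))
    exact key n M inferInstance inferInstance hn.symm
  intro n
  induction n using Nat.strong_induction_on with
  | _ n ih =>
    intro M _ _ hn
    by_cases h0 : IsZero M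
    · exact hzero M h0
    by_cases hi : Indecomposable M
    · exact hind M inferInstance inferInstance hi
    simp only [Indecomposable, h0, not_false_eq_true, true_and, not_forall, not_or] at hi
    obtain ⟨Y, Z, e, hY, hZ⟩ := hi
    let e' : M ≃ₗ[Λ] Y × Z := (e ≪≫ ModuleCat.biprodIsoProd Y Z).toLinearEquiv
    have hYa : IsArtinian Λ Y :=
      isArtinian_of_surjective M (LinearMap.fst Λ Y Z ∘ₗ e'.toLinearMap)
        ((LinearMap.fst_surjective (R := Λ) (M := Y) (M₂ := Z)).comp e'.surjective)
    have hYn : IsNoetherian Λ Y :=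
      isNoetherian_of_surjective (LinearMap.fst Λ Y Z ∘ₗ e'.toLinearMap)
        (LinearMap.range_eq_top.2 ((LinearMap.fst_surjective (R := Λ) (M := Y) (M₂ := Z)).comp e'.surjective))
    have hZa : IsArtinian Λ Z :=
      isArtinian_of_surjective M (LinearMap.snd Λ Y Z ∘ₗ e'.toLinearMap)
        ((LinearMap.snd_surjective (R := Λ) (M := Y) (M₂ := Z)).comp e'.surjective)
    have hZn : IsNoetherian Λ Z :=
      isNoetherian_of_surjective (LinearMap.snd Λ Y Z ∘ₗ e'.toLinearMap)
        (LinearMap.range_eq_top.2 ((LinearMap.snd_surjective (R := Λ) (M := Y) (M₂ := Z)).comp e'.surjective))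
    obtain ⟨y, hy⟩ := ENat.ne_top_iff_exists.1 (Module.length_ne_top (R := Λ) (M := Y))
    obtain ⟨z, hz⟩ := ENat.ne_top_iff_exists.1 (Module.length_ne_top (R := Λ) (M := Z))
    have hsumlen : n = y + z := by
      have := e'.length_eq
      rw [Module.length_prod, hn, ← hy, ← hz] at this
      exact_mod_cast this
    rw [ModuleCat.isZero_iff_subsingleton, ← Module.length_eq_zero_iff (R := Λ), ← hy] at hY
    rw [ModuleCat.isZero_iff_subsingleton, ← Module.length_eq_zero_iff (R := Λ), ← hz] at hZ
    have hy0 : y ≠ 0 := by exact_mod_cast hY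
    have hz0 : z ≠ 0 := by exact_mod_cast hZ
    exact hsum M Y Z e (ih y (by lia) Y hYa hYn hy.symm) (ih z (by lia) Z hZa hZn hz.symm)

end KrullSchmidt

/-! ### Simple modules, projective covers and composition factors -/

section Composition

variable {Λ : Type u} [Ring Λ]

/-- A superfluous submodule lies in every maximal one, so the kernel of f contains the kernel of p;
both are maximal, hence equal. -/
lemma IsSuperfluous.eq_of_ne_zero {P S S' : Type*} [AddCommGroup P] [Module Λ P]
    [AddCommGroup S] [Module Λ S] [AddCommGroup S'] [Module Λ S'] [IsSimpleModule Λ S]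
    [IsSimpleModule Λ S'] {p : P →ₗ[Λ] S} (hp : Function.Surjective p)
    (hs : IsSuperfluous (LinearMap.ker p)) {f : P →ₗ[Λ] S'} (hf : f ≠ 0) :
    Nonempty (S ≃ₗ[Λ] S') := by
  have hf' : Function.Surjective f := LinearMap.surjective_of_ne_zero hf
  have h1 : LinearMap.ker p ≤ LinearMap.ker f := by
    by_contra h
    have hm : IsCoatom (LinearMap.ker f) := LinearMap.isCoatom_ker_of_surjective hf'
    have := hm.2 (LinearMap.ker f ⊔ LinearMap.ker p) (left_lt_sup.2 h)
    exact hm.1 (hs _ this)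
  have h2 : LinearMap.ker p = LinearMap.ker f :=
    ((LinearMap.isCoatom_ker_of_surjective hp).le_iff.1 h1).resolve_left
      (fun h => hf (LinearMap.ker_eq_top.1 h)) |>.symm
  exact ⟨(p.quotKerEquivOfSurjective hp).symm ≪≫ₗ Submodule.quotEquivOfEq _ _ h2 ≪≫ₗ
    f.quotKerEquivOfSurjective hf'⟩

/-- Over an artinian ring, every simple module has a projective cover. -/
lemma exists_projective_cover [IsArtinianRing Λ] (S : ModuleCat.{u} Λ) [IsSimpleModule Λ S] :
    ∃ (P : ModuleCat.{u} Λ) (p : P →ₗ[Λ] S), Module.Projective Λ P ∧ Module.Finite Λ P ∧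
      Function.Surjective p ∧ IsSuperfluous (LinearMap.ker p) := by
  classical
  have hex : ∃ (n : ℕ) (P : ModuleCat.{u} Λ) (p : P →ₗ[Λ] S), Module.Projective Λ P ∧
      Module.Finite Λ P ∧ Function.Surjective p ∧ Module.length Λ P = n := by
    have := IsSimpleModule.nontrivial Λ S
    obtain ⟨x, hx⟩ := exists_ne (0 : S)
    obtain ⟨n, hn⟩ := ENat.ne_top_iff_exists.1 (Module.length_ne_top (R := Λ) (M := Λ))
    exact ⟨n, ModuleCat.of Λ Λ, LinearMap.toSpanSingleton Λ S x,
      inferInstanceAs (Module.Projective Λ Λ), inferInstanceAs (Module.Finite Λ Λ),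
      IsSimpleModule.toSpanSingleton_surjective Λ hx, hn.symm⟩
  -- Among the finitely generated projectives mapping onto S, one of minimal length is a projective
  -- cover.
  obtain ⟨P, p, hP, hPf, hp, hl⟩ := Nat.find_spec hex
  refine ⟨P, p, hP, hPf, hp, fun N hN => ?_⟩
  by_contra hne
  have hNs : Function.Surjective (p ∘ₗ N.subtype) := by
    rw [← LinearMap.range_eq_top, LinearMap.range_comp, Submodule.range_subtype]
    have := congrArg (Submodule.map p) hN
    rwa [Submodule.map_sup, Submodule.map_top, LinearMap.range_eq_top.2 hp,
      show Submodule.map p (LinearMap.ker p) = ⊥ from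
        (Submodule.map_le_iff_le_comap.2 le_rfl).antisymm bot_le, sup_bot_eq] at this
  obtain ⟨g, hg⟩ := Module.projective_lifting_property _ p hNs
  -- G lies over S and has image in N. The stable range of its powers is a direct summand of P
  -- inside N which still maps onto S, contradicting minimality.
  let G : Module.End Λ P := N.subtype ∘ₗ g
  have hpG : ∀ k, p ∘ₗ (G ^ k) = p := by
    intro k
    induction k with
    | zero => rfl
    | succ k ih => rw [pow_succ, Module.End.mul_eq_comp, ← LinearMap.comp_assoc, ih]; exact hg
  obtain ⟨n, hn⟩ := (Filter.eventually_atTop.1 (LinearMap.eventually_isCompl_ker_pow_range_pow G))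
  have hc := hn (n + 1) (by lia)
  have hle : LinearMap.range (G ^ (n + 1)) ≤ N := by
    rw [pow_succ', Module.End.mul_eq_comp]
    refine (LinearMap.range_comp_le_range _ _).trans ?_
    rintro _ ⟨x, rfl⟩
    exact (g x).2
  let P' := LinearMap.range (G ^ (n + 1))
  have hlt : Module.length Λ P' < Module.length Λ P :=
    Submodule.length_lt (fun h => hne (top_le_iff.1 (h ▸ hle)))
  obtain ⟨m, hm⟩ := ENat.ne_top_iff_exists.1 (Module.length_ne_top (R := Λ) (M := P'))
  refine Nat.find_min hex (m := m) ?_ ⟨ModuleCat.of Λ P', p ∘ₗ P'.subtype, ?_, ?_, ?_, hm.symm⟩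
  · rw [hl, ← hm] at hlt
    exact_mod_cast hlt
  · exact Module.Projective.of_split P'.subtype (P'.projectionOnto _ hc.symm)
      (LinearMap.ext fun x => Submodule.projectionOnto_apply_left hc.symm x)
  · exact inferInstanceAs (Module.Finite Λ P')
  · intro s
    obtain ⟨x, hx⟩ := hp s
    exact ⟨⟨_, x, rfl⟩, (LinearMap.congr_fun (hpG (n + 1)) x).trans hx⟩

lemma isSimpleModule_factor {M : ModuleCat.{u} Λ} (s : CompositionSeries (Submodule Λ M))
    (i : Fin s.length) :
    IsSimpleModule Λ (s i.succ ⧸ (s i.castSucc).comap (s i.succ).subtype) :=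
  (covBy_iff_quot_is_simple (s.strictMono (Fin.castSucc_lt_succ)).le).1 (s.step i)

/-- Maps from a projective cover of a simple module which is not a composition factor vanish. -/
lemma eq_zero_of_not_isCompositionFactor {P S M : ModuleCat.{u} Λ} [IsSimpleModule Λ S]
    [IsArtinian Λ M] [IsNoetherian Λ M] {p : P →ₗ[Λ] S} (hp : Function.Surjective p)
    (hs : IsSuperfluous (LinearMap.ker p)) (hS : ¬ IsCompositionFactor S M) (f : P →ₗ[Λ] M) :
    f = 0 := by
  obtain ⟨s, hs₀, hs₁⟩ := exists_compositionSeries_of_isNoetherian_isArtinian Λ M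
  -- The range of f descends the composition series: a nonzero induced map to a factor would
  -- identify that factor with S.
  have key : ∀ i : Fin (s.length + 1), LinearMap.range f ≤ s i → f = 0 := by
    intro i
    induction i using Fin.induction with
    | zero =>
      intro h
      refine LinearMap.range_eq_bot.1 (le_bot_iff.1 (h.trans ?_))
      exact hs₀.le
    | succ i ih =>
      intro h
      by_contra hf
      have := isSimpleModule_factor s i
      let g : P →ₗ[Λ] (s i.succ ⧸ (s i.castSucc).comap (s i.succ).subtype) :=
        (Submodule.mkQ _) ∘ₗ f.codRestrict (s i.succ) fun x => h ⟨x, rfl⟩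
      by_cases hg : g = 0
      · refine hf (ih ?_)
        rintro _ ⟨x, rfl⟩
        have := LinearMap.congr_fun hg x
        simpa [g, Submodule.Quotient.mk_eq_zero] using this
      · exact hS ⟨s, hs₀, hs₁, i, hs.eq_of_ne_zero hp hg⟩
  exact key (Fin.last _) (by
    have : s (Fin.last _) = ⊤ := hs₁
    rw [this]
    exact le_top)

/-- A nonzero finitely generated projective module has a nonzero map to every sincere module. -/
lemma IsSincere.exists_ne_zero {M : ModuleCat.{u} Λ} (hM : IsSincere M) (Q : ModuleCat.{u} Λ)
    [Module.Projective Λ Q] [Module.Finite Λ Q] [Nontrivial Q] : ∃ f : Q →ₗ[Λ] M, f ≠ 0 := by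
  obtain ⟨K, hK, -⟩ := (eq_top_or_exists_le_coatom (⊥ : Submodule Λ Q)).resolve_left bot_ne_top
  have : IsSimpleModule Λ (Q ⧸ K) := isSimpleModule_iff_isCoatom.2 hK
  obtain ⟨s, -, -, i, ⟨e⟩⟩ := hM (ModuleCat.of Λ (Q ⧸ K)) this
  -- A simple quotient of Q occurs as a factor of a composition series of M; lift Q ⟶ factor to the
  -- corresponding submodule of M.
  obtain ⟨g, hg⟩ := Module.projective_lifting_property
    ((s i.castSucc).comap (s i.succ).subtype).mkQ (e.toLinearMap ∘ₗ K.mkQ)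
    (Submodule.mkQ_surjective _)
  refine ⟨(s i.succ).subtype ∘ₗ g, fun h => hK.1 ?_⟩
  have hg0 : g = 0 := by
    ext x
    exact LinearMap.congr_fun h x
  rw [hg0, LinearMap.comp_zero] at hg
  rw [← Submodule.ker_mkQ K, LinearMap.ker_eq_top]
  ext x
  exact e.injective ((LinearMap.congr_fun hg x).symm.trans (map_zero e).symm)

end Composition

/-! ### Superfluous submodules and the Jacobson radical -/

section Radical

variable {Λ : Type u} [Ring Λ]

theorem IsSuperfluous.le_jacobson {P : Type*} [AddCommGroup P] [Module Λ P] {K : Submodule Λ P}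
    (hK : IsSuperfluous K) : K ≤ Module.jacobson Λ P := by
  refine le_sInf fun N hN => ?_
  by_contra h
  exact hN.1 (hK N ((hN.2 _ (lt_of_le_of_ne le_sup_left fun e => h (e ▸ le_sup_right)))))

/-- The quotient P / rad(Λ)P is a module over the semisimple ring Λ / rad(Λ), so its own radical is
zero. -/
theorem jacobson_le_smul_top [IsSemiprimaryRing Λ] (P : Type*) [AddCommGroup P] [Module Λ P] :
    Module.jacobson Λ P ≤ Ring.jacobson Λ • (⊤ : Submodule Λ P) := by
  refine Module.jacobson_le_of_eq_bot ?_
  have : IsSemisimpleModule Λ (P ⧸ (Ring.jacobson Λ • (⊤ : Submodule Λ P))) := by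
    have h : Module.IsTorsionBySet Λ (P ⧸ (Ring.jacobson Λ • (⊤ : Submodule Λ P)))
        (Ring.jacobson Λ) :=
      (Module.isTorsionBySet_quotient_iff _ _).2 fun m i hi => Submodule.smul_mem_smul hi trivial
    let _ := h.module
    exact (h.semilinearMap.isSemisimpleModule_iff_of_bijective Function.bijective_id).2
      inferInstance
  exact IsSemisimpleModule.jacobson_eq_bot _ _

theorem IsSuperfluous.le_smul_top [IsSemiprimaryRing Λ] {P : Type*} [AddCommGroup P] [Module Λ P]
    {K : Submodule Λ P} (hK : IsSuperfluous K) :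
    K ≤ Ring.jacobson Λ • (⊤ : Submodule Λ P) :=
  hK.le_jacobson.trans (jacobson_le_smul_top P)

theorem map_smul_top_le {P Q : Type*} [AddCommGroup P] [Module Λ P] [AddCommGroup Q] [Module Λ Q]
    (I : Ideal Λ) (f : P →ₗ[Λ] Q) : (I • (⊤ : Submodule Λ P)).map f ≤ I • ⊤ := by
  rw [Submodule.map_smul'']
  exact smul_mono_right _ le_top

end Radical

/-! ### Finiteness of the morphism spaces of `K^b(proj Λ)` -/

section HomFinite

open scoped ModuleCat.Algebra

variable (R : Type v) [CommRing R] {Λ : Type u} [Ring Λ] [Algebra R Λ]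

theorem moduleFinite_hom [IsNoetherianRing R] [Module.Finite R Λ] (M N : ModuleCat.{u} Λ)
    [Module.Finite Λ M] [Module.Finite Λ N] : Module.Finite R (M ⟶ N) := by
  obtain ⟨s, hs⟩ := (Module.Finite.fg_top : (⊤ : Submodule Λ M).FG)
  have : Module.Finite R N := Module.Finite.trans Λ N
  let ev : (M ⟶ N) →ₗ[R] (s → N) :=
    { toFun := fun f x => f.hom x.1
      map_add' := fun f g => rfl
      map_smul' := fun r f => rfl }
  refine Module.Finite.of_injective ev fun f g h => ?_
  ext x
  exact congrArg (fun l : M →ₗ[Λ] N => l x)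
    (LinearMap.ext_on hs (f := f.hom) (g := g.hom) fun x hx => congrFun h ⟨x, hx⟩)

theorem moduleFinite_hom_of_isBoundedProj [IsNoetherianRing R] [Module.Finite R Λ]
    {K L : CochainComplex (ModuleCat.{u} Λ) ℤ} (hK : IsBoundedProj Λ K) (hL : IsBoundedProj Λ L) :
    Module.Finite R (K ⟶ L) := by
  obtain ⟨⟨a, _⟩, ⟨b, _⟩, -, hK⟩ := hK
  have := hL.finite
  let ev : (K ⟶ L) →ₗ[R] (∀ i : Finset.Icc a b, (K.X i.1 ⟶ L.X i.1)) :=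
    { toFun := fun f i => f.f i.1
      map_add' := fun f g => rfl
      map_smul' := fun r f => rfl }
  have : ∀ i : Finset.Icc a b, Module.Finite R (K.X i.1 ⟶ L.X i.1) := fun i =>
    moduleFinite_hom R _ _
  refine Module.Finite.of_injective ev fun f g h => ?_
  ext1 i
  by_cases hi : a ≤ i ∧ i ≤ b
  · exact congrFun h ⟨i, Finset.mem_Icc.2 hi⟩
  · refine IsZero.eq_of_src ?_ _ _
    rw [not_and_or] at hi
    obtain hi | hi := hi
    · exact K.isZero_of_isStrictlyGE a i (by lia)
    · exact K.isZero_of_isStrictlyLE b i (by lia)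

theorem KbProj.moduleFinite_hom [IsNoetherianRing R] [Module.Finite R Λ] (X Y : KbProj Λ) :
    Module.Finite R (X ⟶ Y) := by
  have hX : IsBoundedProj Λ X.obj.as := (kbProj_quotient_obj_iff _).1 X.property
  have hY : IsBoundedProj Λ Y.obj.as := (kbProj_quotient_obj_iff _).1 Y.property
  have := moduleFinite_hom_of_isBoundedProj R hX hY
  let q : (X.obj.as ⟶ Y.obj.as) →ₗ[R] (X ⟶ Y) :=
    { toFun := fun f => ObjectProperty.homMk ((HomotopyCategory.quotient _ _).map f)
      map_add' := fun f g => rfl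
      map_smul' := fun r f => rfl }
  refine Module.Finite.of_surjective q fun f => ?_
  obtain ⟨g, hg⟩ := (HomotopyCategory.quotient _ _).map_surjective
    (X := X.obj.as) (Y := Y.obj.as) f.hom
  exact ⟨g, by ext1; exact hg⟩

end HomFinite

/-! ### The degree zero homology -/

section H0

variable {Λ : Type u} [Ring Λ]

/-- The degree zero homology, as a functor on `K^b(proj Λ)`. -/
def KbProj.homologyZero : KbProj Λ ⥤ ModuleCat.{u} Λ :=
  (kbProj Λ).ι ⋙ HomotopyCategory.homologyFunctor (ModuleCat.{u} Λ) (.up ℤ) 0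

instance : (KbProj.homologyZero (Λ := Λ)).Additive := by
  unfold KbProj.homologyZero
  infer_instance

/-- The morphism of `K^b(proj Λ)` given by a chain map. -/
def KbProj.homMk {K L : CochainComplex (ModuleCat.{u} Λ) ℤ} {hK : IsBoundedProj Λ K}
    {hL : IsBoundedProj Λ L} (f : K ⟶ L) : KbProj.mk K hK ⟶ KbProj.mk L hL :=
  ObjectProperty.homMk ((HomotopyCategory.quotient _ _).map f)

theorem KbProj.homMk_surjective {K L : CochainComplex (ModuleCat.{u} Λ) ℤ} {hK : IsBoundedProj Λ K}
    {hL : IsBoundedProj Λ L} (f : KbProj.mk K hK ⟶ KbProj.mk L hL) : ∃ g, KbProj.homMk g = f := by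
  obtain ⟨g, hg⟩ := (HomotopyCategory.quotient _ _).map_surjective (X := K) (Y := L) f.hom
  exact ⟨g, by ext1; exact hg⟩

theorem KbProj.homMk_comp {K L M : CochainComplex (ModuleCat.{u} Λ) ℤ} {hK : IsBoundedProj Λ K}
    {hL : IsBoundedProj Λ L} {hM : IsBoundedProj Λ M} (f : K ⟶ L) (g : L ⟶ M) :
    KbProj.homMk (hK := hK) (hL := hM) (f ≫ g) =
      KbProj.homMk (hL := hL) f ≫ KbProj.homMk g := by
  ext1
  exact (HomotopyCategory.quotient (ModuleCat.{u} Λ) (.up ℤ)).map_comp f g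

theorem KbProj.homMk_id {K : CochainComplex (ModuleCat.{u} Λ) ℤ} {hK : IsBoundedProj Λ K} :
    KbProj.homMk (hK := hK) (hL := hK) (𝟙 K) = 𝟙 _ := by
  ext1
  exact (HomotopyCategory.quotient (ModuleCat.{u} Λ) (.up ℤ)).map_id K

theorem KbProj.homMk_add {K L : CochainComplex (ModuleCat.{u} Λ) ℤ} {hK : IsBoundedProj Λ K}
    {hL : IsBoundedProj Λ L} (f g : K ⟶ L) :
    KbProj.homMk (hK := hK) (hL := hL) (f + g) = KbProj.homMk f + KbProj.homMk g := rfl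

theorem KbProj.homMk_eq_zero_iff {K L : CochainComplex (ModuleCat.{u} Λ) ℤ} {hK : IsBoundedProj Λ K}
    {hL : IsBoundedProj Λ L} (f : K ⟶ L) :
    KbProj.homMk (hK := hK) (hL := hL) f = 0 ↔ Nonempty (Homotopy f 0) := by
  rw [← HomotopyCategory.quotient_map_eq_zero_iff]
  exact ⟨fun h => congrArg (·.hom) h, fun h => by ext1; exact h⟩

/-- The homology of a complex in `K^b(proj Λ)` is the homology of the complex. -/
def KbProj.homologyZeroIso (K : CochainComplex (ModuleCat.{u} Λ) ℤ) (hK : IsBoundedProj Λ K) :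
    KbProj.homologyZero.obj (KbProj.mk K hK) ≅ K.homology 0 :=
  (HomotopyCategory.homologyFunctorFactors (ModuleCat.{u} Λ) (.up ℤ) 0).app K

theorem KbProj.homologyZeroIso_naturality {K L : CochainComplex (ModuleCat.{u} Λ) ℤ}
    {hK : IsBoundedProj Λ K} {hL : IsBoundedProj Λ L} (f : K ⟶ L) :
    KbProj.homologyZero.map (KbProj.homMk (hK := hK) (hL := hL) f) ≫
      (KbProj.homologyZeroIso L hL).hom =
    (KbProj.homologyZeroIso K hK).hom ≫ HomologicalComplex.homologyMap f 0 :=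
  (HomotopyCategory.homologyFunctorFactors (ModuleCat.{u} Λ) (.up ℤ) 0).hom.naturality f

theorem KbProj.homologyZero_map_homMk_eq_zero_iff {K L : CochainComplex (ModuleCat.{u} Λ) ℤ}
    {hK : IsBoundedProj Λ K} {hL : IsBoundedProj Λ L} (f : K ⟶ L) :
    KbProj.homologyZero.map (KbProj.homMk (hK := hK) (hL := hL) f) = 0 ↔
      HomologicalComplex.homologyMap f 0 = 0 := by
  rw [← cancel_mono (KbProj.homologyZeroIso L hL).hom, KbProj.homologyZeroIso_naturality,
    zero_comp, ← cancel_epi (KbProj.homologyZeroIso K hK).hom, comp_zero]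

/-- The canonical morphism `K⁰ ⟶ H⁰(K)` when the differential `K⁰ ⟶ K¹` is zero. -/
def augmentation (K : CochainComplex (ModuleCat.{u} Λ) ℤ) (h : K.d 0 1 = 0) :
    K.X 0 ⟶ K.homology 0 :=
  K.liftCycles (𝟙 _) 1 (by simp) (by simp [h]) ≫ K.homologyπ 0

theorem augmentation_naturality {K L : CochainComplex (ModuleCat.{u} Λ) ℤ} (hK : K.d 0 1 = 0)
    (hL : L.d 0 1 = 0) (f : K ⟶ L) :
    augmentation K hK ≫ HomologicalComplex.homologyMap f 0 = f.f 0 ≫ augmentation L hL := by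
  simp only [augmentation, Category.assoc, HomologicalComplex.homologyπ_naturality]
  rw [← Category.assoc, ← Category.assoc]
  congr 1
  rw [← cancel_mono (L.iCycles 0)]
  simp

instance (K : CochainComplex (ModuleCat.{u} Λ) ℤ) (h : K.d 0 1 = 0) :
    Epi (augmentation K h) := by
  have : IsIso (K.iCycles 0) := K.isIso_iCycles 0 1 (by simp) h
  have : IsIso (K.liftCycles (𝟙 (K.X 0)) 1 (by simp) (by simp [h])) :=
    IsIso.of_isIso_fac_right (K.liftCycles_i (𝟙 (K.X 0)) 1 (by simp) (by simp [h]))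
  unfold augmentation
  infer_instance

theorem d_augmentation (K : CochainComplex (ModuleCat.{u} Λ) ℤ) (h : K.d 0 1 = 0) :
    K.d (-1) 0 ≫ augmentation K h = 0 := by
  have : K.d (-1) 0 ≫ K.liftCycles (𝟙 _) 1 (by simp) (by simp [h]) = K.toCycles (-1) 0 := by
    rw [← cancel_mono (K.iCycles 0)]
    simp
  rw [augmentation, ← Category.assoc, this, HomologicalComplex.toCycles_comp_homologyπ]

theorem exact_augmentation (K : CochainComplex (ModuleCat.{u} Λ) ℤ) (h : K.d 0 1 = 0) :
    (ShortComplex.mk _ _ (d_augmentation K h)).Exact := by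
  have e : (ShortComplex.mk _ _ (K.toCycles_comp_homologyπ (-1) 0)).Exact :=
    ShortComplex.exact_of_g_is_cokernel _ (K.homologyIsCokernel (-1) 0 (by simp))
  have : IsIso (K.iCycles 0) := K.isIso_iCycles 0 1 (by simp) h
  refine (ShortComplex.exact_iff_of_iso ?_).1 e
  refine ShortComplex.isoMk (Iso.refl _) (asIso (K.iCycles 0)) (Iso.refl _) (by simp) ?_
  simp only [augmentation]
  dsimp
  rw [Category.comp_id, ← Category.assoc]
  have : K.iCycles 0 ≫ K.liftCycles (𝟙 _) 1 (by simp) (by simp [h]) = 𝟙 _ := by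
    rw [← cancel_mono (K.iCycles 0)]
    simp
  rw [this, Category.id_comp]

end H0

/-! ### Truncated minimal resolutions -/

section Truncated

variable {Λ : Type u} [Ring Λ]

/-- A complex of finitely generated projective modules, concentrated in degrees `[-n, 0]`, exact
in degrees `]-n, 0[`, and minimal. -/
structure IsTruncatedResolution (n : ℕ) (K : CochainComplex (ModuleCat.{u} Λ) ℤ) : Prop where
  isBoundedProj : IsBoundedProj Λ K
  isZero_of_lt : ∀ i : ℤ, i < -n → IsZero (K.X i)
  isZero_of_gt : ∀ i : ℤ, 0 < i → IsZero (K.X i)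
  exact : ∀ i j k : ℤ, -n < i → i < 0 → j + 1 = i → i + 1 = k →
    ∀ x : K.X i, (K.d i k).hom x = 0 → ∃ y : K.X j, (K.d j i).hom y = x
  d_mem : ∀ i j : ℤ, ∀ x : K.X i, (K.d i j).hom x ∈ Ring.jacobson Λ • (⊤ : Submodule Λ (K.X j))
  mem_of_d_eq_zero : ∀ i j : ℤ, i = -n → i + 1 = j → ∀ x : K.X i, (K.d i j).hom x = 0 →
    x ∈ Ring.jacobson Λ • (⊤ : Submodule Λ (K.X i))

theorem exists_lift_of_projective {P X Y : ModuleCat.{u} Λ} [Module.Projective Λ P] (f : P ⟶ X)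
    (d : Y ⟶ X) (h : ∀ x, ∃ y, d.hom y = f.hom x) : ∃ g : P ⟶ Y, g ≫ d = f := by
  have hf : ∀ x, f.hom x ∈ LinearMap.range d.hom := h
  obtain ⟨g, hg⟩ := Module.projective_lifting_property d.hom.rangeRestrict
    (f.hom.codRestrict _ hf) d.hom.surjective_rangeRestrict
  refine ⟨ModuleCat.ofHom g, ?_⟩
  ext x
  exact congrArg Subtype.val (LinearMap.congr_fun hg x)

namespace IsTruncatedResolution

variable {n : ℕ} {K : CochainComplex (ModuleCat.{u} Λ) ℤ} (hK : IsTruncatedResolution n K)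
include hK

theorem d_eq_zero : K.d 0 1 = 0 := (hK.isZero_of_gt 1 (by lia)).eq_of_tgt _ _

/-- The usual construction of a null-homotopy of a lift of zero, run from degree 0 down to degree -n
+ 1, where exactness stops. -/
theorem exists_homotopy (f : K ⟶ K) (hf : HomologicalComplex.homologyMap f 0 = 0) (k : ℕ)
    (hk : k < n) : ∀ i j l : ℤ, i = -k → j + 1 = i → i + 1 = l →
      ∃ (h : K.X i ⟶ K.X j) (g : K.X l ⟶ K.X i), f.f i = h ≫ K.d j i + K.d i l ≫ g := by
  induction k with
  | zero =>
    intro i j l hi hj hl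
    obtain rfl : i = 0 := by simpa using hi
    obtain rfl : j = -1 := by lia
    have := hK.isBoundedProj.projective 0
    obtain ⟨h, hh⟩ := exists_lift_of_projective (f.f 0) (K.d (-1) 0) fun x => by
      refine (ShortComplex.moduleCat_exact_iff _).1 (exact_augmentation K hK.d_eq_zero) _ ?_
      have := augmentation_naturality hK.d_eq_zero hK.d_eq_zero f
      rw [hf, comp_zero] at this
      exact (LinearMap.congr_fun (congrArg ModuleCat.Hom.hom this) x).symm
    exact ⟨h, 0, by simp [hh]⟩
  | succ k ih =>
    intro i j l hi hj hl
    obtain ⟨h, g, e⟩ := ih (by lia) l i (l + 1) (by push_cast at hi; lia) hl rfl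
    have := hK.isBoundedProj.projective i
    have hu : (f.f i - K.d i l ≫ h) ≫ K.d i l = 0 := by
      simp [e]
    obtain ⟨h', hh⟩ := exists_lift_of_projective (f.f i - K.d i l ≫ h) (K.d j i) fun x =>
      hK.exact i j l (by push_cast at hi; lia) (by push_cast at hi; lia) hj hl _
        (LinearMap.congr_fun (congrArg ModuleCat.Hom.hom hu) x)
    exact ⟨h', h, by simp [hh]⟩

theorem map_mem (hn : 1 ≤ n) (f : K ⟶ K) (hf : HomologicalComplex.homologyMap f 0 = 0) (i : ℤ)
    (x : K.X i) : (f.f i).hom x ∈ Ring.jacobson Λ • (⊤ : Submodule Λ (K.X i)) := by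
  have hmap : ∀ {X Y : ModuleCat.{u} Λ} (g : X ⟶ Y) (x : X),
      x ∈ Ring.jacobson Λ • (⊤ : Submodule Λ X) →
      g.hom x ∈ Ring.jacobson Λ • (⊤ : Submodule Λ Y) := fun g x hx =>
    map_smul_top_le _ g.hom (Submodule.mem_map_of_mem hx)
  by_cases h0 : 0 < i
  · have := ModuleCat.isZero_iff_subsingleton.1 (hK.isZero_of_gt i h0)
    rw [Subsingleton.elim ((f.f i).hom x) 0]
    exact Submodule.zero_mem _
  by_cases h1 : i < -n
  · have := ModuleCat.isZero_iff_subsingleton.1 (hK.isZero_of_lt i h1)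
    rw [Subsingleton.elim ((f.f i).hom x) 0]
    exact Submodule.zero_mem _
  by_cases h2 : i = -n
  -- In the lowest degree there is no further lift. Subtracting the homotopy coming from degree -n +
  -- 1 leaves a map into the kernel of the differential, which is in the radical by minimality.
  · obtain ⟨h, g, e⟩ := hK.exists_homotopy f hf (n - 1) (by lia) (i + 1) i (i + 1 + 1)
      (by lia) rfl rfl
    have hu : (f.f i - K.d i (i + 1) ≫ h) ≫ K.d i (i + 1) = 0 := by
      simp [e]
    have := hK.mem_of_d_eq_zero i (i + 1) h2 rfl ((f.f i - K.d i (i + 1) ≫ h).hom x)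
      (LinearMap.congr_fun (congrArg ModuleCat.Hom.hom hu) x)
    have e' : (f.f i).hom x = (f.f i - K.d i (i + 1) ≫ h).hom x + h.hom ((K.d i (i + 1)).hom x) := by
      simp
    rw [e']
    exact Submodule.add_mem _ this (hmap _ _ (hK.d_mem _ _ _))
  · obtain ⟨k, hk⟩ := Int.exists_eq_neg_ofNat (not_lt.1 h0)
    obtain ⟨h, g, e⟩ := hK.exists_homotopy f hf k (by lia) i (i - 1) (i + 1) hk (by lia) rfl
    rw [e]
    exact Submodule.add_mem _ (hK.d_mem _ _ _) (hmap g _ (hK.d_mem i (i + 1) x))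

end IsTruncatedResolution

/-- The endomorphisms in `K^b(proj Λ)` represented by a chain map with image in `J^k K`, where `J`
is the Jacobson radical. -/
def radicalPower {K : CochainComplex (ModuleCat.{u} Λ) ℤ} (hK : IsBoundedProj Λ K) (k : ℕ) :
    AddSubgroup (KbProj.mk K hK ⟶ KbProj.mk K hK) where
  carrier := {f | ∃ φ : K ⟶ K, KbProj.homMk φ = f ∧
    ∀ i x, (φ.f i).hom x ∈ Ring.jacobson Λ ^ k • (⊤ : Submodule Λ (K.X i))}
  add_mem' := by
    rintro _ _ ⟨φ, rfl, h⟩ ⟨ψ, rfl, h'⟩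
    exact ⟨φ + ψ, KbProj.homMk_add _ _, fun i x => Submodule.add_mem _ (h i x) (h' i x)⟩
  zero_mem' := ⟨0, rfl, fun i x => Submodule.zero_mem _⟩
  neg_mem' := by
    rintro _ ⟨φ, rfl, h⟩
    exact ⟨-φ, rfl, fun i x => Submodule.neg_mem _ (h i x)⟩

theorem map_mem_pow_smul_top {K L M : ModuleCat.{u} Λ} {f : K ⟶ L} {g : L ⟶ M} {a b : ℕ} (hb : b ≠ 0)
    (hf : ∀ x, f.hom x ∈ Ring.jacobson Λ ^ a • (⊤ : Submodule Λ L))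
    (hg : ∀ x, g.hom x ∈ Ring.jacobson Λ ^ b • (⊤ : Submodule Λ M)) (x : K) :
    (f ≫ g).hom x ∈ Ring.jacobson Λ ^ (a + b) • (⊤ : Submodule Λ M) := by
  rw [Submodule.pow_add _ hb, Submodule.mul_smul]
  have : (Ring.jacobson Λ ^ a • (⊤ : Submodule Λ L)).map g.hom ≤
      Ring.jacobson Λ ^ a • Ring.jacobson Λ ^ b • (⊤ : Submodule Λ M) := by
    rw [Submodule.map_smul'']
    refine smul_mono_right _ ?_
    rintro _ ⟨y, -, rfl⟩
    exact hg y
  exact this (Submodule.mem_map_of_mem (hf x))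

section

variable {K : CochainComplex (ModuleCat.{u} Λ) ℤ} {hK : IsBoundedProj Λ K}

theorem radicalPower_comp {f g : KbProj.mk K hK ⟶ KbProj.mk K hK} {a b : ℕ}
    (hb : b ≠ 0)
    (hf : f ∈ radicalPower hK a) (hg : g ∈ radicalPower hK b) :
    f ≫ g ∈ radicalPower hK (a + b) := by
  obtain ⟨φ, rfl, h⟩ := hf
  obtain ⟨ψ, rfl, h'⟩ := hg
  exact ⟨φ ≫ ψ, KbProj.homMk_comp _ _, fun i x => map_mem_pow_smul_top hb (h i) (h' i) x⟩

theorem eq_zero_of_mem_radicalPower {f : KbProj.mk K hK ⟶ KbProj.mk K hK} {k : ℕ}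
    (hk : Ring.jacobson Λ ^ k = ⊥) (hf : f ∈ radicalPower hK k) : f = 0 := by
  obtain ⟨φ, rfl, h⟩ := hf
  have : φ = 0 := by
    ext i x
    have := h i x
    rw [hk, Submodule.bot_smul] at this
    exact this
  rw [this]
  rfl

theorem IsTruncatedResolution.mem_radicalPower {n : ℕ} (h : IsTruncatedResolution n K)
    (hn : 1 ≤ n) (f : KbProj.mk K hK ⟶ KbProj.mk K hK) (hf : KbProj.homologyZero.map f = 0) :
    f ∈ radicalPower hK 1 := by
  obtain ⟨φ, rfl⟩ := KbProj.homMk_surjective f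
  rw [KbProj.homologyZero_map_homMk_eq_zero_iff] at hf
  refine ⟨φ, rfl, fun i x => ?_⟩
  rw [Submodule.pow_one]
  exact h.map_mem hn φ hf i x

/-- View g as a matrix of endomorphisms of K: every entry is zero on homology, hence in the radical,
and the entries of the powers of g lie in higher and higher powers of the nilpotent radical. -/
theorem IsTruncatedResolution.isNilpotent [IsSemiprimaryRing Λ] {n : ℕ}
    (h : IsTruncatedResolution n K) (hn : 1 ≤ n) {X : KbProj Λ} (hX : IsSplitOff (KbProj.mk K hK) X)
    (g : End X) (hg : KbProj.homologyZero.map g = 0) : IsNilpotent g := by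
  obtain ⟨a, i, r, e⟩ := hX
  obtain ⟨m, hm⟩ := IsSemiprimaryRing.isNilpotent (R := Λ)
  have key : ∀ k : ℕ, ∀ s t, r s ≫ (g ^ (k + 1) : End X) ≫ i t ∈ radicalPower hK (k + 1) := by
    intro k
    induction k with
    | zero =>
      intro s t
      refine h.mem_radicalPower hn _ ?_
      rw [zero_add, pow_one]
      simp only [Functor.map_comp, hg, zero_comp, comp_zero]
    | succ k ih =>
      intro s t
      have : r s ≫ (g ^ (k + 1 + 1) : End X) ≫ i t =
          ∑ w, (r s ≫ g ≫ i w) ≫ (r w ≫ (g ^ (k + 1) : End X) ≫ i t) := by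
        have h1 : (g ^ (k + 1 + 1) : End X) = g ≫ (g ^ (k + 1) : End X) := pow_succ _ _
        rw [h1]
        calc _ = r s ≫ g ≫ (𝟙 X) ≫ (g ^ (k + 1) : End X) ≫ i t := by simp
          _ = _ := by
            rw [← e]
            simp only [Preadditive.sum_comp, Preadditive.comp_sum, Category.assoc]
      rw [this]
      refine AddSubgroup.sum_mem _ fun w _ => ?_
      rw [add_comm (k + 1) 1]
      refine radicalPower_comp k.succ_ne_zero (h.mem_radicalPower hn _ ?_) (ih w t)
      simp only [Functor.map_comp, hg, zero_comp, comp_zero]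
  refine ⟨m + 1, ?_⟩
  have hz : ∀ s t, r s ≫ (g ^ (m + 1) : End X) ≫ i t = 0 := fun s t =>
    eq_zero_of_mem_radicalPower (k := m + 1) (by rw [Submodule.pow_succ, hm]; exact zero_mul _) (key m s t)
  have : (g ^ (m + 1) : End X) = 𝟙 X ≫ (g ^ (m + 1) : End X) ≫ 𝟙 X := by simp
  rw [this, ← e]
  simp only [Preadditive.sum_comp, Preadditive.comp_sum, Category.assoc]
  refine Finset.sum_eq_zero fun s _ => Finset.sum_eq_zero fun t _ => ?_
  have := congrArg (fun z => i t ≫ z ≫ r s) (hz t s)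
  simpa using this

end

end Truncated

/-! ### The truncations of a minimal projective resolution -/

section StupidTrunc

theorem stupidTrunc_d_stupidTruncXIso {C : Type*} [Category C] [HasZeroMorphisms C] [HasZeroObject C]
    {ι ι' : Type*} {c : ComplexShape ι} {c' : ComplexShape ι'} (K : HomologicalComplex C c')
    (e : c.Embedding c') [e.IsRelIff] {i j : ι} {i' j' : ι'} (hi : e.f i = i') (hj : e.f j = j') :
    (K.stupidTrunc e).d i' j' ≫ (K.stupidTruncXIso e hj).hom =
      (K.stupidTruncXIso e hi).hom ≫ K.d i' j' := by
  subst hi hj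
  have h : ((K.restriction e).extend e).d (e.f i) (e.f j) ≫
      ((K.restriction e).extendXIso e rfl).hom =
      ((K.restriction e).extendXIso e rfl).hom ≫ (K.restriction e).d i j := by
    rw [HomologicalComplex.extend_d_eq _ e rfl rfl]
    simp only [Category.assoc, Iso.inv_hom_id, Category.comp_id]
  change _ ≫ (((K.restriction e).extendXIso e rfl).hom ≫ 𝟙 _) =
    (((K.restriction e).extendXIso e rfl).hom ≫ 𝟙 _) ≫ K.d (e.f i) (e.f j)
  rw [Category.comp_id, Category.comp_id]
  exact h

end StupidTrunc

namespace MinProjRes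

variable {Λ : Type u} [Ring Λ] {M : ModuleCat.{u} Λ} (P : MinProjRes M)

theorem d_mem_jacobson [IsSemiprimaryRing Λ] (i j : ℕ) (x : P.complex.X i) :
    (P.complex.d i j).hom x ∈ Ring.jacobson Λ • (⊤ : Submodule Λ (P.complex.X j)) := by
  by_cases hij : (ComplexShape.down ℕ).Rel i j
  · obtain rfl : j + 1 = i := hij
    cases j with
    | zero =>
      refine P.superfluous_zero.le_smul_top ?_
      exact LinearMap.congr_fun (congrArg ModuleCat.Hom.hom P.complex_d_comp_π_f_zero) x
    | succ j =>
      refine (P.superfluous_succ j).le_smul_top ?_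
      exact LinearMap.congr_fun (congrArg ModuleCat.Hom.hom (P.complex.d_comp_d _ _ _)) x
  · rw [P.complex.shape _ _ hij]
    exact Submodule.zero_mem _

theorem embeddingUpIntGE_f_sub (n : ℕ) (i : ℤ) (k : ℕ) (hi : i = -k) (hk : k ≤ n) :
    (ComplexShape.embeddingUpIntGE (-(n : ℤ))).f (n - k) = i :=
  show -(n : ℤ) + (n - k : ℕ) = i by lia

/-- The terms of the truncation of a minimal projective resolution. -/
def truncXIso (n : ℕ) (i : ℤ) (k : ℕ) (hi : i = -k) (hk : k ≤ n) :
    (P.trunc n).X i ≅ P.complex.X k :=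
  P.toProjectiveResolution.cochainComplex.stupidTruncXIso
    (ComplexShape.embeddingUpIntGE (-(n : ℤ))) (embeddingUpIntGE_f_sub n i k hi hk) ≪≫
  P.toProjectiveResolution.cochainComplexXIso i k hi.symm

theorem trunc_d_truncXIso (n : ℕ) (i j : ℤ) (k l : ℕ) (hi : i = -k) (hj : j = -l) (hk : k ≤ n)
    (hl : l ≤ n) : (P.trunc n).d i j ≫ (P.truncXIso n j l hj hl).hom =
      (P.truncXIso n i k hi hk).hom ≫ P.complex.d k l := by
  have h := stupidTrunc_d_stupidTruncXIso P.toProjectiveResolution.cochainComplex _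
    (embeddingUpIntGE_f_sub n i k hi hk) (embeddingUpIntGE_f_sub n j l hj hl)
  have h' : P.toProjectiveResolution.cochainComplex.d i j ≫
      (P.toProjectiveResolution.cochainComplexXIso j l hj.symm).hom =
      (P.toProjectiveResolution.cochainComplexXIso i k hi.symm).hom ≫ P.complex.d k l := by
    rw [P.toProjectiveResolution.cochainComplex_d i j k l hi.symm hj.symm]
    simp
  refine (Category.assoc _ _ _).symm.trans ((congrArg (· ≫ _) h).trans ?_)
  refine (Category.assoc _ _ _).trans ((congrArg (_ ≫ ·) h').trans (Category.assoc _ _ _).symm)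

theorem isZero_trunc_of_lt (n : ℕ) (i : ℤ) (hi : i < -n) : IsZero ((P.trunc n).X i) :=
  HomologicalComplex.isZero_stupidTrunc_X _ _ _
    ((ComplexShape.notMem_range_embeddingUpIntGE_iff _ _).2 (by lia))

theorem isZero_trunc_of_gt (n : ℕ) (i : ℤ) (hi : 0 < i) : IsZero ((P.trunc n).X i) := by
  obtain ⟨j, hj⟩ := Int.eq_ofNat_of_zero_le (a := i + n) (by lia)
  exact IsZero.of_iso (P.toProjectiveResolution.cochainComplex.isZero_of_isStrictlyLE 0 i hi)
    (P.toProjectiveResolution.cochainComplex.stupidTruncXIso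
      (ComplexShape.embeddingUpIntGE (-(n : ℤ))) (i := j) (show -(n : ℤ) + j = i by lia))

theorem mem_smul_top_iff {X Y : ModuleCat.{u} Λ} (e : X ≅ Y) (x : X) (I : Ideal Λ) :
    e.hom.hom x ∈ I • (⊤ : Submodule Λ Y) ↔ x ∈ I • (⊤ : Submodule Λ X) := by
  refine ⟨fun h => ?_, fun h => map_smul_top_le _ e.hom.hom (Submodule.mem_map_of_mem h)⟩
  have := map_smul_top_le _ e.inv.hom (Submodule.mem_map_of_mem h)
  simpa using this

theorem trunc_d_apply (n : ℕ) (i j : ℤ) (k l : ℕ) (hi : i = -k) (hj : j = -l) (hk : k ≤ n)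
    (hl : l ≤ n) (x : (P.trunc n).X i) :
    (P.truncXIso n j l hj hl).hom.hom (((P.trunc n).d i j).hom x) =
      (P.complex.d k l).hom ((P.truncXIso n i k hi hk).hom.hom x) :=
  LinearMap.congr_fun (congrArg ModuleCat.Hom.hom (P.trunc_d_truncXIso n i j k l hi hj hk hl)) x

theorem isTruncatedResolution [IsSemiprimaryRing Λ] (n : ℕ) (hn : 1 ≤ n) :
    IsTruncatedResolution n (P.trunc n) where
  isBoundedProj := P.isBoundedProj_trunc n
  isZero_of_lt := P.isZero_trunc_of_lt n
  isZero_of_gt := P.isZero_trunc_of_gt n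
  exact := by
    intro i j k h1 h2 hj hk x hx
    obtain ⟨m, hm⟩ := Int.eq_ofNat_of_zero_le (a := -k) (by lia)
    have hc := P.trunc_d_apply n i k (m + 1) m (by lia) (by lia) (by lia) (by lia) x
    rw [hx, map_zero] at hc
    obtain ⟨y, hy⟩ := (ShortComplex.moduleCat_exact_iff _).1 (P.exact_succ m) _ hc.symm
    refine ⟨(P.truncXIso n j (m + 2) (by lia) (by lia)).inv.hom y, ?_⟩
    apply (P.truncXIso n i (m + 1) (by lia) (by lia)).toLinearEquiv.injective
    refine (P.trunc_d_apply n j i (m + 2) (m + 1) (by lia) (by lia) (by lia) (by lia) _).trans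
      (Eq.trans ?_ hy)
    simp
  d_mem := by
    intro i j x
    by_cases h : -n ≤ i ∧ i ≤ 0 ∧ -n ≤ j ∧ j ≤ 0
    · obtain ⟨a, ha⟩ := Int.eq_ofNat_of_zero_le (a := -i) (by lia)
      obtain ⟨b, hb⟩ := Int.eq_ofNat_of_zero_le (a := -j) (by lia)
      rw [← mem_smul_top_iff (P.truncXIso n j b (by lia) (by lia)),
        P.trunc_d_apply n i j a b (by lia) (by lia) (by lia) (by lia)]
      exact P.d_mem_jacobson _ _ _
    · have : (P.trunc n).d i j = 0 := by
        by_cases h1 : i < -n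
        · exact (P.isZero_trunc_of_lt n i h1).eq_of_src _ _
        by_cases h2 : 0 < i
        · exact (P.isZero_trunc_of_gt n i h2).eq_of_src _ _
        by_cases h3 : j < -n
        · exact (P.isZero_trunc_of_lt n j h3).eq_of_tgt _ _
        · exact (P.isZero_trunc_of_gt n j (by lia)).eq_of_tgt _ _
      rw [this]
      exact Submodule.zero_mem _
  mem_of_d_eq_zero := by
    intro i j hi hj x hx
    obtain ⟨m, rfl⟩ := Nat.exists_eq_add_of_le' hn
    have hc := P.trunc_d_apply (m + 1) i j (m + 1) m (by lia) (by lia) (by lia) (by lia) x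
    rw [hx, map_zero] at hc
    rw [← mem_smul_top_iff (P.truncXIso (m + 1) i (m + 1) (by lia) (by lia))]
    exact (P.superfluous_succ m).le_smul_top hc.symm

theorem trunc_d_zero_one (n : ℕ) : (P.trunc n).d 0 1 = 0 :=
  (P.isZero_trunc_of_gt n 1 (by lia)).eq_of_tgt _ _

/-- The augmentation `P₀ ⟶ M`. -/
def π₀ : P.complex.X 0 ⟶ M := P.π.f 0

theorem d_π₀ : P.complex.d 1 0 ≫ P.π₀ = 0 := P.complex_d_comp_π_f_zero

theorem exact_π₀ : (ShortComplex.mk _ _ P.d_π₀).Exact := P.exact₀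

instance : Epi P.π₀ := inferInstanceAs (Epi (P.π.f 0))

/-- `M` is the degree zero homology of the truncation. -/
theorem exists_homologyIso (n : ℕ) (hn : 1 ≤ n) :
    ∃ e : (P.trunc n).homology 0 ≅ M, augmentation (P.trunc n) (P.trunc_d_zero_one n) ≫ e.hom =
      (P.truncXIso n 0 0 rfl (by lia)).hom ≫ P.π₀ := by
  have h : (P.trunc n).d (-1) 0 ≫ (P.truncXIso n 0 0 rfl (by lia)).hom ≫ P.π₀ = 0 := by
    rw [← Category.assoc, P.trunc_d_truncXIso n (-1) 0 1 0 rfl rfl hn (by lia), Category.assoc,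
      d_π₀, comp_zero]
  have hex : (ShortComplex.mk _ _ h).Exact := by
    refine (ShortComplex.exact_iff_of_iso ?_).2 P.exact_π₀
    exact ShortComplex.isoMk (P.truncXIso n (-1) 1 rfl hn) (P.truncXIso n 0 0 rfl (by lia))
      (Iso.refl _) (P.trunc_d_truncXIso n (-1) 0 1 0 rfl rfl hn (by lia)).symm (by simp)
  have : Epi (ShortComplex.mk _ _ h).g := by dsimp; infer_instance
  have : Epi (ShortComplex.mk _ _ (d_augmentation _ (P.trunc_d_zero_one n))).g := by
    dsimp; infer_instance
  refine ⟨(exact_augmentation _ (P.trunc_d_zero_one n)).gIsCokernel.coconePointUniqueUpToIso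
    hex.gIsCokernel, ?_⟩
  exact (exact_augmentation _ (P.trunc_d_zero_one n)).gIsCokernel.comp_coconePointUniqueUpToIso_hom
    hex.gIsCokernel WalkingParallelPair.one

/-- Lift the endomorphism of M to the whole resolution by the comparison theorem and truncate the
lift. -/
theorem exists_homologyMap_eq (n : ℕ) (hn : 1 ≤ n)
    (φ : (P.trunc n).homology 0 ⟶ (P.trunc n).homology 0) :
    ∃ f : P.trunc n ⟶ P.trunc n, HomologicalComplex.homologyMap f 0 = φ := by
  obtain ⟨e, he⟩ := P.exists_homologyIso n hn
  let ψ : M ⟶ M := e.inv ≫ φ ≫ e.hom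
  let l : ProjectiveResolution.Hom P.toProjectiveResolution P.toProjectiveResolution ψ :=
    { hom := ProjectiveResolution.lift ψ _ _
      hom_f_zero_comp_π_f_zero := ProjectiveResolution.lift_commutes_zero ψ _ _ }
  let f : P.trunc n ⟶ P.trunc n := HomologicalComplex.stupidTruncMap l.hom' _
  have hl : l.hom.f 0 ≫ P.π₀ = P.π₀ ≫ ψ := ProjectiveResolution.lift_commutes_zero ψ _ _
  have hf : f.f 0 ≫ (P.truncXIso n 0 0 rfl (by lia)).hom =
      (P.truncXIso n 0 0 rfl (by lia)).hom ≫ l.hom.f 0 := by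
    have h := HomologicalComplex.stupidTruncMap_stupidTruncXIso_hom l.hom' _
      (embeddingUpIntGE_f_sub n 0 0 rfl (by lia))
    have h' : l.hom'.f 0 ≫ (P.toProjectiveResolution.cochainComplexXIso 0 0 rfl).hom =
        (P.toProjectiveResolution.cochainComplexXIso 0 0 rfl).hom ≫ l.hom.f 0 := by
      rw [l.hom'_f 0 0 rfl]
      simp
    refine (Category.assoc _ _ _).symm.trans ((congrArg (· ≫ _) h).trans ?_)
    refine (Category.assoc _ _ _).trans ((congrArg (_ ≫ ·) h').trans (Category.assoc _ _ _).symm)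
  refine ⟨f, ?_⟩
  rw [← cancel_epi (augmentation (P.trunc n) (P.trunc_d_zero_one n)), ← cancel_mono e.hom,
    augmentation_naturality _ (P.trunc_d_zero_one n), Category.assoc, he, ← Category.assoc, hf,
    Category.assoc, hl, ← Category.assoc, ← he]
  simp [ψ]

end MinProjRes

/-! ### Degree zero homology on the objects split off the truncation -/

section

theorem isUnit_end_of_isNilpotent_sub_one {C : Type*} [Category C] [Preadditive C] {X : C}
    (f : End X) (h : IsNilpotent (f - 1)) : IsIso (f : X ⟶ X) := by
  have := h.isUnit_add_one
  rw [sub_add_cancel] at this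
  exact (isUnit_iff_isIso f).1 this

end

namespace MinProjRes

variable {Λ : Type u} [Ring Λ] {M : ModuleCat.{u} Λ} (P : MinProjRes M) (n : ℕ)

/-- The truncation `P_{≥ -n}(M)` as an object of `K^b(proj Λ)`. -/
abbrev truncObj : KbProj Λ := KbProj.mk (P.trunc n) (P.isBoundedProj_trunc n)

variable (hn : 1 ≤ n)
include hn

theorem nonempty_homologyZero_iso : Nonempty (KbProj.homologyZero.obj (P.truncObj n) ≅ M) := by
  obtain ⟨e, -⟩ := P.exists_homologyIso n hn
  exact ⟨KbProj.homologyZeroIso _ _ ≪≫ e⟩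

theorem exists_homologyZero_map_eq
    (φ : KbProj.homologyZero.obj (P.truncObj n) ⟶ KbProj.homologyZero.obj (P.truncObj n)) :
    ∃ f, KbProj.homologyZero.map f = φ := by
  obtain ⟨f, hf⟩ := P.exists_homologyMap_eq n hn
    ((KbProj.homologyZeroIso _ _).inv ≫ φ ≫ (KbProj.homologyZeroIso _ _).hom)
  refine ⟨KbProj.homMk f, ?_⟩
  rw [← cancel_mono (KbProj.homologyZeroIso _ _).hom, KbProj.homologyZeroIso_naturality, hf]
  simp

/-- The degree zero homology is full on the objects split off the truncation. -/
theorem exists_homologyZero_map_eq_of_isSplitOff {X Y : KbProj Λ}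
    (hX : IsSplitOff (P.truncObj n) X) (hY : IsSplitOff (P.truncObj n) Y)
    (φ : KbProj.homologyZero.obj X ⟶ KbProj.homologyZero.obj Y) :
    ∃ f, KbProj.homologyZero.map f = φ := by
  obtain ⟨a, i, r, e⟩ := hX
  obtain ⟨b, i', r', e'⟩ := hY
  have := fun s t => P.exists_homologyZero_map_eq n hn
    (KbProj.homologyZero.map (r s) ≫ φ ≫ KbProj.homologyZero.map (i' t))
  choose f hf using this
  refine ⟨∑ s, ∑ t, i s ≫ f s t ≫ r' t, ?_⟩
  simp only [Functor.map_sum, Functor.map_comp, hf]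
  have h : φ = KbProj.homologyZero.map (𝟙 X) ≫ φ ≫ KbProj.homologyZero.map (𝟙 Y) := by simp
  rw [← e, ← e'] at h
  refine Eq.trans ?_ h.symm
  simp only [Functor.map_sum, Functor.map_comp, Preadditive.sum_comp, Preadditive.comp_sum,
    Category.assoc]
  rw [Finset.sum_comm]

variable [IsSemiprimaryRing Λ]

theorem isNilpotent_of_homologyZero_map_eq_zero {X : KbProj Λ} (hX : IsSplitOff (P.truncObj n) X)
    (g : End X) (hg : KbProj.homologyZero.map g = 0) : IsNilpotent g :=
  (P.isTruncatedResolution n hn).isNilpotent hn hX g hg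

theorem isIso_of_homologyZero_map_eq_id {X : KbProj Λ} (hX : IsSplitOff (P.truncObj n) X)
    (g : X ⟶ X) (hg : KbProj.homologyZero.map g = 𝟙 _) : IsIso g := by
  refine isUnit_end_of_isNilpotent_sub_one g
    (P.isNilpotent_of_homologyZero_map_eq_zero n hn hX _ ?_)
  change KbProj.homologyZero.map (g - 𝟙 X) = 0
  rw [Functor.map_sub, hg, CategoryTheory.Functor.map_id, sub_self]

/-- The degree zero homology reflects isomorphisms between objects split off the truncation. -/
theorem isIso_of_isIso_homologyZero_map {X Y : KbProj Λ}
    (hX : IsSplitOff (P.truncObj n) X) (hY : IsSplitOff (P.truncObj n) Y)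
    (f : X ⟶ Y) [IsIso (KbProj.homologyZero.map f)] : IsIso f := by
  obtain ⟨g, hg⟩ := P.exists_homologyZero_map_eq_of_isSplitOff n hn hY hX
    (inv (KbProj.homologyZero.map f))
  have h1 : IsIso (f ≫ g) := P.isIso_of_homologyZero_map_eq_id n hn hX _ (by
    rw [Functor.map_comp, hg, IsIso.hom_inv_id])
  have h2 : IsIso (g ≫ f) := P.isIso_of_homologyZero_map_eq_id n hn hY _ (by
    rw [Functor.map_comp, hg, IsIso.inv_hom_id])
  have : Mono f := mono_of_mono f g
  have : IsSplitEpi f := IsSplitEpi.mk' ⟨inv (g ≫ f) ≫ g, by rw [Category.assoc, IsIso.inv_hom_id]⟩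
  exact isIso_of_mono_of_isSplitEpi f

theorem nonempty_iso_of_homologyZero_iso {X Y : KbProj Λ}
    (hX : IsSplitOff (P.truncObj n) X) (hY : IsSplitOff (P.truncObj n) Y)
    (e : KbProj.homologyZero.obj X ≅ KbProj.homologyZero.obj Y) : Nonempty (X ≅ Y) := by
  obtain ⟨f, hf⟩ := P.exists_homologyZero_map_eq_of_isSplitOff n hn hX hY e.hom
  have : IsIso (KbProj.homologyZero.map f) := by rw [hf]; infer_instance
  have := P.isIso_of_isIso_homologyZero_map n hn hX hY f
  exact ⟨asIso f⟩

theorem isZero_of_isZero_homologyZero {X : KbProj Λ} (hX : IsSplitOff (P.truncObj n) X)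
    (h : IsZero (KbProj.homologyZero.obj X)) : IsZero X := by
  obtain ⟨k, hk⟩ := P.isNilpotent_of_homologyZero_map_eq_zero n hn hX (1 : End X)
    (h.eq_of_src _ _)
  rw [one_pow] at hk
  exact (IsZero.iff_id_eq_zero X).2 hk

/-- Nilpotency holds already for chain maps, before passing to homotopy classes. Idempotents can
therefore be lifted to the abelian category of complexes, where they split. -/
theorem isNilpotent_of_homologyMap_eq_zero (g : End (P.trunc n))
    (hg : HomologicalComplex.homologyMap (g : P.trunc n ⟶ P.trunc n) 0 = 0) : IsNilpotent g := by
  obtain ⟨m, hm⟩ := IsSemiprimaryRing.isNilpotent (R := Λ)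
  have key : ∀ k : ℕ, ∀ i x, (((g ^ (k + 1) : End (P.trunc n)) : P.trunc n ⟶ P.trunc n).f i).hom x ∈
      Ring.jacobson Λ ^ (k + 1) • (⊤ : Submodule Λ ((P.trunc n).X i)) := by
    have h1 : ∀ i x, ((g : P.trunc n ⟶ P.trunc n).f i).hom x ∈
      Ring.jacobson Λ ^ 1 • (⊤ : Submodule Λ ((P.trunc n).X i)) := fun i x => by
      rw [Submodule.pow_one]
      exact (P.isTruncatedResolution n hn).map_mem hn g hg i x
    intro k
    induction k with
    | zero => rw [zero_add, pow_one]; exact h1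
    | succ k ih =>
      intro i x
      rw [pow_succ, add_comm (k + 1) 1]
      exact map_mem_pow_smul_top k.succ_ne_zero (h1 i) (ih i) x
  refine ⟨m + 1, ?_⟩
  refine HomologicalComplex.hom_ext _ _ fun i => ?_
  ext x
  have := key m i x
  rw [Submodule.pow_succ, hm] at this
  rw [show (0 * Ring.jacobson Λ : Ideal Λ) = ⊥ from zero_mul _, Submodule.bot_smul] at this
  exact this

/-- The retracts of `M` lift to retracts of the truncation. -/
theorem exists_retract_of_retract {N : ModuleCat.{u} Λ} (i : N ⟶ M) (r : M ⟶ N)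
    (h : i ≫ r = 𝟙 N) : ∃ (X : KbProj Λ) (j : X ⟶ P.truncObj n) (q : P.truncObj n ⟶ X),
      j ≫ q = 𝟙 X ∧ Nonempty (KbProj.homologyZero.obj X ≅ N) := by
  obtain ⟨e, -⟩ := P.exists_homologyIso n hn
  let F : End (P.trunc n) →+* End ((P.trunc n).homology 0) :=
    { toFun := fun f => HomologicalComplex.homologyMap f 0
      map_one' := HomologicalComplex.homologyMap_id _ _
      map_mul' := fun f g => HomologicalComplex.homologyMap_comp _ _ _
      map_zero' := HomologicalComplex.homologyMap_zero _ _ _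
      map_add' := fun f g => HomologicalComplex.homologyMap_add _ _ _ }
  let ε : End ((P.trunc n).homology 0) := e.hom ≫ r ≫ i ≫ e.inv
  have hε : IsIdempotentElem ε := by
    change (e.hom ≫ r ≫ i ≫ e.inv) ≫ (e.hom ≫ r ≫ i ≫ e.inv) = e.hom ≫ r ≫ i ≫ e.inv
    simp [reassoc_of% h]
  obtain ⟨p, hp, hF⟩ := exists_isIdempotentElem_eq_of_ker_isNilpotent F
    (fun g hg => P.isNilpotent_of_homologyMap_eq_zero n hn g hg) ε
    (P.exists_homologyMap_eq n hn ε) hε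
  obtain ⟨Y, j, q, hjq, hqj⟩ := IsIdempotentComplete.idempotents_split (P.trunc n) p hp
  have hY : ∀ a, j.f a ≫ q.f a = 𝟙 _ := fun a => by
    rw [← HomologicalComplex.comp_f, hjq, HomologicalComplex.id_f]
  have hz : ∀ a, IsZero ((P.trunc n).X a) → IsZero (Y.X a) := fun a ha => by
    rw [IsZero.iff_id_eq_zero, ← hY a, ha.eq_of_tgt (j.f a) 0, zero_comp]
  obtain ⟨⟨a, _⟩, ⟨b, _⟩, hproj, hfin⟩ := P.isBoundedProj_trunc n
  have hb : IsBoundedProj Λ Y := by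
    refine ⟨⟨a, ?_⟩, ⟨b, ?_⟩, fun c => ?_, fun c => ?_⟩
    · rw [CochainComplex.isStrictlyGE_iff]
      exact fun c hc => hz c ((P.trunc n).isZero_of_isStrictlyGE a c hc)
    · rw [CochainComplex.isStrictlyLE_iff]
      exact fun c hc => hz c ((P.trunc n).isZero_of_isStrictlyLE b c hc)
    · have := hproj c
      exact Module.Projective.of_split (j.f c).hom (q.f c).hom
        (congrArg ModuleCat.Hom.hom (hY c))
    · have := hfin c
      refine Module.Finite.of_surjective (q.f c).hom fun x => ⟨(j.f c).hom x, ?_⟩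
      exact LinearMap.congr_fun (congrArg ModuleCat.Hom.hom (hY c)) x
  refine ⟨KbProj.mk Y hb, KbProj.homMk j, KbProj.homMk q, ?_, ⟨KbProj.homologyZeroIso _ _ ≪≫ ?_⟩⟩
  · rw [← KbProj.homMk_comp, hjq, KbProj.homMk_id]
  · have h1 : HomologicalComplex.homologyMap j 0 ≫ HomologicalComplex.homologyMap q 0 = 𝟙 _ := by
      rw [← HomologicalComplex.homologyMap_comp, hjq, HomologicalComplex.homologyMap_id]
    have h2 : HomologicalComplex.homologyMap q 0 ≫ HomologicalComplex.homologyMap j 0 =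
        e.hom ≫ r ≫ i ≫ e.inv := by
      rw [← HomologicalComplex.homologyMap_comp, hqj]
      exact hF
    refine ⟨HomologicalComplex.homologyMap j 0 ≫ e.hom ≫ r,
      i ≫ e.inv ≫ HomologicalComplex.homologyMap q 0, ?_, ?_⟩
    · have : e.hom ≫ r ≫ i ≫ e.inv ≫ HomologicalComplex.homologyMap q 0 =
          HomologicalComplex.homologyMap q 0 := by
        have := congrArg (· ≫ HomologicalComplex.homologyMap q 0) h2
        simp only [Category.assoc, h1, Category.comp_id] at this
        exact this.symm
      simp only [Category.assoc, this, h1]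
    · simp only [Category.assoc]
      rw [reassoc_of% h2]
      simp [h]

end MinProjRes

/-! ### The silting complex `Λ` -/

section AddClosure

variable {C : Type*} [Category C] [HasZeroObject C] [HasShift C ℤ] [Preadditive C]
  [∀ n : ℤ, (shiftFunctor C n).Additive] [Pretriangulated C]

/-- A split monomorphism in a triangulated category has its cone as a complement, since the
connecting map of its triangle vanishes. -/
theorem IsSplitOff.addClosure {T X : C} (h : IsSplitOff T X) : addClosure T X := by
  obtain ⟨a, i, r, e⟩ := h
  let f : X ⟶ ⨁ fun _ : Fin a => T := biproduct.lift i
  let g : (⨁ fun _ : Fin a => T) ⟶ X := biproduct.desc r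
  have hfg : f ≫ g = 𝟙 X := by simp [f, g, biproduct.lift_desc, e]
  obtain ⟨Z, p, q, hT⟩ := distinguished_cocone_triangle f
  have hq : q ≫ f⟦(1 : ℤ)⟧' = 0 := comp_distTriang_mor_zero₃₁ _ hT
  have hq' : q = 0 := by
    have h := congrArg (· ≫ g⟦(1 : ℤ)⟧') hq
    simp only [Category.assoc, ← Functor.map_comp, hfg, CategoryTheory.Functor.map_id,
      Category.comp_id, zero_comp] at h
    exact h
  obtain ⟨e, -⟩ := exists_iso_binaryBiproduct_of_distTriang _ hT hq'
  exact ⟨a, Z, ⟨e.symm⟩⟩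

end AddClosure

variable {Λ : Type u} [Ring Λ]

/-- The shift of a complex in `K^b(proj Λ)`. -/
def KbProj.shiftIso (K : CochainComplex (ModuleCat.{u} Λ) ℤ) (hK : IsBoundedProj Λ K) (n : ℤ) :
    (KbProj.mk K hK)⟦n⟧ ≅ KbProj.mk (K⟦n⟧) (hK.shift n) :=
  (kbProj Λ).fullyFaithfulι.preimageIso (((kbProj Λ).ι.commShiftIso n).app (KbProj.mk K hK) ≪≫
    (((HomotopyCategory.quotient (ModuleCat.{u} Λ) (.up ℤ)).commShiftIso n).app K).symm)

theorem KbProj.hom_shift_eq_zero {K L : CochainComplex (ModuleCat.{u} Λ) ℤ}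
    {hK : IsBoundedProj Λ K} {hL : IsBoundedProj Λ L} {n : ℤ}
    (h : ∀ f : K ⟶ L⟦n⟧, Nonempty (Homotopy f 0)) (f : KbProj.mk K hK ⟶ (KbProj.mk L hL)⟦n⟧) :
    f = 0 := by
  refine hom_eq_zero_of_iso (Iso.refl _) (KbProj.shiftIso L hL n).symm (fun f => ?_) f
  obtain ⟨g, rfl⟩ := KbProj.homMk_surjective f
  exact (KbProj.homMk_eq_zero_iff g).2 (h g)

theorem KbProj.shift_hom_eq_zero {K L : CochainComplex (ModuleCat.{u} Λ) ℤ}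
    {hK : IsBoundedProj Λ K} {hL : IsBoundedProj Λ L} {n : ℤ}
    (h : ∀ f : K⟦n⟧ ⟶ L, Nonempty (Homotopy f 0)) (f : (KbProj.mk K hK)⟦n⟧ ⟶ KbProj.mk L hL) :
    f = 0 := by
  refine hom_eq_zero_of_iso (KbProj.shiftIso K hK n).symm (Iso.refl _) (fun f => ?_) f
  obtain ⟨g, rfl⟩ := KbProj.homMk_surjective f
  exact (KbProj.homMk_eq_zero_iff g).2 (h g)

/-- The isomorphism of `K^b(proj Λ)` given by an isomorphism of complexes. -/
def KbProj.mkIso {K L : CochainComplex (ModuleCat.{u} Λ) ℤ}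
    {hK : IsBoundedProj Λ K} {hL : IsBoundedProj Λ L} (e : K ≅ L) :
    KbProj.mk K hK ≅ KbProj.mk L hL where
  hom := KbProj.homMk e.hom
  inv := KbProj.homMk e.inv
  hom_inv_id := by rw [← KbProj.homMk_comp, e.hom_inv_id, KbProj.homMk_id]
  inv_hom_id := by rw [← KbProj.homMk_comp, e.inv_hom_id, KbProj.homMk_id]

theorem IsSplitOff.kbProj {K L : CochainComplex (ModuleCat.{u} Λ) ℤ}
    {hK : IsBoundedProj Λ K} {hL : IsBoundedProj Λ L} (h : IsSplitOff K L) :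
    IsSplitOff (KbProj.mk K hK) (KbProj.mk L hL) := by
  obtain ⟨a, i, r, e⟩ := h
  refine ⟨a, fun s => KbProj.homMk (i s), fun s => KbProj.homMk (r s), ?_⟩
  simp only [← KbProj.homMk_comp]
  rw [← KbProj.homMk_id, ← e]
  let F : (L ⟶ L) →+ (KbProj.mk L hL ⟶ KbProj.mk L hL) :=
    { toFun := KbProj.homMk
      map_zero' := rfl
      map_add' := fun _ _ => rfl }
  exact (map_sum F _ _).symm

/-- A property of objects of `K^b(proj Λ)` stable under extensions passes to the middle term of a
degreewise split short exact sequence. -/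
theorem KbProj.prop_of_splitting (S : ObjectProperty (KbProj Λ)) [S.IsTriangulated]
    [S.IsClosedUnderIsomorphisms] (E : ShortComplex (CochainComplex (ModuleCat.{u} Λ) ℤ))
    (σ : ∀ i, (E.map (HomologicalComplex.eval _ _ i)).Splitting)
    (h₁ : IsBoundedProj Λ E.X₁) (h₂ : IsBoundedProj Λ E.X₂) (h₃ : IsBoundedProj Λ E.X₃)
    (hS₁ : S (KbProj.mk _ h₁)) (hS₃ : S (KbProj.mk _ h₃)) : S (KbProj.mk _ h₂) := by
  obtain ⟨Z, p, q, hT⟩ := distinguished_cocone_triangle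
    (KbProj.homMk (hK := h₁) (hL := h₂) E.f)
  have hT' := (kbProj Λ).ι.map_distinguished _ hT
  have hE : CochainComplex.trianglehOfDegreewiseSplit E σ ∈ distTriang _ :=
    (HomotopyCategory.distinguished_iff_iso_trianglehOfDegreewiseSplit _).2 ⟨E, σ, ⟨Iso.refl _⟩⟩
  let e := isoTriangleOfIso₁₂ _ _ hT' hE (Iso.refl _) (Iso.refl _)
    ((Category.comp_id _).trans (Category.id_comp _).symm)
  have e₃ : Z ≅ KbProj.mk _ h₃ := (kbProj Λ).fullyFaithfulι.preimageIso (Triangle.π₃.mapIso e)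
  exact S.ext_of_isTriangulatedClosed₂ _ hT hS₁ (S.prop_of_iso e₃.symm hS₃)

/-- The single complex functor. -/
abbrev singleAt (b : ℤ) (P : ModuleCat.{u} Λ) : CochainComplex (ModuleCat.{u} Λ) ℤ :=
  (HomologicalComplex.single _ (.up ℤ) b).obj P

theorem isBoundedProj_singleAt (b : ℤ) (P : ModuleCat.{u} Λ) [Module.Projective Λ P]
    [Module.Finite Λ P] : IsBoundedProj Λ (singleAt b P) := by
  have hz : ∀ i, i ≠ b → IsZero ((singleAt b P).X i) := fun i hi =>
    HomologicalComplex.isZero_single_obj_X _ _ _ _ hi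
  refine ⟨⟨b, ?_⟩, ⟨b, ?_⟩, fun i => ?_, fun i => ?_⟩
  · rw [CochainComplex.isStrictlyGE_iff]
    exact fun i hi => hz i (by lia)
  · rw [CochainComplex.isStrictlyLE_iff]
    exact fun i hi => hz i (by lia)
  · by_cases hi : i = b
    · subst hi
      exact Module.Projective.of_equiv
        (HomologicalComplex.singleObjXSelf (.up ℤ) i P).symm.toLinearEquiv
    · have := ModuleCat.isZero_iff_subsingleton.1 (hz i hi)
      infer_instance
  · by_cases hi : i = b
    · subst hi
      exact Module.Finite.equiv
        (HomologicalComplex.singleObjXSelf (.up ℤ) i P).symm.toLinearEquiv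
    · have := ModuleCat.isZero_iff_subsingleton.1 (hz i hi)
      infer_instance

theorem isSplitOff_self_of_projective (P : ModuleCat.{u} Λ) [Module.Projective Λ P]
    [Module.Finite Λ P] : IsSplitOff (ModuleCat.of Λ Λ) P := by
  obtain ⟨m, p, hp⟩ := Module.Finite.exists_fin' Λ P
  obtain ⟨s, hs⟩ := Module.projective_lifting_property p LinearMap.id hp
  refine ⟨m, fun a => ModuleCat.ofHom (LinearMap.proj a ∘ₗ s),
    fun a => ModuleCat.ofHom (p ∘ₗ LinearMap.single Λ (fun _ => Λ) a), ?_⟩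
  ext x
  have h : p (s x) = x := LinearMap.congr_fun hs x
  have h' : s x = ∑ a, LinearMap.single Λ (fun _ : Fin m => Λ) a (s x a) :=
    (LinearMap.sum_single_apply (fun _ => Λ) (s x)).symm
  rw [h', map_sum] at h
  rw [ModuleCat.hom_sum]
  simpa [LinearMap.sum_apply] using h

theorem isIso_mkHomFromSingle {K : CochainComplex (ModuleCat.{u} Λ) ℤ} {b : ℤ}
    (hz : ∀ i, i ≠ b → IsZero (K.X i)) (h : ∀ k, (ComplexShape.up ℤ).Rel b k → 𝟙 (K.X b) ≫ K.d b k = 0) :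
    IsIso (HomologicalComplex.mkHomFromSingle (𝟙 (K.X b)) h) := by
  have : ∀ i, IsIso ((HomologicalComplex.mkHomFromSingle (𝟙 (K.X b)) h).f i) := fun i => by
    by_cases hi : i = b
    · subst hi
      rw [HomologicalComplex.mkHomFromSingle_f]
      infer_instance
    · exact (isIso_of_source_target_iso_zero _
        (HomologicalComplex.isZero_single_obj_X _ _ _ _ hi).isoZero (hz i hi).isoZero)
  exact HomologicalComplex.Hom.isIso_of_components _

theorem singleAtIso {K : CochainComplex (ModuleCat.{u} Λ) ℤ} {b : ℤ}
    (hz : ∀ i, i ≠ b → IsZero (K.X i)) : Nonempty (singleAt b (K.X b) ≅ K) := by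
  have h : ∀ k, (ComplexShape.up ℤ).Rel b k → 𝟙 (K.X b) ≫ K.d b k = 0 := fun k hk =>
    (hz k (by rintro rfl; simp at hk)).eq_of_tgt _ _
  have := isIso_mkHomFromSingle hz h
  exact ⟨asIso (HomologicalComplex.mkHomFromSingle (𝟙 (K.X b)) h)⟩

/-- `Λ`, in degree zero, generates `K^b(proj Λ)`. -/
theorem KbProj.eq_top_of_isTriangulated (S : ObjectProperty (KbProj Λ)) [S.IsTriangulated]
    [S.IsClosedUnderIsomorphisms]
    (h0 : ∀ (P : ModuleCat.{u} Λ) [Module.Projective Λ P] [Module.Finite Λ P],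
      S (KbProj.mk _ (isBoundedProj_singleAt 0 P))) : S = ⊤ := by
  have hsingle : ∀ (b : ℤ) (P : ModuleCat.{u} Λ) [Module.Projective Λ P] [Module.Finite Λ P],
      S (KbProj.mk _ (isBoundedProj_singleAt b P)) := by
    intro b P _ _
    let e : (singleAt 0 P)⟦-b⟧ ≅ singleAt b P :=
      ((CochainComplex.singleFunctors (ModuleCat.{u} Λ)).shiftIso (-b) b 0 (by simp)).app P
    refine S.prop_of_iso (KbProj.shiftIso _ (isBoundedProj_singleAt 0 P) (-b) ≪≫ KbProj.mkIso e) ?_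
    exact S.le_shift _ _ (h0 P)
  have key : ∀ (k : ℕ) (a : ℤ) (K : CochainComplex (ModuleCat.{u} Λ) ℤ) (hK : IsBoundedProj Λ K),
      (∀ i, i < a ∨ a + k ≤ i → IsZero (K.X i)) → S (KbProj.mk K hK) := by
    intro k
    induction k with
    | zero =>
      intro a K hK hz
      have hK0 : IsZero K := by
        rw [IsZero.iff_id_eq_zero]
        ext1 i
        exact (hz i (by simp; lia)).eq_of_src _ _
      refine S.prop_of_isZero ?_
      rw [IsZero.iff_id_eq_zero, ← KbProj.homMk_id, hK0.eq_of_src (𝟙 K) 0]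
      rfl
    | succ k ih =>
      intro a K hK hz
      -- The top term of K is a subcomplex, and the quotient is K with that term removed. All
      -- quotient terms are projective, so the sequence splits degreewise and gives a distinguished
      -- triangle.
      set b : ℤ := a + k with hb
      have hd : ∀ j, (ComplexShape.up ℤ).Rel b j → 𝟙 (K.X b) ≫ K.d b j = 0 := fun j hj =>
        (hz j (by right; push_cast; simp at hj; lia)).eq_of_tgt _ _
      have hpb := hK.projective b
      have hfb := hK.finite b
      let f : singleAt b (K.X b) ⟶ K := HomologicalComplex.mkHomFromSingle (𝟙 (K.X b)) hd
      have hfb' : IsIso (f.f b) := by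
        simp only [f]
        rw [HomologicalComplex.mkHomFromSingle_f]
        infer_instance
      have hsz : ∀ i, i ≠ b → IsZero ((singleAt b (K.X b)).X i) := fun i hi =>
        HomologicalComplex.isZero_single_obj_X _ _ _ _ hi
      have hmono : Mono f := HomologicalComplex.mono_of_mono_f _ fun i => by
        by_cases hi : i = b
        · subst hi
          infer_instance
        · exact (hsz i hi).mono _
      let E : ShortComplex (CochainComplex (ModuleCat.{u} Λ) ℤ) :=
        ShortComplex.mk f (cokernel.π f) (cokernel.condition f)
      have hE : E.ShortExact :=
        { exact := ShortComplex.exact_of_g_is_cokernel _ (cokernelIsCokernel f)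
          mono_f := hmono
          epi_g := inferInstanceAs (Epi (cokernel.π f)) }
      have hEi := (HomologicalComplex.shortExact_iff_degreewise_shortExact E).1 hE
      have hiso : ∀ i, i ≠ b → IsIso (E.g.f i) := fun i hi => by
        have h1 : Epi (E.g.f i) := (hEi i).epi_g
        have h2 : Mono (E.g.f i) := (hEi i).exact.mono_g ((hsz i hi).eq_of_src _ _)
        exact isIso_of_mono_of_epi _
      have hzb : IsZero (E.X₃.X b) := by
        have h1 : Epi (E.g.f b) := (hEi b).epi_g
        have h2 : f.f b ≫ E.g.f b = 0 := (E.map (HomologicalComplex.eval _ _ b)).zero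
        have h3 : E.g.f b = 0 := by
          rw [← cancel_epi (f.f b), h2, comp_zero]
        rw [IsZero.iff_id_eq_zero, ← cancel_epi (E.g.f b), h3, zero_comp, zero_comp]
      have hz3 : ∀ i, IsZero (K.X i) → IsZero (E.X₃.X i) := fun i hi => by
        by_cases h : i = b
        · rw [h]; exact hzb
        · have := hiso i h
          exact hi.of_iso (asIso (E.g.f i)).symm
      have hE3 : IsBoundedProj Λ E.X₃ := by
        refine ⟨⟨a, ?_⟩, ⟨b, ?_⟩, fun i => ?_, fun i => ?_⟩
        · rw [CochainComplex.isStrictlyGE_iff]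
          exact fun i hi => hz3 i (hz i (by lia))
        · rw [CochainComplex.isStrictlyLE_iff]
          exact fun i hi => hz3 i (hz i (by push_cast; lia))
        · by_cases h : i = b
          · have := ModuleCat.isZero_iff_subsingleton.1 (h ▸ hzb)
            infer_instance
          · have := hiso i h
            have := hK.projective i
            exact Module.Projective.of_equiv (asIso (E.g.f i)).toLinearEquiv
        · by_cases h : i = b
          · have := ModuleCat.isZero_iff_subsingleton.1 (h ▸ hzb)
            infer_instance
          · have := hiso i h
            have := hK.finite i
            exact Module.Finite.equiv (asIso (E.g.f i)).toLinearEquiv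
      have σ : ∀ i, (E.map (HomologicalComplex.eval _ _ i)).Splitting := fun i => by
        have : Module.Projective Λ (E.X₃.X i) := hE3.projective i
        have : Projective (E.map (HomologicalComplex.eval _ _ i)).X₃ :=
          (IsProjective.iff_projective _).1 this
        exact (hEi i).splittingOfProjective
      refine KbProj.prop_of_splitting S E σ (isBoundedProj_singleAt b (K.X b)) hK hE3
        (hsingle b _) (ih a _ hE3 fun i hi => ?_)
      by_cases h : i = b
      · rw [h]; exact hzb
      · exact hz3 i (hz i (by push_cast; lia))
  ext X
  refine ⟨fun _ => trivial, fun _ => ?_⟩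
  have hX : IsBoundedProj Λ X.obj.as := (kbProj_quotient_obj_iff _).1 X.property
  obtain ⟨⟨a, _⟩, ⟨b, _⟩, -, -⟩ := id hX
  refine key (b + 1 - a).toNat a X.obj.as hX fun i hi => ?_
  obtain hi | hi := hi
  · exact CochainComplex.isZero_of_isStrictlyGE X.obj.as a i hi
  · exact CochainComplex.isZero_of_isStrictlyLE X.obj.as b i (by lia)

theorem isSuperfluous_of_eq_bot {P : Type*} [AddCommGroup P] [Module Λ P] {K : Submodule Λ P}
    (h : K = ⊥) : IsSuperfluous K := fun N hN => by
  rwa [h, sup_bot_eq] at hN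

variable (Λ) in
/-- The trivial minimal projective resolution of `Λ`. -/
def MinProjRes.self : MinProjRes (ModuleCat.of Λ Λ) :=
  have : Projective (ModuleCat.of Λ Λ) :=
    (IsProjective.iff_projective (ModuleCat.of Λ Λ)).1 (inferInstanceAs (Module.Projective Λ Λ))
  have hz : ∀ i : ℕ, Subsingleton ((ProjectiveResolution.self (ModuleCat.of Λ Λ)).complex.X (i + 1)) :=
    fun i => ModuleCat.isZero_iff_subsingleton.1
      (HomologicalComplex.isZero_single_obj_X _ _ _ _ (by simp))
  { ProjectiveResolution.self (ModuleCat.of Λ Λ) with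
    finite := fun i => by
      cases i with
      | zero => exact inferInstanceAs (Module.Finite Λ Λ)
      | succ i =>
        have := hz i
        infer_instance
    superfluous_zero := isSuperfluous_of_eq_bot (by
      rw [LinearMap.ker_eq_bot]
      exact fun x y h => h)
    superfluous_succ := fun i => isSuperfluous_of_eq_bot (by
      have := hz i
      exact Subsingleton.elim _ _) }

theorem MinProjRes.isZero_self_complex_X (i : ℕ) (hi : i ≠ 0) :
    IsZero ((MinProjRes.self Λ).complex.X i) :=
  HomologicalComplex.isZero_single_obj_X _ _ _ _ hi

theorem MinProjRes.isZero_self_trunc_X (n : ℕ) (i : ℤ) (hi : i ≠ 0) :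
    IsZero (((MinProjRes.self Λ).trunc n).X i) := by
  by_cases h1 : i < -n
  · exact (MinProjRes.self Λ).isZero_trunc_of_lt n i h1
  by_cases h2 : 0 < i
  · exact (MinProjRes.self Λ).isZero_trunc_of_gt n i h2
  · obtain ⟨k, hk⟩ := Int.exists_eq_neg_ofNat (not_lt.1 h2)
    exact (MinProjRes.isZero_self_complex_X k (by lia)).of_iso
      ((MinProjRes.self Λ).truncXIso n i k hk (by lia))

theorem isTauTilting_self (n : ℕ) : IsTauTilting n (ModuleCat.of Λ Λ) := by
  refine ⟨MinProjRes.self Λ, ?_, ?_⟩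
  · intro i hi
    refine KbProj.hom_shift_eq_zero fun f => ?_
    have : f = 0 := by
      ext1 j
      by_cases hj : j = 0
      · exact (MinProjRes.isZero_self_trunc_X n (j + i) (by lia)).eq_of_tgt _ _
      · exact (MinProjRes.isZero_self_trunc_X n j hj).eq_of_src _ _
    exact ⟨Homotopy.ofEq this⟩
  · intro S _ _ hS
    refine KbProj.eq_top_of_isTriangulated S fun P _ _ => hS _ (IsSplitOff.addClosure ?_)
    obtain ⟨e⟩ := singleAtIso (MinProjRes.isZero_self_trunc_X (Λ := Λ) n)
    have e' : ((MinProjRes.self Λ).trunc n).X 0 ≅ ModuleCat.of Λ Λ :=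
      (MinProjRes.self Λ).truncXIso n 0 0 rfl (by lia)
    have h := (isSplitOff_self_of_projective P).map
      (HomologicalComplex.single (ModuleCat.{u} Λ) (.up ℤ) 0)
    obtain ⟨a, i, r, h⟩ := h
    let e'' := (HomologicalComplex.single (ModuleCat.{u} Λ) (.up ℤ) 0).mapIso e'.symm ≪≫ e
    refine IsSplitOff.kbProj ⟨a, fun s => i s ≫ e''.hom, fun s => e''.inv ≫ r s, ?_⟩
    simpa using h

/-! ### The rank of a `τ_n`-tilting module -/

lemma IsSplitOff.biprod {C : Type*} [Category C] [Preadditive C] [HasBinaryBiproducts C]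
    {T X Y : C} (hX : IsSplitOff T X) (hY : IsSplitOff T Y) : IsSplitOff T (X ⊞ Y) := by
  obtain ⟨a, i, r, h⟩ := hX
  obtain ⟨b, j, q, h'⟩ := hY
  refine ⟨a + b, Fin.append (fun s => biprod.fst ≫ i s) (fun t => biprod.snd ≫ j t),
    Fin.append (fun s => r s ≫ biprod.inl) (fun t => q t ≫ biprod.inr), ?_⟩
  rw [Fin.sum_univ_add]
  simp only [Fin.append_left, Fin.append_right, Category.assoc]
  simp only [← Preadditive.comp_sum]
  have h1 : ∀ s, i s ≫ r s ≫ (biprod.inl : X ⟶ X ⊞ Y) = (i s ≫ r s) ≫ biprod.inl := fun s =>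
    (Category.assoc _ _ _).symm
  have h2 : ∀ s, j s ≫ q s ≫ (biprod.inr : Y ⟶ X ⊞ Y) = (j s ≫ q s) ≫ biprod.inr := fun s =>
    (Category.assoc _ _ _).symm
  simp only [h1, h2, ← Preadditive.sum_comp, h, h', Category.id_comp]
  exact biprod.total

lemma Indecomposable.of_iso {C : Type*} [Category C] [Preadditive C] [HasBinaryBiproducts C]
    {X Y : C} (e : X ≅ Y) (hX : Indecomposable X) : Indecomposable Y :=
  ⟨fun h => hX.1 (h.of_iso e), fun A B f => hX.2 A B (e ≪≫ f)⟩

section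

variable {Λ : Type u} [Ring Λ]

theorem MinProjRes.moduleFinite {M : ModuleCat.{u} Λ} (P : MinProjRes M) : Module.Finite Λ M := by
  have := P.finite 0
  exact Module.Finite.of_surjective P.π₀.hom ((ModuleCat.epi_iff_surjective _).1 inferInstance)

/-- H⁰ reflects isomorphisms on these objects, so it induces a local homomorphism of endomorphism
rings. -/
theorem isLocalRing_end_of_homologyZero [IsSemiprimaryRing Λ] {M : ModuleCat.{u} Λ}
    (P : MinProjRes M) {n : ℕ} (hn : 1 ≤ n) {X : KbProj Λ} (hX : IsSplitOff (P.truncObj n) X)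
    [IsLocalRing (End (KbProj.homologyZero.obj X))] : IsLocalRing (End X) := by
  let F : End X →+* End (KbProj.homologyZero.obj X) :=
    { toFun := fun f => KbProj.homologyZero.map f
      map_one' := CategoryTheory.Functor.map_id _ _
      map_mul' := fun f g => Functor.map_comp _ _ _
      map_zero' := Functor.map_zero _ _ _
      map_add' := fun f g => Functor.map_add _ }
  have : IsLocalHom F := ⟨fun f hf => by
    have : IsIso (KbProj.homologyZero.map f) := (isUnit_iff_isIso _).1 hf
    exact (isUnit_iff_isIso f).2 (P.isIso_of_isIso_homologyZero_map n hn hX hX f)⟩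
  exact RingHom.domain_isLocalRing F

variable {R : Type v} [CommRing R] [IsArtinianRing R] [Algebra R Λ] [Module.Finite R Λ]

open scoped ModuleCat.Algebra in
include R in
/-- The number of pairwise non-isomorphic indecomposable summands of a `τ_n`-tilting module is at
most the number of those of any other one. -/
theorem card_le_of_isTauTilting {n : ℕ} (hn : 1 ≤ n) {M M' : ModuleCat.{u} Λ} (P : MinProjRes M)
    (hP : IsSilting (P.truncObj n)) (P' : MinProjRes M') (hP' : IsSilting (P'.truncObj n))
    {ι ι' : Type*} [Fintype ι] [Fintype ι'] (N : ι → ModuleCat.{u} Λ)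
    (hN : ∀ s, Indecomposable (N s)) (i : ∀ s, N s ⟶ M) (r : ∀ s, M ⟶ N s)
    (hir : ∀ s, i s ≫ r s = 𝟙 (N s)) (hne : ∀ s t, Nonempty (N s ≅ N t) → s = t)
    (N' : ι' → ModuleCat.{u} Λ) (i' : ∀ s, N' s ⟶ M') (r' : ∀ s, M' ⟶ N' s)
    (hir' : ∀ s, i' s ≫ r' s = 𝟙 (N' s))
    (hN' : ∀ L : ModuleCat.{u} Λ, Indecomposable L → (∃ (j : L ⟶ M') (q : M' ⟶ L), j ≫ q = 𝟙 L) →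
      ∃ s, Nonempty (L ≅ N' s)) : Fintype.card ι ≤ Fintype.card ι' := by
  have : IsArtinianRing Λ := IsArtinianRing.of_finite R Λ
  have := P.moduleFinite
  have := P'.moduleFinite
  choose X j q hjq e using fun s => P.exists_retract_of_retract n hn (i s) (r s) (hir s)
  choose X' j' q' hjq' e' using fun s => P'.exists_retract_of_retract n hn (i' s) (r' s) (hir' s)
  have hX : ∀ s, IsSplitOff (P.truncObj n) (X s) := fun s =>
    (IsSplitOff.self _).of_retract _ _ (hjq s)
  have hX' : ∀ s, IsSplitOff (P'.truncObj n) (X' s) := fun s =>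
    (IsSplitOff.self _).of_retract _ _ (hjq' s)
  have hfl : ∀ s, Module.Finite Λ (N s) := fun s =>
    Module.Finite.of_surjective (r s).hom fun x => ⟨(i s).hom x,
      LinearMap.congr_fun (congrArg ModuleCat.Hom.hom (hir s)) x⟩
  have hfl' : ∀ s, Module.Finite Λ (KbProj.homologyZero.obj (X s)) := fun s =>
    Module.Finite.equiv (e s).some.symm.toLinearEquiv
  have hind : ∀ s, Indecomposable (KbProj.homologyZero.obj (X s)) := fun s =>
    Indecomposable.of_iso (e s).some.symm (hN s)
  have hloc : ∀ s, IsLocalRing (End (X s)) := fun s => by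
    have := Indecomposable.isLocalRing_end (hind s)
    exact isLocalRing_end_of_homologyZero P hn (hX s)
  refine IsSilting.card_le (R := R) (KbProj.moduleFinite_hom R) hP X j q hjq ?_ X' ?_
  · intro s t hst f g hfg
    refine hst (hne s t ⟨(e s).some.symm ≪≫ ?_ ≪≫ (e t).some⟩)
    -- If g ≫ f is invertible, H⁰(g) is a split monomorphism between indecomposables, hence an
    -- isomorphism, which contradicts `hne`.
    have : IsIso (KbProj.homologyZero.map g) := by
      refine Indecomposable.isIso_of_retract (hind s) (hind t).1 _
        (KbProj.homologyZero.map (f ≫ inv (g ≫ f))) ?_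
      rw [← Functor.map_comp, ← Category.assoc, IsIso.hom_inv_id, CategoryTheory.Functor.map_id]
    exact (asIso (KbProj.homologyZero.map g)).symm
  · intro S _ _ hS
    refine hP'.generates S inferInstance inferInstance fun Y hY => ?_
    have hY' := hY.isSplitOff
    obtain ⟨ε⟩ := P'.nonempty_homologyZero_iso n hn
    have hsplit : IsSplitOff M' (KbProj.homologyZero.obj Y) := by
      obtain ⟨a, k, l, h⟩ := hY'.map KbProj.homologyZero
      exact ⟨a, fun s => k s ≫ ε.hom, fun s => ε.inv ≫ l s, by simpa using h⟩
    have hfY : Module.Finite Λ (KbProj.homologyZero.obj Y) := by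
      obtain ⟨a, k, l, h⟩ := hsplit
      let F : (Fin a → M') →ₗ[Λ] KbProj.homologyZero.obj Y :=
        ∑ s, (l s).hom ∘ₗ LinearMap.proj s
      refine Module.Finite.of_surjective F fun x => ⟨fun s => (k s).hom x, ?_⟩
      have := LinearMap.congr_fun (congrArg ModuleCat.Hom.hom h) x
      rw [ModuleCat.hom_sum] at this
      simpa [F, LinearMap.sum_apply] using this
    -- Decompose H⁰(Y) into indecomposables and reassemble the lifts X' s into an object Z of S with
    -- H⁰(Z) ≅ H⁰(Y); then Z ≅ Y.
    have key := induction_indecomposable (p := fun L => IsSplitOff M' L →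
      ∃ Z, IsSplitOff (P'.truncObj n) Z ∧ S Z ∧ Nonempty (KbProj.homologyZero.obj Z ≅ L))
      (fun L hL _ => ?_) (fun L _ _ hL hLM => ?_) (fun L L₁ L₂ f h₁ h₂ h => ?_)
      (KbProj.homologyZero.obj Y) hsplit
    · obtain ⟨Z, hZ, hSZ, ⟨f⟩⟩ := key
      obtain ⟨f'⟩ := P'.nonempty_iso_of_homologyZero_iso n hn hZ hY' f
      exact S.prop_of_iso f' hSZ
    · exact ⟨0, ⟨0, fun _ => 0, fun _ => 0, (isZero_zero _).eq_of_src _ _⟩,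
        S.prop_of_isZero (isZero_zero _),
        ⟨((KbProj.homologyZero (Λ := Λ)).map_isZero (isZero_zero _)).iso hL⟩⟩
    · obtain ⟨s, ⟨f⟩⟩ := hN' L hL (Indecomposable.exists_retract hL hLM)
      exact ⟨X' s, hX' s, hS s, ⟨(e' s).some ≪≫ f.symm⟩⟩
    · obtain ⟨Z₁, hZ₁, hS₁, ⟨f₁⟩⟩ := h₁ (h.of_retract (biprod.inl ≫ f.inv) (f.hom ≫ biprod.fst)
        (by simp))
      obtain ⟨Z₂, hZ₂, hS₂, ⟨f₂⟩⟩ := h₂ (h.of_retract (biprod.inr ≫ f.inv) (f.hom ≫ biprod.snd)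
        (by simp))
      have := preservesBinaryBiproduct_of_preservesBiproduct KbProj.homologyZero Z₁ Z₂
      refine ⟨Z₁ ⊞ Z₂, hZ₁.biprod hZ₂, ?_, ⟨KbProj.homologyZero.mapBiprod Z₁ Z₂ ≪≫
        biprod.mapIso f₁ f₂ ≪≫ f.symm⟩⟩
      exact S.ext_of_isTriangulatedClosed₂ _ (binaryBiproductTriangle_distinguished Z₁ Z₂) hS₁ hS₂

include R in
theorem rk_le_of_isTauTilting {n : ℕ} (hn : 1 ≤ n) {M M' : ModuleCat.{u} Λ}
    (hM : IsTauTilting n M) (hM' : IsTauTilting n M') : rk M ≤ rk M' := by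
  obtain ⟨P, hP⟩ := hM
  obtain ⟨P', hP'⟩ := hM'
  by_contra! hlt
  unfold rk at hlt
  set A := {c : Quotient (isIsomorphicSetoid (ModuleCat.{u} Λ)) |
    ∃ N N' : ModuleCat.{u} Λ, c = Quotient.mk _ N ∧ Indecomposable N ∧ Nonempty (N ⊞ N' ≅ M)}
  set A' := {c : Quotient (isIsomorphicSetoid (ModuleCat.{u} Λ)) |
    ∃ N N' : ModuleCat.{u} Λ, c = Quotient.mk _ N ∧ Indecomposable N ∧ Nonempty (N ⊞ N' ≅ M')}
  have hfin' : A'.Finite := Set.encard_lt_top_iff.1 (hlt.trans_le le_top)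
  -- A finite subset with exactly one element more than A' suffices, so finiteness of A need not be
  -- known.
  obtain ⟨B, hBA, hB⟩ := Set.exists_subset_encard_eq (Order.add_one_le_of_lt hlt)
  have hfin : B.Finite := Set.encard_lt_top_iff.1 (by
    rw [hB]
    exact (WithTop.add_lt_top.2 ⟨Set.encard_lt_top_iff.2 hfin', ENat.natCast_lt_top 1⟩))
  have := hfin.fintype
  have := hfin'.fintype
  choose N L hc hN e using fun c : B => hBA c.2
  choose N' L' hc' hN' e' using fun c : A' => c.2
  have hcard := card_le_of_isTauTilting (R := R) hn P hP P' hP' N hN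
    (fun c => biprod.inl ≫ (e c).some.hom) (fun c => (e c).some.inv ≫ biprod.fst) (fun c => by simp)
    (fun c d h => Subtype.ext ((hc c).trans ((Quotient.sound h).trans (hc d).symm))) N'
    (fun c => biprod.inl ≫ (e' c).some.hom) (fun c => (e' c).some.inv ≫ biprod.fst)
    (fun c => by simp) (fun K hK ⟨j, q, hjq⟩ => by
      obtain ⟨K', hK'⟩ := exists_biprod_iso_of_retract j q hjq
      let c : A' := ⟨Quotient.mk _ K, K, K', rfl, hK, hK'⟩
      exact ⟨c, Quotient.exact (hc' c)⟩)
  rw [← Set.toFinset_card, ← Set.toFinset_card] at hcard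
  rw [Set.encard_eq_coe_toFinset_card, Set.encard_eq_coe_toFinset_card] at hB
  have : B.toFinset.card = A'.toFinset.card + 1 := by exact_mod_cast hB
  lia

include R in
theorem rk_eq_of_isTauTilting {n : ℕ} (hn : 1 ≤ n) {M : ModuleCat.{u} Λ}
    (hM : IsTauTilting n M) : rk M = rk (ModuleCat.of Λ Λ) :=
  le_antisymm (rk_le_of_isTauTilting (R := R) hn hM (isTauTilting_self n))
    (rk_le_of_isTauTilting (R := R) hn (isTauTilting_self n) hM)

end

/-! ### Sincerity of `τ_n`-tilting modules -/

section Sincerity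

variable {Λ : Type u} [Ring Λ]

theorem nonempty_homotopy_of_single {P : ModuleCat.{u} Λ} {b : ℤ}
    {L : CochainComplex (ModuleCat.{u} Λ) ℤ} (f : singleAt b P ⟶ L)
    (s : (singleAt b P).X b ⟶ L.X (b - 1)) (h : s ≫ L.d (b - 1) b = f.f b) :
    Nonempty (Homotopy f 0) := by
  let σ : ∀ i j, (ComplexShape.up ℤ).Rel j i → ((singleAt b P).X i ⟶ L.X j) := fun i j hij =>
    if hi : i = b then ((singleAt b P).XIsoOfEq hi).hom ≫ s ≫
      (L.XIsoOfEq (show b - 1 = j by simp at hij; lia)).hom else 0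
  have hf : f = Homotopy.nullHomotopicMap' σ := by
    refine HomologicalComplex.from_single_hom_ext ?_
    rw [Homotopy.nullHomotopicMap'_f (k₂ := b - 1) (k₁ := b) (k₀ := b + 1) (by simp) (by simp)]
    simp [σ, h]
  rw [hf]
  exact ⟨Homotopy.nullHomotopy' σ⟩

/-- Only the sign of the differential differs, and it matters neither for kernels nor for images. -/
theorem shift_d_apply (K : CochainComplex (ModuleCat.{u} Λ) ℤ) (n i j : ℤ) :
    (∀ x : K.X (i + n), (K⟦n⟧.d i j).hom x = (K.d (i + n) (j + n)).hom x) ∨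
    (∀ x : K.X (i + n), (K⟦n⟧.d i j).hom x = (-(K.d (i + n) (j + n)).hom x : K.X (j + n))) := by
  have e : (K⟦n⟧.d i j : K.X (i + n) ⟶ K.X (j + n)) = n.negOnePow • K.d (i + n) (j + n) :=
    CochainComplex.shiftFunctor_obj_d' K n i j
  obtain h | h := Int.units_eq_one_or n.negOnePow
  · rw [h, one_smul] at e
    exact .inl fun x => LinearMap.congr_fun (congrArg ModuleCat.Hom.hom e) x
  · rw [h, Units.neg_smul, one_smul] at e
    exact .inr fun x => LinearMap.congr_fun (congrArg ModuleCat.Hom.hom e) x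

theorem shift_exists_of_exists (K : CochainComplex (ModuleCat.{u} Λ) ℤ) (n i j : ℤ)
    (x : K.X (j + n)) (h : ∃ y, (K.d (i + n) (j + n)).hom y = x) :
    ∃ y, (K⟦n⟧.d i j).hom y = x := by
  obtain ⟨y, rfl⟩ := h
  obtain h | h := shift_d_apply K n i j
  · exact ⟨y, h y⟩
  · exact ⟨(-y : K.X (i + n)), (h (-y)).trans (by rw [map_neg, neg_neg])⟩

theorem d_apply_eq_zero_of_shift (K : CochainComplex (ModuleCat.{u} Λ) ℤ) (n i j : ℤ)
    (x : K.X (i + n)) (hx : (K⟦n⟧.d i j).hom x = 0) : (K.d (i + n) (j + n)).hom x = 0 := by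
  obtain h | h := shift_d_apply K n i j
  · exact (h x).symm.trans hx
  · exact neg_eq_zero.1 ((h x).symm.trans hx)

/-- The composite of f with the augmentation onto H⁰ ≅ M vanishes, so f takes values in the
boundaries. -/
theorem MinProjRes.exists_of_homologyZero_hom_eq_zero {M : ModuleCat.{u} Λ} (P : MinProjRes M)
    {n : ℕ} (hn : 1 ≤ n) {Q : ModuleCat.{u} Λ} (hQ : ∀ f : Q ⟶ M, f = 0)
    (f : Q ⟶ (P.trunc n).X 0) (x : Q) :
    ∃ y, ((P.trunc n).d (-1) 0).hom y = f.hom x := by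
  obtain ⟨e, -⟩ := P.exists_homologyIso n hn
  have h : f ≫ augmentation _ (P.trunc_d_zero_one n) = 0 := by
    rw [← cancel_mono e.hom, zero_comp]
    exact hQ _
  exact (ShortComplex.moduleCat_exact_iff _).1 (exact_augmentation _ (P.trunc_d_zero_one n)) _
    (LinearMap.congr_fun (congrArg ModuleCat.Hom.hom h) x)

variable {R : Type v} [CommRing R] [IsArtinianRing R] [Algebra R Λ] [Module.Finite R Λ]

open scoped ModuleCat.Algebra in
include R in
theorem isSincere_of_isTauTilting {n : ℕ} (hn : 1 ≤ n) {M : ModuleCat.{u} Λ}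
    (hM : IsTauTilting n M) : IsSincere M := by
  have : IsArtinianRing Λ := IsArtinianRing.of_finite R Λ
  obtain ⟨P, hP⟩ := hM
  have := P.moduleFinite
  intro S _
  by_contra hS
  obtain ⟨Q, p, _, _, hp, hs⟩ := exists_projective_cover S
  have hQ : ∀ f : Q ⟶ M, f = 0 := fun f => by
    ext1
    exact eq_zero_of_not_isCompositionFactor hp hs hS f.hom
  have hK := P.isTruncatedResolution n hn
  have hz : ∀ i, i ≠ -(n : ℤ) → IsZero ((singleAt (-(n : ℤ)) Q).X i) := fun i hi =>
    HomologicalComplex.isZero_single_obj_X _ _ _ _ hi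
  have e : (singleAt (-(n : ℤ)) Q).X (-n) ≅ Q := HomologicalComplex.singleObjXSelf _ _ _
  have hproj : Module.Projective Λ ((singleAt (-(n : ℤ)) Q).X (-n)) :=
    Module.Projective.of_equiv e.symm.toLinearEquiv
  have hQ' : ∀ f : (singleAt (-(n : ℤ)) Q).X (-n) ⟶ M, f = 0 := fun f => by
    rw [← cancel_epi e.inv, comp_zero]
    exact hQ _
  let X : KbProj Λ := KbProj.mk _ (isBoundedProj_singleAt (-(n : ℤ)) Q)
  -- Morphisms from T⟦i⟧ with i < 0 vanish because T⟦i⟧ is zero in degree -n. In the other direction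
  -- a map Q[n] ⟶ T⟦i⟧ picks cycles of T in degree i - n: they bound by exactness for 0 < i < n, by
  -- Hom(Q, M) = 0 for i = n, and trivially for i > n.
  have hX : IsSplitOff (P.truncObj n) X := by
    refine IsSilting.isSplitOff R (KbProj.moduleFinite_hom R) hP (fun i hi => ?_) fun i hi => ?_
    · refine KbProj.shift_hom_eq_zero fun f => ⟨Homotopy.ofEq ?_⟩
      ext1
      exact (P.isZero_trunc_of_lt n (-n + i) (by lia)).eq_of_src _ _
    · refine KbProj.hom_shift_eq_zero fun f => ?_
      suffices h : ∀ x, ∃ y, (((P.trunc n)⟦i⟧).d (-n - 1) (-n)).hom y = (f.f (-n)).hom x by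
        obtain ⟨s, hs⟩ := exists_lift_of_projective _ _ h
        exact nonempty_homotopy_of_single f s hs
      intro x
      refine shift_exists_of_exists _ _ _ _ _ ?_
      by_cases h1 : (n : ℤ) < i
      · have := ModuleCat.isZero_iff_subsingleton.1 (P.isZero_trunc_of_gt n (-n + i) (by lia))
        exact ⟨0, Subsingleton.elim _ _⟩
      by_cases h2 : i = n
      · have key : ∀ j k : ℤ, j = 0 → k = -1 → ∀ f : (singleAt (-(n : ℤ)) Q).X (-n) ⟶ (P.trunc n).X j,
            ∀ x, ∃ y, ((P.trunc n).d k j).hom y = f.hom x := by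
          rintro _ _ rfl rfl f x
          exact P.exists_of_homologyZero_hom_eq_zero hn hQ' f x
        exact key (-n + i) (-n - 1 + i) (by lia) (by lia) (f.f (-n)) x
      · refine hK.exact (-n + i) (-n - 1 + i) (-n + 1 + i) (by lia) (by lia) (by lia) (by lia) _ ?_
        refine d_apply_eq_zero_of_shift _ _ _ _ _ ?_
        have := f.comm (-n) (-n + 1)
        rw [(hz (-n + 1) (by lia)).eq_of_tgt ((singleAt (-(n : ℤ)) Q).d (-n) (-n + 1)) 0,
          zero_comp] at this
        exact LinearMap.congr_fun (congrArg ModuleCat.Hom.hom this) x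
  -- X sits in degree -n ≠ 0, so H⁰ does not see it; as a summand of copies of T it must then be
  -- zero.
  have hX0 : IsZero (KbProj.homologyZero.obj X) := by
    refine IsZero.of_iso ?_ (KbProj.homologyZeroIso _ _)
    refine ShortComplex.isZero_homology_of_isZero_X₂ _ (hz 0 (by lia))
  have hX1 := P.isZero_of_isZero_homologyZero n hn hX hX0
  have hid : KbProj.homMk (hK := isBoundedProj_singleAt (-(n : ℤ)) Q)
    (hL := isBoundedProj_singleAt (-(n : ℤ)) Q) (𝟙 _) = 0 := by
    rw [KbProj.homMk_id]
    exact (IsZero.iff_id_eq_zero X).1 hX1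
  obtain ⟨h⟩ := (KbProj.homMk_eq_zero_iff _).1 hid
  have hQ0 : 𝟙 ((singleAt (-(n : ℤ)) Q).X (-n)) = 0 := by
    have := h.comm (-n)
    rw [dNext_eq _ (show (ComplexShape.up ℤ).Rel (-n : ℤ) (-n + 1) by simp),
      prevD_eq _ (show (ComplexShape.up ℤ).Rel (-n - 1 : ℤ) (-n) by simp)] at this
    simpa using this
  have hQz : IsZero Q := ((IsZero.iff_id_eq_zero _).2 hQ0).of_iso e.symm
  have := ModuleCat.isZero_iff_subsingleton.1 hQz
  have := IsSimpleModule.nontrivial Λ S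
  obtain ⟨x, hx⟩ := exists_ne (0 : S)
  obtain ⟨y, rfl⟩ := hp x
  exact hx (by rw [Subsingleton.elim y 0, map_zero])

end Sincerity

/-! ### Morphisms to the Auslander-Reiten translation -/

section Duality

variable {R : Type v} [CommRing R] {J : Type v} [AddCommGroup J] [Module R J]

theorem isSemisimpleModule_quotient_jacobson [IsSemiprimaryRing R] :
    IsSemisimpleModule R (R ⧸ Ring.jacobson R) := by
  have h : Module.IsTorsionBySet R (R ⧸ Ring.jacobson R) (Ring.jacobson R) :=
    (Module.isTorsionBySet_quotient_iff _ _).2 fun m i hi =>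
      Ideal.mul_mem_right _ _ hi
  let _ := h.module
  exact (h.semilinearMap.isSemisimpleModule_iff_of_bijective Function.bijective_id).2
    inferInstance

/-- The injective envelope of `R / rad R` is a cogenerator. -/
theorem IsInjectiveEnvelope.exists_apply_ne_zero [IsArtinianRing R]
    {ι : (R ⧸ Ring.jacobson R) →ₗ[R] J} (hι : IsInjectiveEnvelope R ι) {V : Type*}
    [AddCommGroup V] [Module R V] {v : V} (hv : v ≠ 0) : ∃ ξ : V →ₗ[R] J, ξ v ≠ 0 := by
  let t := LinearMap.toSpanSingleton R V v
  have ht : LinearMap.ker t ≠ ⊤ := fun h => hv (by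
    have : (1 : R) ∈ LinearMap.ker t := h ▸ Submodule.mem_top
    simpa [t] using this)
  -- The cyclic module Rv maps onto a simple module R / m, which embeds into the semisimple module R
  -- / rad R and hence into J; injectivity extends this map from Rv to V.
  obtain ⟨m, hm, hle⟩ := Ideal.exists_le_maximal _ ht
  have hjac : Ring.jacobson R ≤ m := Ring.jacobson_le_of_isMaximal m
  have := isSemisimpleModule_quotient_jacobson (R := R)
  obtain ⟨s, hs⟩ := IsSemisimpleModule.lifting_property
    (Submodule.factor hjac) (Submodule.factor_surjective hjac) LinearMap.id
  let θ : R →ₗ[R] J := ι ∘ₗ s ∘ₗ Submodule.mkQ m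
  have hθ : LinearMap.ker t ≤ LinearMap.ker θ := fun x hx => by
    have : Submodule.mkQ m x = 0 := (Submodule.Quotient.mk_eq_zero m).2 (hle hx)
    change ι (s (Submodule.mkQ m x)) = 0
    rw [this, map_zero, map_zero]
  have hθ1 : θ 1 ≠ 0 := fun h => by
    have h1 : s (Submodule.mkQ m 1) = 0 := hι.mono (h.trans (map_zero ι).symm)
    have h2 := LinearMap.congr_fun hs (Submodule.mkQ m 1)
    rw [LinearMap.comp_apply, h1, map_zero] at h2
    exact hm.ne_top ((Ideal.eq_top_iff_one m).2 ((Submodule.Quotient.mk_eq_zero m).1 h2.symm))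
  obtain ⟨ξ, hξ⟩ := (Module.Baer.of_injective hι.injective).extension_property
    ((LinearMap.ker t).liftQ t le_rfl)
    (LinearMap.ker_eq_bot.1 (Submodule.ker_liftQ_eq_bot _ _ _ le_rfl))
    ((LinearMap.ker t).liftQ θ hθ)
  refine ⟨ξ, fun h => hθ1 ?_⟩
  have := LinearMap.congr_fun hξ ((LinearMap.ker t).mkQ 1)
  simp only [LinearMap.comp_apply, Submodule.mkQ_apply, Submodule.liftQ_apply] at this
  rw [← this]
  simpa [t] using h

theorem IsInjectiveEnvelope.exists_apply_ne_zero_of_notMem [IsArtinianRing R]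
    {ι : (R ⧸ Ring.jacobson R) →ₗ[R] J} (hι : IsInjectiveEnvelope R ι) {V : Type*}
    [AddCommGroup V] [Module R V] {v : V} {W : Submodule R V} (hv : v ∉ W) :
    ∃ ξ : V →ₗ[R] J, (∀ w ∈ W, ξ w = 0) ∧ ξ v ≠ 0 := by
  obtain ⟨ξ, hξ⟩ := hι.exists_apply_ne_zero (v := W.mkQ v)
    (fun h => hv ((Submodule.Quotient.mk_eq_zero W).1 h))
  refine ⟨ξ ∘ₗ W.mkQ, fun w hw => ?_, hξ⟩
  rw [LinearMap.comp_apply, show W.mkQ w = 0 from (Submodule.Quotient.mk_eq_zero W).2 hw, map_zero]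

variable {Λ : Type u} [Ring Λ] [Algebra R Λ]

/-- If `Hom(M, Ker ν(d)) = 0`, then every morphism from the source of `d` to `M` factors
through `d`. -/
theorem exists_comp_eq_of_forall_eq_zero [IsArtinianRing R]
    {ι : (R ⧸ Ring.jacobson R) →ₗ[R] J} (hι : IsInjectiveEnvelope R ι) {P Q M : Type*}
    [AddCommGroup P] [Module Λ P] [AddCommGroup Q] [Module Λ Q] [AddCommGroup M] [Module Λ M]
    [Module.Projective Λ P] [Module.Finite Λ P] (d : P →ₗ[Λ] Q)
    (h : ∀ f : M →ₗ[Λ] LinearMap.ker (nakayamaMap R J d), f = 0) (g : P →ₗ[Λ] M) :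
    ∃ g' : Q →ₗ[Λ] M, g' ∘ₗ d = g := by
  let _ : Module R M := Module.compHom M (algebraMap R Λ)
  have : IsScalarTower R Λ M := IsScalarTower.of_algebraMap_smul fun _ _ => rfl
  have hsc : ∀ (r : R) (a : Λ) (x : M), (r • a) • x = r • (a • x) := fun r a x => smul_assoc r a x
  let W : Submodule R (P →ₗ[Λ] M) :=
    { carrier := {f | ∃ g' : Q →ₗ[Λ] M, g' ∘ₗ d = f}
      add_mem' := by
        rintro _ _ ⟨a, rfl⟩ ⟨b, rfl⟩
        exact ⟨a + b, LinearMap.add_comp _ _ _⟩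
      zero_mem' := ⟨0, LinearMap.zero_comp _⟩
      smul_mem' := by
        rintro r _ ⟨a, rfl⟩
        exact ⟨r • a, LinearMap.smul_comp _ _ _⟩ }
  by_contra hg
  obtain ⟨ξ, hξ, hξg⟩ := hι.exists_apply_ne_zero_of_notMem (W := W) (v := g) hg
  -- The morphism M ⟶ ν(P) corresponding to the functional ξ on Hom(P, M). It lands in Ker ν(d)
  -- because ξ kills the morphisms factoring through d.
  let φ : M →ₗ[Λ] Nakayama R (Λ := Λ) J P :=
    { toFun := fun x =>
        { toFun := fun k => ξ (LinearMap.toSpanSingleton Λ M x ∘ₗ k)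
          map_add' := fun k k' => by rw [LinearMap.comp_add, map_add]
          map_smul' := fun r k => by
            rw [RingHom.id_apply, ← map_smul]
            congr 1
            ext p
            exact hsc r (k p) x }
      map_add' := fun x y => DFunLike.ext _ _ fun k => by
        change ξ _ = ξ _ + ξ _
        rw [← map_add]
        congr 1
        ext p
        exact smul_add (k p) x y
      map_smul' := fun a x => DFunLike.ext _ _ fun k => by
        change ξ _ = ξ _
        congr 1
        ext p
        exact (mul_smul (k p) a x).symm }
  let φ' : M →ₗ[Λ] LinearMap.ker (nakayamaMap R J d) := φ.codRestrict _ fun x => by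
    refine DFunLike.ext _ _ fun k => ?_
    exact hξ _ ⟨LinearMap.toSpanSingleton Λ M x ∘ₗ k, rfl⟩
  have hφ : ∀ (x : M) (k : P →ₗ[Λ] Λ), ξ (LinearMap.toSpanSingleton Λ M x ∘ₗ k) = 0 := fun x k => by
    have h1 := congrArg Subtype.val (LinearMap.congr_fun (h φ') x)
    exact DFunLike.congr_fun h1 k
  refine hξg ?_
  obtain ⟨m, p, hp⟩ := Module.Finite.exists_fin' Λ P
  obtain ⟨s, hs⟩ := Module.projective_lifting_property p LinearMap.id hp
  -- By a dual basis of P, the morphism g is a sum of morphisms P ⟶ Λ ⟶ M, on all of which ξ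
  -- vanishes.
  have hdual : g = ∑ a, LinearMap.toSpanSingleton Λ M (g (p (Pi.single a 1))) ∘ₗ
      (LinearMap.proj a ∘ₗ s) := by
    ext x
    have h1 : p (s x) = x := LinearMap.congr_fun hs x
    have h2 : s x = ∑ a, s x a • (Pi.single a (1 : Λ) : Fin m → Λ) := by
      simpa using (pi_eq_sum_univ' (s x))
    conv_lhs => rw [← h1, h2]
    simp [map_sum, LinearMap.sum_apply]
  rw [hdual, map_sum]
  exact Finset.sum_eq_zero fun a _ => hφ _ _

end Duality

/-! ### Syzygies -/

section Cover

variable {Λ : Type u} [Ring Λ]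

theorem IsSuperfluous.surjective_of_comp {A B C : Type*} [AddCommGroup A] [Module Λ A]
    [AddCommGroup B] [Module Λ B] [AddCommGroup C] [Module Λ C] {p : B →ₗ[Λ] C}
    (hp : IsSuperfluous (LinearMap.ker p)) {u : A →ₗ[Λ] B}
    (h : Function.Surjective (p ∘ₗ u)) : Function.Surjective u := by
  rw [← LinearMap.range_eq_top]
  refine hp _ (eq_top_iff.2 fun b _ => ?_)
  obtain ⟨a, ha⟩ := h (p b)
  refine Submodule.mem_sup.2 ⟨u a, ⟨a, rfl⟩, b - u a, ?_, by simp⟩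
  rw [LinearMap.mem_ker, map_sub, sub_eq_zero]
  exact ha.symm

/-- The kernels of projective covers of isomorphic modules are isomorphic. -/
theorem nonempty_ker_equiv {P P' M M' : Type*} [AddCommGroup P] [Module Λ P]
    [AddCommGroup P'] [Module Λ P'] [AddCommGroup M] [Module Λ M] [AddCommGroup M'] [Module Λ M']
    [Module.Projective Λ P] [Module.Projective Λ P'] [IsNoetherian Λ P] [IsNoetherian Λ P']
    {p : P →ₗ[Λ] M} {p' : P' →ₗ[Λ] M'} (hp : Function.Surjective p) (hp' : Function.Surjective p')
    (hs : IsSuperfluous (LinearMap.ker p)) (hs' : IsSuperfluous (LinearMap.ker p'))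
    (e : M ≃ₗ[Λ] M') : Nonempty (LinearMap.ker p ≃ₗ[Λ] LinearMap.ker p') := by
  obtain ⟨u, hu⟩ := Module.projective_lifting_property p' (e.toLinearMap ∘ₗ p) hp'
  obtain ⟨w, hw⟩ := Module.projective_lifting_property p (e.symm.toLinearMap ∘ₗ p') hp
  have hus : Function.Surjective u := hs'.surjective_of_comp (by
    rw [hu]
    exact e.surjective.comp hp)
  have hws : Function.Surjective w := hs.surjective_of_comp (by
    rw [hw]
    exact e.symm.surjective.comp hp')
  have hwu : Function.Injective (w ∘ₗ u) :=
    IsNoetherian.injective_of_surjective_endomorphism (w ∘ₗ u) (hws.comp hus)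
  have hui : Function.Injective u := fun x y h => hwu (congrArg w h)
  let U := LinearEquiv.ofBijective u ⟨hui, hus⟩
  have hmap : (LinearMap.ker p).map U.toLinearMap = LinearMap.ker p' := by
    ext y
    constructor
    · rintro ⟨x, hx, rfl⟩
      exact (LinearMap.congr_fun hu x).trans (by
        rw [LinearMap.comp_apply, show p x = 0 from hx, map_zero])
    · intro hy
      obtain ⟨x, rfl⟩ := hus y
      refine ⟨x, ?_, rfl⟩
      have := (LinearMap.congr_fun hu x).symm.trans hy
      exact e.injective (this.trans (map_zero e).symm)
  exact ⟨(U.submoduleMap _).trans (LinearEquiv.ofEq _ _ hmap)⟩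

/-- If all morphisms from `P` to `M` kill the kernel of a surjection `P ⟶ N`, then so do all the
morphisms to `M` from a projective cover of `N`. -/
theorem eq_zero_of_projective_cover {P Q N M : Type*} [AddCommGroup P] [Module Λ P]
    [AddCommGroup Q] [Module Λ Q] [AddCommGroup N] [Module Λ N] [AddCommGroup M] [Module Λ M]
    [Module.Projective Λ P] [Module.Projective Λ Q] [IsNoetherian Λ Q]
    {p : P →ₗ[Λ] N} {q : Q →ₗ[Λ] N} (hp : Function.Surjective p) (hq : Function.Surjective q)
    (hs : IsSuperfluous (LinearMap.ker q))
    (h : ∀ (g : P →ₗ[Λ] M) (x : P), p x = 0 → g x = 0) (g : Q →ₗ[Λ] M) (x : Q) (hx : q x = 0) :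
    g x = 0 := by
  obtain ⟨a, ha⟩ := Module.projective_lifting_property p q hp
  obtain ⟨b, hb⟩ := Module.projective_lifting_property q p hq
  have hqba : q ∘ₗ (b ∘ₗ a) = q := by rw [← LinearMap.comp_assoc, hb, ha]
  have hsurj : Function.Surjective (b ∘ₗ a) := hs.surjective_of_comp (by rwa [hqba])
  let U := LinearEquiv.ofBijective (b ∘ₗ a)
    ⟨IsNoetherian.injective_of_surjective_endomorphism _ hsurj, hsurj⟩
  have h1 := h (g ∘ₗ U.symm.toLinearMap ∘ₗ b) (a x)
    ((LinearMap.congr_fun ha x).trans hx)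
  have h2 : U.symm (b (a x)) = x := U.symm_apply_apply x
  rwa [LinearMap.comp_apply, LinearMap.comp_apply, LinearEquiv.coe_coe, h2] at h1

namespace MinProjRes

variable {M : ModuleCat.{u} Λ} (P : MinProjRes M)

/-- The projective cover `P_k ⟶ Ω^k(M)`. -/
def cover : ∀ k : ℕ, P.complex.X k →ₗ[Λ] P.syzygy k
  | 0 => P.π₀.hom
  | 1 => (P.complex.d 1 0).hom.codRestrict (LinearMap.ker (P.π.f 0).hom) fun x =>
      LinearMap.congr_fun (congrArg ModuleCat.Hom.hom P.d_π₀) x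
  | k + 2 => (P.complex.d (k + 2) (k + 1)).hom.codRestrict
      (LinearMap.ker (P.complex.d (k + 1) k).hom) fun x =>
      LinearMap.congr_fun (congrArg ModuleCat.Hom.hom (P.complex.d_comp_d (k + 2) (k + 1) k)) x

theorem cover_surjective : ∀ k : ℕ, Function.Surjective (P.cover k)
  | 0 => (ModuleCat.epi_iff_surjective P.π₀).1 inferInstance
  | 1 => fun ⟨y, hy⟩ => by
      obtain ⟨x, hx⟩ := (ShortComplex.moduleCat_exact_iff _).1 P.exact_π₀ y hy
      exact ⟨x, Subtype.ext hx⟩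
  | k + 2 => fun ⟨y, hy⟩ => by
      obtain ⟨x, hx⟩ := (ShortComplex.moduleCat_exact_iff _).1 (P.exact_succ k) y hy
      exact ⟨x, Subtype.ext hx⟩

theorem ker_cover_succ : ∀ k : ℕ,
    LinearMap.ker (P.cover (k + 1)) = LinearMap.ker (P.complex.d (k + 1) k).hom
  | 0 => LinearMap.ker_codRestrict _ _ _
  | _ + 1 => LinearMap.ker_codRestrict _ _ _

theorem isSuperfluous_ker_cover : ∀ k : ℕ, IsSuperfluous (LinearMap.ker (P.cover k))
  | 0 => P.superfluous_zero
  | k + 1 => by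
      rw [ker_cover_succ]
      exact P.superfluous_succ k

/-- The kernel of the projective cover of `Ω^k(M)` is `Ω^{k+1}(M)`. -/
def kerCoverEquiv : ∀ k : ℕ, LinearMap.ker (P.cover k) ≃ₗ[Λ] P.syzygy (k + 1)
  | 0 => LinearEquiv.refl _ _
  | k + 1 => LinearEquiv.ofEq _ _ (P.ker_cover_succ k)

theorem moduleProjective (k : ℕ) : Module.Projective Λ (P.complex.X k) :=
  (IsProjective.iff_projective _).2 (P.projective k)

/-- The syzygies do not depend on the minimal projective resolution. -/
theorem nonempty_syzygy_equiv [IsNoetherianRing Λ] (P' : MinProjRes M) (k : ℕ) :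
    Nonempty (P.syzygy k ≃ₗ[Λ] P'.syzygy k) := by
  induction k with
  | zero => exact ⟨LinearEquiv.refl _ _⟩
  | succ k ih =>
    obtain ⟨e⟩ := ih
    have := P.finite k
    have := P'.finite k
    have := P.moduleProjective k
    have := P'.moduleProjective k
    obtain ⟨f⟩ := nonempty_ker_equiv (P.cover_surjective k) (P'.cover_surjective k)
      (P.isSuperfluous_ker_cover k) (P'.isSuperfluous_ker_cover k) e
    exact ⟨(P.kerCoverEquiv k).symm.trans (f.trans (P'.kerCoverEquiv k))⟩

/-- Dimension shifting along the sequences 0 ⟶ Ω^{m+1} ⟶ P_m ⟶ Ω^m ⟶ 0, descending from Ω^n to Ω^0 =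
M. -/
theorem hasProjectiveDimensionLE_of_syzygy (n : ℕ) (h : Module.Projective Λ (P.syzygy n)) :
    HasProjectiveDimensionLE M n := by
  suffices key : ∀ k : ℕ, k ≤ n → HasProjectiveDimensionLE (P.syzygy (n - k)) k by
    have := key n le_rfl
    rw [Nat.sub_self] at this
    exact this
  intro k
  induction k with
  | zero =>
    intro _
    rw [Nat.sub_zero]
    exact (projective_iff_hasProjectiveDimensionLE_zero _).1
      ((IsProjective.iff_projective _).1 h)
  | succ k ih =>
    intro hk
    have h1 := ih (by lia)
    obtain ⟨m, hm⟩ : ∃ m, n - k = m + 1 := ⟨n - k - 1, by lia⟩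
    have hm' : n - (k + 1) = m := by lia
    rw [hm] at h1
    rw [hm']
    let i : P.syzygy (m + 1) ⟶ P.complex.X m :=
      ModuleCat.ofHom ((LinearMap.ker (P.cover m)).subtype ∘ₗ (P.kerCoverEquiv m).symm.toLinearMap)
    let p : P.complex.X m ⟶ P.syzygy m := ModuleCat.ofHom (P.cover m)
    have hip : i ≫ p = 0 := by
      ext x
      exact ((P.kerCoverEquiv m).symm x).2
    let S := ShortComplex.mk i p hip
    have hS : S.ShortExact :=
      { exact := (ShortComplex.moduleCat_exact_iff _).2 fun x hx =>
          ⟨P.kerCoverEquiv m ⟨x, hx⟩, congrArg Subtype.val ((P.kerCoverEquiv m).symm_apply_apply _)⟩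
        mono_f := (ModuleCat.mono_iff_injective _).2
          (Subtype.val_injective.comp (P.kerCoverEquiv m).symm.injective)
        epi_g := (ModuleCat.epi_iff_surjective _).2 (P.cover_surjective m) }
    exact (hS.hasProjectiveDimensionLT_X₃_iff k (P.projective m)).2 h1

end MinProjRes

end Cover

/-! ### Morphisms between the truncation and its shift -/

section Rigid

variable {Λ : Type u} [Ring Λ] {M : ModuleCat.{u} Λ}

/-- A lift P_n ⟶ P_0 of g, placed in degree -n, is a chain map T ⟶ T⟦n⟧, hence null-homotopic. On
the kernel of the differential only the part of the homotopy through P_1 ⟶ P_0 survives, and this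
dies in M. -/
theorem MinProjRes.eq_zero_of_isPresilting (P : MinProjRes M) {n : ℕ} (hn : 1 ≤ n)
    (hP : IsPresilting (P.truncObj n)) (g : P.complex.X n →ₗ[Λ] M) (x : P.complex.X n)
    (hx : (P.complex.d n (n - 1)).hom x = 0) : g x = 0 := by
  have := P.moduleProjective n
  obtain ⟨g', hg⟩ := Module.projective_lifting_property P.π₀.hom g
    ((ModuleCat.epi_iff_surjective P.π₀).1 inferInstance)
  let a := P.truncXIso n (-n) n rfl le_rfl
  let b := P.truncXIso n (-n + n) 0 (by simp) (by lia)
  let φ : (P.trunc n).X (-n) ⟶ ((P.trunc n)⟦(n : ℤ)⟧).X (-n) :=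
    a.hom ≫ ModuleCat.ofHom g' ≫ b.inv
  let f : P.trunc n ⟶ (P.trunc n)⟦(n : ℤ)⟧ :=
    { f := fun i => if hi : i = -n then
        ((P.trunc n).XIsoOfEq hi).hom ≫ φ ≫ (((P.trunc n)⟦(n : ℤ)⟧).XIsoOfEq hi).inv else 0
      comm' := fun i j hij => by
        have hij' : i + 1 = j := hij
        by_cases hi : i = -n
        · exact (P.isZero_trunc_of_gt n (j + n) (by lia)).eq_of_tgt _ _
        · by_cases hi' : i < -n
          · exact (P.isZero_trunc_of_lt n i hi').eq_of_src _ _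
          · exact (P.isZero_trunc_of_gt n (j + n) (by lia)).eq_of_tgt _ _ }
  have hf : f.f (-n) = φ := by
    simp only [f, dite_true, HomologicalComplex.XIsoOfEq_rfl, Iso.refl_hom, Iso.refl_inv,
      Category.id_comp]
    exact Category.comp_id φ
  have hz : KbProj.homMk (hK := P.isBoundedProj_trunc n)
      (hL := (P.isBoundedProj_trunc n).shift n) f = 0 := by
    rw [← cancel_mono (KbProj.shiftIso (P.trunc n) (P.isBoundedProj_trunc n) n).inv, zero_comp]
    exact hP n (by lia) _
  obtain ⟨h⟩ := (KbProj.homMk_eq_zero_iff f).1 hz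
  have hc := h.comm (-n)
  rw [dNext_eq _ (show (ComplexShape.up ℤ).Rel (-n : ℤ) (-n + 1) by simp),
    prevD_eq _ (show (ComplexShape.up ℤ).Rel (-n - 1 : ℤ) (-n) by simp), hf,
    HomologicalComplex.zero_f, add_zero] at hc
  have hy : ((P.trunc n).d (-n) (-n + 1)).hom (a.inv.hom x) = 0 := by
    have e := P.trunc_d_apply n (-n) (-n + 1) n (n - 1) rfl (by lia) le_rfl (by lia) (a.inv.hom x)
    have hax : a.hom.hom (a.inv.hom x) = x := by simp
    rw [hax, hx] at e
    exact (P.truncXIso n (-n + 1) (n - 1) (by lia) (by lia)).toLinearEquiv.injective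
      (e.trans (map_zero _).symm)
  have hφ : φ.hom (a.inv.hom x) =
      (((P.trunc n)⟦(n : ℤ)⟧).d (-n - 1) (-n)).hom ((h.hom (-n) (-n - 1)).hom (a.inv.hom x)) := by
    refine (LinearMap.congr_fun (congrArg ModuleCat.Hom.hom hc) (a.inv.hom x)).trans ?_
    refine (congrArg (· + _) ((congrArg (h.hom (-n + 1) (-n)).hom hy).trans (map_zero _))).trans ?_
    exact zero_add _
  have hb : b.hom.hom (φ.hom (a.inv.hom x)) = g' x := by
    have e : a.inv ≫ (a.hom ≫ ModuleCat.ofHom g' ≫ b.inv) ≫ b.hom = ModuleCat.ofHom g' := by simp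
    exact LinearMap.congr_fun (congrArg ModuleCat.Hom.hom e) x
  have key : ∀ w : (P.trunc n).X (-n - 1 + n),
      P.π₀.hom (b.hom.hom (((P.trunc n).d (-n - 1 + n) (-n + n)).hom w)) = 0 := fun w => by
    have e := P.trunc_d_apply n (-n - 1 + n) (-n + n) 1 0 (by push_cast; lia) (by simp) hn (by lia) w
    refine (congrArg P.π₀.hom e).trans ?_
    exact LinearMap.congr_fun (congrArg ModuleCat.Hom.hom P.d_π₀) _
  rw [← hg, LinearMap.comp_apply, ← hb, hφ]
  obtain h' | h' := shift_d_apply (P.trunc n) n (-n - 1) (-n)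
  · exact (congrArg (fun z => P.π₀.hom (b.hom.hom z)) (h' _)).trans (key _)
  · refine (congrArg (fun z => P.π₀.hom (b.hom.hom z)) (h' _)).trans ?_
    refine (congrArg P.π₀.hom (map_neg b.hom.hom _)).trans ?_
    exact (map_neg P.π₀.hom _).trans (neg_eq_zero.2 (key _))

variable {R : Type v} [CommRing R] [IsArtinianRing R] [Algebra R Λ] [Module.Finite R Λ]

/-- Silting and rigidity come with their own resolutions P and P', which are compared through their
isomorphic n-th syzygies. -/
theorem moduleProjective_syzygy {n : ℕ} (hn : 1 ≤ n) {P : MinProjRes M}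
    (hP : IsSilting (P.truncObj n)) (P' : MinProjRes M) (Q : MinProjRes (P'.syzygy n))
    {J : Type v} [AddCommGroup J] [Module R J] {ι : (R ⧸ Ring.jacobson R) →ₗ[R] J}
    (hι : IsInjectiveEnvelope R ι) (hτ : ∀ f : M →ₗ[Λ] Q.tau R J, f = 0) :
    Module.Projective Λ (P'.syzygy n) := by
  have : IsArtinianRing Λ := IsArtinianRing.of_finite R Λ
  obtain ⟨e⟩ := P.nonempty_syzygy_equiv P' n
  have := P.moduleProjective n
  have := Q.moduleProjective
  have := Q.finite
  have hQ₀ : ∀ (g : Q.complex.X 0 →ₗ[Λ] M) (x : Q.complex.X 0), Q.cover 0 x = 0 → g x = 0 := by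
    refine eq_zero_of_projective_cover (p := e.toLinearMap ∘ₗ P.cover n)
      (e.surjective.comp (P.cover_surjective n)) (Q.cover_surjective 0)
      (Q.isSuperfluous_ker_cover 0) fun g x hx => ?_
    refine P.eq_zero_of_isPresilting hn hP.presilting g x ?_
    obtain ⟨m, rfl⟩ := Nat.exists_eq_add_of_le' hn
    have hx' : x ∈ LinearMap.ker (P.cover (m + 1)) := e.injective (hx.trans (map_zero e).symm)
    rw [P.ker_cover_succ] at hx'
    exact hx'
  -- Rigidity extends g to Q₀, and presilting makes the extension vanish on the image of Q₁, so g =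
  -- 0; sincerity of M then forces Q₁ = 0.
  have hQ₁ : ∀ g : Q.complex.X 1 →ₗ[Λ] M, g = 0 := fun g => by
    obtain ⟨g', rfl⟩ := exists_comp_eq_of_forall_eq_zero hι (Q.complex.d 1 0).hom hτ g
    ext x
    exact hQ₀ g' _ (LinearMap.congr_fun (congrArg ModuleCat.Hom.hom Q.d_π₀) x)
  have hsub : Subsingleton (Q.complex.X 1) := by
    rw [← not_nontrivial_iff_subsingleton]
    intro _
    obtain ⟨f, hf⟩ := IsSincere.exists_ne_zero
      (isSincere_of_isTauTilting (R := R) hn ⟨P, hP⟩) (Q.complex.X 1)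
    exact hf (hQ₁ f)
  refine Module.Projective.of_equiv (LinearEquiv.ofBijective (Q.cover 0)
    ⟨(injective_iff_map_eq_zero _).2 fun x hx => ?_, Q.cover_surjective 0⟩)
  obtain ⟨y, hy⟩ := (ShortComplex.moduleCat_exact_iff _).1 Q.exact_π₀ x hx
  rw [← hy, Subsingleton.elim y 0]
  exact map_zero _

theorem hasProjectiveDimensionLE_of_isTauRigid {n : ℕ} (hn : 1 ≤ n) (hM : IsTauTilting n M)
    (hM' : IsTauRigid R (n + 1) M) : HasProjectiveDimensionLE M n := by
  obtain ⟨P, hP⟩ := hM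
  obtain ⟨⟨P', Q, J, _, _, ι, hι, hτ⟩, -⟩ := hM'
  exact P'.hasProjectiveDimensionLE_of_syzygy n (moduleProjective_syzygy hn hP P' Q hι hτ)

end Rigid

end TauTilting

end

theorem mainTheorem5 {R : Type v} [CommRing R] [IsArtinianRing R]
    {Λ : Type u} [Ring Λ] [Algebra R Λ] [Module.Finite R Λ]
    (n : ℕ) (hn : 1 ≤ n) (M : ModuleCat.{u} Λ) [Module.Finite Λ M]
    (hM : TauTilting.IsTauTilting n M) :
    (TauTilting.IsSincere M ∧ TauTilting.rk M = TauTilting.rk (ModuleCat.of Λ Λ)) ∧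
      (¬ TauTilting.IsTauRigid R (n + 1) M ∨ HasProjectiveDimensionLE M n) :=
  ⟨⟨TauTilting.isSincere_of_isTauTilting (R := R) hn hM,
    TauTilting.rk_eq_of_isTauTilting (R := R) hn hM⟩,
    or_iff_not_imp_left.2 fun h =>
      TauTilting.hasProjectiveDimensionLE_of_isTauRigid hn hM (not_not.1 h)⟩
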